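/- **Proposition (magneto-mechanical dissipation energy balance).** Let $d\in\{2,3\}$, let $\Omega\subset\mathbb R^d$ be a bounded open set with smooth boundary $\Gamma$, unit outward normal $n$ and surface measure $dS$. Conventions: $(\nabla v)_{ij}=\partial_jv_i$, $(\nabla^2v)_{ijk}=\partial_k\partial_jv_i$, $e(v)=\frac12(\nabla v+\nabla v^\top)$, $\mathrm{skw}A=\frac12(A-A^\top)$, divergences act on the last index, $|\cdot|$ are Euclidean/Frobenius norms, $\mathrm{div}_S$ is the surface divergence, $[\cdot]_t$ the tangential part, $\dot m=\partial_tm+(v\cdot\nabla)m$ and $\overset{\circ}{m}=\dot m-\mathrm{skw}(\nabla v)\,m$. $\mathrm{Dir}(0)$ is the closed unit ball and $\mathrm{Dir}(r)=\{r/|r|\}$ for $r\ne0$. For $d=2$, $\times$ means the in-plane part of the vector product (i.e. $0$). *Data.* Constants $p\ge1$, $\mu_0,\tau,\nu_1,\nu_2,\nu_\flat$; functions $\varphi(F,m)$, $\kappa(F)$ of class $C^1$ for $\det F>0$; $\zeta(F,m,\theta)$, differentiable in $(F,m)$ with derivative continuous in $(F,m,\theta)$, for $\det F>0$, $\theta\ge0$;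 $h_c(F,\theta)$; $\gamma(F,m,\theta)>0$; loads $g$, $k$ and $h_{\rm ext}$, the last one $C^1$ on $(0,T)\times\bar\Omega$. Put $\psi'_m=\varphi'_m+\zeta'_m$. *System.* Let $(\varrho,v,F,m,u)$ be a smooth solution, with a given continuous temperature field $\theta\ge0$ and with $\det F>0$ on $\bar\Omega$, for $t\in(0,T)$, of $$\partial_t\varrho=-\mathrm{div}(\varrho v),\qquad \partial_tF=(\nabla v)F-(v\cdot\nabla)F,$$ $$\partial_t(\varrho v)=\mathrm{div}\big(T+K+S+D-\mathrm{div}(\mathscr H+\mathscr S)-\varrho v\otimes v\big)+\mu_0(\nabla h)^\top m-\mu_0\nabla(h\cdot m)+\varrho g,$$ $$\tau\overset{\circ}{m}+h_c(F,\theta)\,\mathrm{Dir}(\overset{\circ}{m})-\frac{m\times\overset{\circ}{m}}{\gamma(F,m,\theta)}\ni\mu_0h-\frac{\psi_m'(F,m,\theta)}{\det F}+\mathrm{div}\Big(\frac{\kappa(F)}{\det F}\nabla m\Big)$$ in $\Omega$, and $\mathrm{div}(\nabla u-\chi_\Omega m)=0$ on $\mathbb R^d$ in the sense of distributions, where $h=h_{\rm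 ext}+\nabla u$ and $$T=\Big(\frac{\varphi_F'+\zeta_F'}{\det F}+\frac{|\nabla m|^2\kappa'(F)}{2\det F}\Big)F^\top,\quad K=-\frac{\kappa(F)}{\det F}\nabla m\otimes\nabla m,\quad S=\mathrm{skw}\Big(m\otimes\Big(\mu_0h-\frac{\psi_m'}{\det F}\Big)\Big),$$ $$D=\nu_1|e(v)|^{p-2}e(v),\quad \mathscr H=\nu_2|\nabla^2v|^{p-2}\nabla^2v,\quad \mathscr S=\frac{\kappa(F)}{\det F}\,\mathrm{Skw}(\nabla m\otimes m),$$ with $(\nabla m\otimes\nabla m)_{ij}=\sum_k\partial_im_k\,\partial_jm_k$ and $\mathrm{Skw}(\nabla m\otimes m)_{ijk}=\frac12(\partial_km_i\,m_j-m_i\,\partial_km_j)$, and with the boundary conditions on $\Gamma$ $$v\cdot n=0,\qquad\big[(T+K+S+D-\mathrm{div}(\mathscr H+\mathscr S))n-\mathrm{div}_S((\mathscr H+\mathscr S)n)\big]_t+\nu_\flat|v|^{p-2}v=k,$$ $$\nabla^2v:(n\otimes n)=0,\qquad (n\cdot\nabla)m=0,$$ and $u(x)\to0$ as $|x|\to\infty$.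 Here smooth means: $\varrho,v,F,m,u$ are $C^\infty$ on $(0,T)\times\bar\Omega$ (up to the boundary), at each time $T,S,D$ are $C^1$ and $\mathscr H,\mathscr S$ are $C^2$ on $\bar\Omega$, and $u$ is locally Lipschitz on $\mathbb R^d$ with $\nabla u\in L^2(\mathbb R^d)$. *Claim.* If $\zeta(\cdot,m,\theta)$ is frame indifferent, i.e. $\zeta(QF,m,\theta)=\zeta(F,m,\theta)$ for all $Q\in SO(d)$, then for every $t\in(0,T)$ all the integrals below exist, the energy is differentiable in time, and $$\frac{d}{dt}\bigg(\int_\Omega\frac\varrho2|v|^2+\frac{\varphi(F,m)}{\det F}+\frac{\kappa(F)|\nabla m|^2}{2\det F}-\mu_0h\cdot m\,dx+\int_{\mathbb R^d}\frac{\mu_0}2|\nabla u|^2dx\bigg)$$ $$+\int_\Omega\nu_1|e(v)|^p+\nu_2|\nabla^2v|^p+\tau|\overset{\circ}{m}|^2+h_c(F,\theta)|\overset{\circ}{m}|\,dx+\int_\Gamma\nu_\flat|v|^p\,dS$$ $$=\int_\Omega\varrho\,g\cdot v-\mu_0\,\partial_th_{\rm ext}\cdot m-\frac{\zeta_F'(F,m,\theta)F^\top}{\det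 F}:e(v)-\frac{\zeta_m'(F,m,\theta)}{\det F}\cdot\dot m\,dx+\int_\Gamma k\cdot v\,dS.$$ Without the frame indifference of $\zeta(\cdot,m,\theta)$ the same holds with $\nabla v$ in place of $e(v)$ on the right-hand side. -/

import Mathlib

open MeasureTheory Set Filter Topology
open scoped ContDiff Matrix

/- Matrices carry the (finite-dimensional) sup norm, for the purposes of differential calculus only.
The Frobenius norms that occur in the equations are written out explicitly below. -/
attribute [local instance] Matrix.normedAddCommGroup Matrix.normedSpace

namespace Magneto

noncomputable section

/-- The physical space `ℝ^d` with its Euclidean norm. -/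
abbrev E (d : ℕ) : Type := EuclideanSpace ℝ (Fin d)

/-- `d × d` matrices. -/
abbrev Mat (d : ℕ) : Type := Matrix (Fin d) (Fin d) ℝ

/-- Third-order tensors. -/
abbrev Ten (d : ℕ) : Type := Fin d → Fin d → Fin d → ℝ

/-! ### Algebra of vectors, matrices and third-order tensors -/

section Algebra

variable {d : ℕ}

/-- Symmetric part of a matrix. -/
def sym (A : Mat d) : Mat d := (1 / 2 : ℝ) • (A + Aᵀ)

/-- Skew-symmetric part of a matrix. -/
def skw (A : Mat d) : Mat d := (1 / 2 : ℝ) • (A - Aᵀ)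

/-- `A : B = ∑ᵢⱼ Aᵢⱼ Bᵢⱼ`. -/
def ddot (A B : Mat d) : ℝ := ∑ i, ∑ j, A i j * B i j

/-- The Frobenius norm of a matrix. -/
def frob (A : Mat d) : ℝ := √(∑ i, ∑ j, A i j ^ 2)

/-- The Frobenius norm of a third-order tensor. -/
def frob3 (G : Ten d) : ℝ := √(∑ i, ∑ j, ∑ k, G i j k ^ 2)

/-- `a ⊗ b`. -/
def outer (a b : E d) : Mat d := Matrix.of fun i j => a i * b j

/-- The vector `A x`. -/
def mulV (A : Mat d) (x : E d) : E d := WithLp.toLp 2 (A *ᵥ x.ofLp)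

/-- The matrix `(G n)ᵢⱼ = ∑ₖ Gᵢⱼₖ nₖ`. -/
def tenMulV (G : Ten d) (n : E d) : Mat d := Matrix.of fun i j => ∑ k, G i j k * n k

/-- A vector of `ℝ^d`, `d ≤ 3`, regarded as a vector of `ℝ³`. -/
def pad (a : E d) : Fin 3 → ℝ := fun i => if hi : (i : ℕ) < d then a ⟨i, hi⟩ else 0

/-- The vector product: for `d = 3` it is the usual one. For `d = 2` it is the in-plane part of the
vector product in `ℝ³` of two planar vectors (hence zero). -/
def cross (a b : E d) : E d :=
  WithLp.toLp 2 fun i => if hi : (i : ℕ) < 3 then (crossProduct (pad a) (pad b)) ⟨i, hi⟩ else 0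

/-- The set-valued direction mapping: the closed unit ball at `r = 0`, and `{r / |r|}` otherwise. -/
def Dir (r : E d) : Set (E d) := {e | (r = 0 ∧ ‖e‖ ≤ 1) ∨ (r ≠ 0 ∧ e = ‖r‖⁻¹ • r)}

/-- The matrix of partial derivatives `∂f/∂Fᵢⱼ` of a function of a matrix. -/
def matDeriv (f : Mat d → ℝ) (F : Mat d) : Mat d :=
  Matrix.of fun i j => fderiv ℝ f F (Matrix.single i j 1)

end Algebra

/-! ### Domains and differential operators -/

/-- A bounded open set with smooth boundary, given by a smooth defining function: it is the set
where the function is negative, and the gradient does not vanish on the zero set (which is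
then the boundary). -/
structure SmoothDomain (d : ℕ) where
  /-- the open set -/
  carrier : Set (E d)
  /-- a defining function -/
  defFun : E d → ℝ
  smooth : ContDiff ℝ ∞ defFun
  carrier_eq : carrier = {x | defFun x < 0}
  regular : ∀ x, defFun x = 0 → gradient defFun x ≠ 0
  bounded : Bornology.IsBounded carrier

namespace SmoothDomain

variable {d : ℕ} (Ω : SmoothDomain d)

/-- The closure of the domain. -/
def closed : Set (E d) := closure Ω.carrier

/-- The boundary of the domain. -/
def bdry : Set (E d) := frontier Ω.carrier

/-- The unit outward normal on the boundary (and a smooth extension of it to a neighbourhood). -/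
def normal (x : E d) : E d := ‖gradient Ω.defFun x‖⁻¹ • gradient Ω.defFun x

/-- The surface measure on the boundary: the `(d-1)`-dimensional Hausdorff measure, normalized so as
to agree with the Lebesgue measure on `(d-1)`-dimensional planes. -/
def surf : Measure (E d) := (μHE[d - 1] : Measure (E d)).restrict Ω.bdry

/-- The partial derivative `∂ⱼ f`, in the domain and up to the boundary (one-sided there). -/
def pd (f : E d → ℝ) (j : Fin d) (x : E d) : ℝ :=
  fderivWithin ℝ f Ω.closed x (EuclideanSpace.single j 1)

/-- The gradient of a scalar field. -/
def grad (f : E d → ℝ) (x : E d) : E d := WithLp.toLp 2 fun j => Ω.pd f j x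

/-- The gradient of a vector field, `(∇v)ᵢⱼ = ∂ⱼ vᵢ`. -/
def gradV (v : E d → E d) (x : E d) : Mat d := Matrix.of fun i j => Ω.pd (fun y => v y i) j x

/-- The second gradient of a vector field, `(∇²v)ᵢⱼₖ = ∂ₖ ∂ⱼ vᵢ`. -/
def grad2 (v : E d → E d) (x : E d) : Ten d :=
  fun i j k => Ω.pd (fun y => Ω.gradV v y i j) k x

/-- The divergence of a vector field. -/
def divV (v : E d → E d) (x : E d) : ℝ := ∑ j, Ω.pd (fun y => v y j) j x

/-- The row-wise divergence of a matrix field, `(div A)ᵢ = ∑ⱼ ∂ⱼ Aᵢⱼ`. -/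
def divM (A : E d → Mat d) (x : E d) : E d :=
  WithLp.toLp 2 fun i => ∑ j, Ω.pd (fun y => A y i j) j x

/-- The divergence of a third-order tensor field, `(div G)ᵢⱼ = ∑ₖ ∂ₖ Gᵢⱼₖ`. -/
def divT (G : E d → Ten d) (x : E d) : Mat d :=
  Matrix.of fun i j => ∑ k, Ω.pd (fun y => G y i j k) k x

/-- The surface divergence of a matrix field on the boundary,
`(div_S A)ᵢ = ∑ⱼ (∇_S Aᵢⱼ)ⱼ` with the surface gradient `∇_S f = ∇f - (∂f/∂n) n`. -/
def surfDiv (A : E d → Mat d) (x : E d) : E d :=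
  WithLp.toLp 2 fun i => ∑ j, (Ω.pd (fun y => A y i j) j x -
    (∑ k, Ω.pd (fun y => A y i j) k x * Ω.normal x k) * Ω.normal x j)

/-- The tangential part of a vector at a boundary point. -/
def tangential (w : E d) (x : E d) : E d := w - (inner ℝ w (Ω.normal x)) • Ω.normal x

end SmoothDomain

/-! ### Material, loading, fields -/

/-- The material: referential stored energy `φ(F,m)`, thermal part `ζ(F,m,θ)` of the referential free
energy, exchange coefficient `κ(F)`, coercive force `h_c(F,θ)`, gyromagnetic ratio `γ(F,m,θ)`, and
constants. Only the values at matrices with positive determinant and at temperatures `θ ≥ 0`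
matter. -/
structure Material (d : ℕ) where
  φ : Mat d → E d → ℝ
  ζ : Mat d → E d → ℝ → ℝ
  κ : Mat d → ℝ
  hc : Mat d → ℝ → ℝ
  γ : Mat d → E d → ℝ → ℝ
  /-- vacuum permeability -/
  μ₀ : ℝ
  /-- magnetic damping coefficient -/
  τ : ℝ
  /-- bulk viscosity, hyperviscosity and boundary viscosity -/
  ν₁ : ℝ
  ν₂ : ℝ
  νb : ℝ
  /-- the exponent of the viscosities -/
  p : ℝ
  one_le_p : 1 ≤ p
  γ_pos : ∀ F m θ, 0 < F.det → 0 ≤ θ → 0 < γ F m θ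
  φ_C1 : ContDiffOn ℝ 1 (fun q : Mat d × E d => φ q.1 q.2) {q | 0 < q.1.det}
  κ_C1 : ContDiffOn ℝ 1 κ {F | 0 < F.det}
  /-- `ζ` is continuously differentiable in `(F,m)`, with derivative continuous in `(F,m,θ)` -/
  ζ_diff : ∀ θ, 0 ≤ θ → ∀ F m, 0 < F.det →
    DifferentiableAt ℝ (fun q : Mat d × E d => ζ q.1 q.2 θ) (F, m)
  ζ_C1 : ContinuousOn
    (fun r : Mat d × E d × ℝ => fderiv ℝ (fun q : Mat d × E d => ζ q.1 q.2 r.2.2) (r.1, r.2.1))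
    {r | 0 < r.1.det ∧ 0 ≤ r.2.2}

/-- Frame indifference of `ζ(·,m,θ)`. -/
def Material.ThermalFrameIndifferent {d : ℕ} (M : Material d) : Prop :=
  ∀ Q ∈ Matrix.specialOrthogonalGroup (Fin d) ℝ, ∀ F m θ, 0 < F.det → 0 ≤ θ →
    M.ζ (Q * F) m θ = M.ζ F m θ

/-- The loading: gravity acceleration, external magnetic field, boundary traction. -/
structure Loads (d : ℕ) where
  g : ℝ → E d → E d
  hext : ℝ → E d → E d
  k : ℝ → E d → E d

/-- The unknown fields, as functions of time and place: mass density, velocity, deformation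
gradient, magnetization, demagnetizing-field potential; and the temperature. -/
structure Fields (d : ℕ) where
  ρ : ℝ → E d → ℝ
  v : ℝ → E d → E d
  F : ℝ → E d → Mat d
  m : ℝ → E d → E d
  u : ℝ → E d → ℝ
  θ : ℝ → E d → ℝ

section System

variable {d : ℕ} (Ω : SmoothDomain d) (M : Material d) (L : Loads d) (s : Fields d)

/-! #### Derived quantities -/

/-- The magnetic field `h = h_ext + ∇u` in the body. -/
def hField (t : ℝ) (x : E d) : E d := L.hext t x + Ω.grad (s.u t) x

/-- The small strain rate `e(v)`. -/
def strainRate (t : ℝ) (x : E d) : Mat d := sym (Ω.gradV (s.v t) x)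

/-- The convective time derivative of the magnetization, `∂m/∂t + (v·∇)m`. -/
def mDot (t : ℝ) (x : E d) : E d :=
  deriv (fun r => s.m r x) t + mulV (Ω.gradV (s.m t) x) (s.v t x)

/-- The corotational (Zaremba–Jaumann) time derivative of the magnetization. -/
def mZJ (t : ℝ) (x : E d) : E d :=
  mDot Ω s t x - mulV (skw (Ω.gradV (s.v t) x)) (s.m t x)

/-- `ζ'_F(F,m,θ)` along the fields. -/
def zetaF (t : ℝ) (x : E d) : Mat d :=
  matDeriv (fun G => M.ζ G (s.m t x) (s.θ t x)) (s.F t x)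

/-- `ζ'_m(F,m,θ)` along the fields. -/
def zetaM (t : ℝ) (x : E d) : E d :=
  gradient (fun a => M.ζ (s.F t x) a (s.θ t x)) (s.m t x)

/-- `φ'_F(F,m)` along the fields. -/
def phiF (t : ℝ) (x : E d) : Mat d := matDeriv (fun G => M.φ G (s.m t x)) (s.F t x)

/-- `φ'_m(F,m)` along the fields. -/
def phiM (t : ℝ) (x : E d) : E d := gradient (fun a => M.φ (s.F t x) a) (s.m t x)

/-- `|∇m|²`. -/
def gradMsq (t : ℝ) (x : E d) : ℝ := frob (Ω.gradV (s.m t) x) ^ 2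

/-- The actual exchange coefficient `κ(F) / det F`. -/
def exch (t : ℝ) (x : E d) : ℝ := M.κ (s.F t x) / (s.F t x).det

/-- The magnetic driving field `μ₀ h - ψ'_m(F,m,θ) / det F` without its exchange part. -/
def drive (t : ℝ) (x : E d) : E d :=
  M.μ₀ • hField Ω L s t x - ((s.F t x).det)⁻¹ • (phiM M s t x + zetaM M s t x)

/-- The conservative Cauchy stress `T`. -/
def stressT (t : ℝ) (x : E d) : Mat d :=
  ((s.F t x).det)⁻¹ • ((phiF M s t x + zetaF M s t x +
    (gradMsq Ω s t x / 2) • matDeriv M.κ (s.F t x)) * (s.F t x)ᵀ)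

/-- The capillarity-like stress `K = -(κ(F)/det F) ∇m ⊗ ∇m`, where
`(∇m ⊗ ∇m)ᵢⱼ = ∑ₖ ∂ᵢmₖ ∂ⱼmₖ`. -/
def stressK (t : ℝ) (x : E d) : Mat d :=
  -(exch M s t x • ((Ω.gradV (s.m t) x)ᵀ * Ω.gradV (s.m t) x))

/-- The skew-symmetric magnetic stress `S = skw (m ⊗ (μ₀ h - ψ'_m / det F))`. -/
def stressS (t : ℝ) (x : E d) : Mat d := skw (outer (s.m t x) (drive Ω M L s t x))

/-- The viscous stress `D = ν₁ |e(v)|^(p-2) e(v)`. -/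
def stressD (t : ℝ) (x : E d) : Mat d :=
  (M.ν₁ * frob (strainRate Ω s t x) ^ (M.p - 2)) • strainRate Ω s t x

/-- The viscous hyperstress `ν₂ |∇²v|^(p-2) ∇²v`. -/
def hyperH (t : ℝ) (x : E d) : Ten d :=
  (M.ν₂ * frob3 (Ω.grad2 (s.v t) x) ^ (M.p - 2)) • Ω.grad2 (s.v t) x

/-- The skew-symmetric magnetic hyperstress `(κ(F)/det F) Skw(∇m ⊗ m)`, where
`Skw(∇m ⊗ m)ᵢⱼₖ = (∂ₖmᵢ mⱼ - mᵢ ∂ₖmⱼ) / 2`. -/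
def hyperS (t : ℝ) (x : E d) : Ten d := fun i j k =>
  exch M s t x * ((Ω.gradV (s.m t) x i k * s.m t x j - s.m t x i * Ω.gradV (s.m t) x j k) / 2)

/-- The sum of the hyperstresses. -/
def hyper (t : ℝ) (x : E d) : Ten d := hyperH Ω M s t x + hyperS Ω M s t x

/-- The total Cauchy stress `T + K + S + D - div (hyperstresses)`. -/
def stress (t : ℝ) (x : E d) : Mat d :=
  stressT Ω M s t x + stressK Ω M s t x + stressS Ω M L s t x + stressD Ω M s t x -
    Ω.divT (hyper Ω M s t) x

/-- The magnetic force `μ₀ (∇h)ᵀ m - μ₀ ∇(h·m)`. -/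
def magForce (t : ℝ) (x : E d) : E d :=
  M.μ₀ • mulV (Ω.gradV (hField Ω L s t) x)ᵀ (s.m t x) -
    M.μ₀ • Ω.grad (fun y => inner ℝ (hField Ω L s t y) (s.m t y)) x

/-! #### Smooth solutions of the magneto-mechanical subsystem -/

/-- Smooth solutions on the time interval `(0, T)`: the fields are smooth up to the boundary, the
equations hold in the domain, the boundary conditions hold on the boundary. The temperature is a
given continuous nonnegative field. -/
structure IsSmoothSolution (T : ℝ) : Prop where
  -- regularity of the fields and of the external magnetic field
  smooth_ρ : ContDiffOn ℝ ∞ (fun q : ℝ × E d => s.ρ q.1 q.2) (Ioo 0 T ×ˢ Ω.closed)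
  smooth_v : ContDiffOn ℝ ∞ (fun q : ℝ × E d => s.v q.1 q.2) (Ioo 0 T ×ˢ Ω.closed)
  smooth_F : ContDiffOn ℝ ∞ (fun q : ℝ × E d => s.F q.1 q.2) (Ioo 0 T ×ˢ Ω.closed)
  smooth_m : ContDiffOn ℝ ∞ (fun q : ℝ × E d => s.m q.1 q.2) (Ioo 0 T ×ˢ Ω.closed)
  smooth_u : ContDiffOn ℝ ∞ (fun q : ℝ × E d => s.u q.1 q.2) (Ioo 0 T ×ˢ Ω.closed)
  smooth_hext : ContDiffOn ℝ 1 (fun q : ℝ × E d => L.hext q.1 q.2) (Ioo 0 T ×ˢ Ω.closed)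
  cont_θ : ∀ t ∈ Ioo 0 T, ContinuousOn (s.θ t) Ω.closed
  θ_nonneg : ∀ t ∈ Ioo 0 T, ∀ x ∈ Ω.closed, 0 ≤ s.θ t x
  det_pos : ∀ t ∈ Ioo 0 T, ∀ x ∈ Ω.closed, 0 < (s.F t x).det
  -- the stresses are regular enough for the momentum equation to hold classically
  -- (automatic for smooth material data and `p > 3`)
  stressT_C1 : ∀ t ∈ Ioo 0 T, ContDiffOn ℝ 1 (stressT Ω M s t) Ω.closed
  stressS_C1 : ∀ t ∈ Ioo 0 T, ContDiffOn ℝ 1 (stressS Ω M L s t) Ω.closed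
  stressD_C1 : ∀ t ∈ Ioo 0 T, ContDiffOn ℝ 1 (stressD Ω M s t) Ω.closed
  hyperH_C2 : ∀ t ∈ Ioo 0 T, ContDiffOn ℝ 2 (hyperH Ω M s t) Ω.closed
  hyperS_C2 : ∀ t ∈ Ioo 0 T, ContDiffOn ℝ 2 (hyperS Ω M s t) Ω.closed
  -- mass continuity
  mass : ∀ t ∈ Ioo 0 T, ∀ x ∈ Ω.carrier,
    deriv (fun r => s.ρ r x) t = -Ω.divV (fun y => s.ρ t y • s.v t y) x
  -- momentum
  momentum : ∀ t ∈ Ioo 0 T, ∀ x ∈ Ω.carrier,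
    deriv (fun r => s.ρ r x • s.v r x) t =
      Ω.divM (fun y => stress Ω M L s t y - s.ρ t y • outer (s.v t y) (s.v t y)) x +
        magForce Ω M L s t x + s.ρ t x • L.g t x
  -- transport of the deformation gradient
  transport : ∀ t ∈ Ioo 0 T, ∀ x ∈ Ω.carrier, ∀ i j,
    deriv (fun r => s.F r x i j) t =
      (Ω.gradV (s.v t) x * s.F t x) i j - ∑ k, s.v t x k * Ω.pd (fun y => s.F t y i j) k x
  -- Landau–Lifshitz–Gilbert inclusion
  llg : ∀ t ∈ Ioo 0 T, ∀ x ∈ Ω.carrier, ∃ e ∈ Dir (mZJ Ω s t x),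
    M.τ • mZJ Ω s t x + M.hc (s.F t x) (s.θ t x) • e -
        (M.γ (s.F t x) (s.m t x) (s.θ t x))⁻¹ • cross (s.m t x) (mZJ Ω s t x) =
      drive Ω M L s t x + Ω.divM (fun y => exch M s t y • Ω.gradV (s.m t) y) x
  -- `div (∇u - χ m) = 0` on the whole space in the sense of distributions, with `u` locally
  -- Lipschitz on the whole space (it has a gradient jump across the boundary), of finite energy,
  -- and vanishing at infinity
  u_lipschitz : ∀ t ∈ Ioo 0 T, LocallyLipschitz (s.u t)
  u_energy : ∀ t ∈ Ioo 0 T, MemLp (fun x => gradient (s.u t) x) 2 volume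
  u_infinity : ∀ t ∈ Ioo 0 T, Tendsto (s.u t) (cocompact (E d)) (𝓝 0)
  poisson : ∀ t ∈ Ioo 0 T, ∀ η : E d → ℝ, ContDiff ℝ ∞ η → HasCompactSupport η →
    ∫ x, inner ℝ (gradient (s.u t) x) (gradient η x) =
      ∫ x in Ω.carrier, inner ℝ (s.m t x) (gradient η x)
  -- boundary conditions
  impermeable : ∀ t ∈ Ioo 0 T, ∀ x ∈ Ω.bdry, inner ℝ (s.v t x) (Ω.normal x) = 0
  traction : ∀ t ∈ Ioo 0 T, ∀ x ∈ Ω.bdry,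
    Ω.tangential (mulV (stress Ω M L s t x) (Ω.normal x) -
        Ω.surfDiv (fun y => tenMulV (hyper Ω M s t y) (Ω.normal y)) x) x +
      (M.νb * ‖s.v t x‖ ^ (M.p - 2)) • s.v t x = L.k t x
  hyper_bc : ∀ t ∈ Ioo 0 T, ∀ x ∈ Ω.bdry, ∀ i,
    ∑ j, ∑ k, Ω.grad2 (s.v t) x i j k * Ω.normal x j * Ω.normal x k = 0
  neumann_m : ∀ t ∈ Ioo 0 T, ∀ x ∈ Ω.bdry, mulV (Ω.gradV (s.m t) x) (Ω.normal x) = 0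

/-! #### Energetics -/

/-- The density of the kinetic, stored, exchange and (negative) Zeeman energy. -/
def energyDensity (t : ℝ) (x : E d) : ℝ :=
  s.ρ t x / 2 * ‖s.v t x‖ ^ 2 + M.φ (s.F t x) (s.m t x) / (s.F t x).det +
    M.κ (s.F t x) * gradMsq Ω s t x / (2 * (s.F t x).det) -
    M.μ₀ * inner ℝ (hField Ω L s t x) (s.m t x)

/-- The energy of the body together with the energy of the demagnetizing field. -/
def energy (t : ℝ) : ℝ :=
  (∫ x in Ω.carrier, energyDensity Ω M L s t x) +
    ∫ x, M.μ₀ / 2 * ‖gradient (s.u t) x‖ ^ 2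

/-- The bulk dissipation rate
`ξ = ν₁ |e(v)|^p + ν₂ |∇²v|^p + τ |r|² + h_c(F,θ) |r|` at the corotational rate `r` of `m`. -/
def dissRate (t : ℝ) (x : E d) : ℝ :=
  M.ν₁ * frob (strainRate Ω s t x) ^ M.p + M.ν₂ * frob3 (Ω.grad2 (s.v t) x) ^ M.p +
    M.τ * ‖mZJ Ω s t x‖ ^ 2 + M.hc (s.F t x) (s.θ t x) * ‖mZJ Ω s t x‖

/-- The power density of gravity, of the external field, and of the adiabatic effects, the power of
the thermal stress being computed with the rate `A` (which is `e(v)` or `∇v`). -/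
def powerDensity (A : E d → Mat d) (t : ℝ) (x : E d) : ℝ :=
  s.ρ t x * inner ℝ (L.g t x) (s.v t x) -
    M.μ₀ * inner ℝ (deriv (fun r => L.hext r x) t) (s.m t x) -
    ddot (((s.F t x).det)⁻¹ • (zetaF M s t x * (s.F t x)ᵀ)) (A x) -
    inner ℝ (((s.F t x).det)⁻¹ • zetaM M s t x) (mDot Ω s t x)

/-- The energy balance at time `t`: all integrals exist, the energy is differentiable in time, and
its derivative plus the bulk and boundary dissipation rates is the power of the external and
adiabatic effects plus the power of the traction. -/
def EnergyBalance (A : E d → Mat d) (t : ℝ) : Prop :=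
  IntegrableOn (energyDensity Ω M L s t) Ω.carrier ∧
  Integrable (fun x => M.μ₀ / 2 * ‖gradient (s.u t) x‖ ^ 2) ∧
  IntegrableOn (dissRate Ω M s t) Ω.carrier ∧
  IntegrableOn (powerDensity Ω M L s A t) Ω.carrier ∧
  Integrable (fun x => M.νb * ‖s.v t x‖ ^ M.p) Ω.surf ∧
  Integrable (fun x => inner ℝ (L.k t x) (s.v t x)) Ω.surf ∧
  ∃ E' : ℝ, HasDerivAt (energy Ω M L s) E' t ∧
    E' + (∫ x in Ω.carrier, dissRate Ω M s t x) + (∫ x, M.νb * ‖s.v t x‖ ^ M.p ∂Ω.surf) =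
      (∫ x in Ω.carrier, powerDensity Ω M L s A t x) + ∫ x, inner ℝ (L.k t x) (s.v t x) ∂Ω.surf

end System

end

end Magneto

namespace Magneto

open scoped ENNReal NNReal

section AreaFormula

variable {n : ℕ} {X : Type*} [MetricSpace X] [MeasurableSpace X] [BorelSpace X]

theorem euclideanHausdorffMeasure_image_le_of_lipschitzOnWith {Y : Type*} [MetricSpace Y]
    [MeasurableSpace Y] [BorelSpace Y] {f : X → Y} {s : Set X} {K : ℝ≥0}
    (hf : LipschitzOnWith K f s) : μHE[n] (f '' s) ≤ (K : ℝ≥0∞) ^ n * μHE[n] s := by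
  simp only [Measure.euclideanHausdorffMeasure_def, Measure.smul_apply, ENNReal.smul_def,
    smul_eq_mul]
  have h := hf.hausdorffMeasure_image_le (d := n) (by positivity)
  rw [ENNReal.rpow_natCast] at h
  calc _ ≤ _ := mul_le_mul_right h _
    _ = _ := by ring

theorem volume_image_clm_eq (R : E n ≃L[ℝ] E n) (s : Set (E n)) :
    μHE[n] (R '' s) = ENNReal.ofReal |(R : E n →L[ℝ] E n).det| * volume s := by
  rw [EuclideanSpace.euclideanHausdorffMeasure_eq_volume]
  exact Measure.addHaar_image_continuousLinearMap volume (R : E n →L[ℝ] E n) s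

theorem hausdorff_image_le_of_dist_le {G : E n → X} {s : Set (E n)} (R : E n ≃L[ℝ] E n) {C : ℝ≥0}
    (h : ∀ x ∈ s, ∀ y ∈ s, dist (G x) (G y) ≤ C * ‖R (x - y)‖) :
    μHE[n] (G '' s) ≤
      (C : ℝ≥0∞) ^ n * (ENNReal.ofReal |(R : E n →L[ℝ] E n).det| * volume s) := by
  have hL : LipschitzOnWith C (G ∘ R.symm) (R '' s) := by
    refine LipschitzOnWith.of_dist_le_mul ?_
    rintro _ ⟨x, hx, rfl⟩ _ ⟨y, hy, rfl⟩
    simpa [dist_eq_norm] using h x hx y hy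
  have h2 := euclideanHausdorffMeasure_image_le_of_lipschitzOnWith (n := n) hL
  rwa [← image_comp, volume_image_clm_eq, show (G ∘ R.symm) ∘ R = G by ext; simp] at h2

theorem volume_le_hausdorff_image_of_le_dist {G : E n → X} {P : X → E n} {s : Set (E n)}
    (hP : ∀ y ∈ s, P (G y) = y) (R : E n ≃L[ℝ] E n) {C : ℝ≥0}
    (h : ∀ x ∈ s, ∀ y ∈ s, ‖R (x - y)‖ ≤ C * dist (G x) (G y)) :
    ENNReal.ofReal |(R : E n →L[ℝ] E n).det| * volume s ≤
      (C : ℝ≥0∞) ^ n * μHE[n] (G '' s) := by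
  have hL : LipschitzOnWith C (fun x => R (P x)) (G '' s) := by
    refine LipschitzOnWith.of_dist_le_mul ?_
    rintro _ ⟨x, hx, rfl⟩ _ ⟨y, hy, rfl⟩
    rw [hP x hx, hP y hy, dist_eq_norm, ← map_sub]
    exact h x hx y hy
  have h2 := euclideanHausdorffMeasure_image_le_of_lipschitzOnWith (n := n) hL
  rw [← volume_image_clm_eq]
  convert h2 using 2
  rw [image_image]
  refine image_congr fun y hy => by rw [hP y hy]

/-- Comparison of measures is local. -/
theorem measure_le_of_locally_le {α : Type*} [TopologicalSpace α] [SecondCountableTopology α]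
    [MeasurableSpace α] [OpensMeasurableSpace α] (μ ν : Measure α) {V : Set α}
    (h : ∀ y ∈ V, ∃ W, IsOpen W ∧ y ∈ W ∧ ∀ s ⊆ W ∩ V, MeasurableSet s → μ s ≤ ν s) {s : Set α}
    (hs : MeasurableSet s) (hsV : s ⊆ V) : μ s ≤ ν s := by
  choose! W hWo hyW hW using h
  obtain ⟨t, htV, htc, hcov⟩ := TopologicalSpace.countable_cover_nhdsWithin (s := V) (f := W)
    fun x hx => mem_nhdsWithin_of_mem_nhds ((hWo x hx).mem_nhds (hyW x hx))
  rcases t.eq_empty_or_nonempty with rfl | hne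
  · have : s = ∅ := by
      have := hsV.trans hcov
      simpa using this
    simp [this]
  obtain ⟨u, rfl⟩ := htc.exists_eq_range hne
  have hu : ∀ k, u k ∈ V := fun k => htV ⟨k, rfl⟩
  set D := disjointed (fun k => s ∩ W (u k)) with hD
  have hDm : ∀ k, MeasurableSet (D k) :=
    fun k => MeasurableSet.disjointed (fun k => hs.inter (hWo _ (hu k)).measurableSet) k
  have hDs : s = ⋃ k, D k := by
    rw [hD, iUnion_disjointed, ← inter_iUnion]
    refine (inter_eq_left.2 fun x hx => ?_).symm
    simpa using hcov (hsV hx)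
  rw [hDs, measure_iUnion (disjoint_disjointed _) hDm, measure_iUnion (disjoint_disjointed _) hDm]
  refine ENNReal.tsum_le_tsum fun k => hW _ (hu k) _ ?_ (hDm k)
  intro x hx
  have := disjointed_subset _ k hx
  exact ⟨this.2, hsV this.1⟩

/-- A parametrized `n`-dimensional surface: near each point `y` of the parameter domain `V`,
distances are asymptotically those of a linear automorphism with determinant `±J y`. -/
structure IsAreaParam (G : E n → X) (P : X → E n) (V : Set (E n)) (J : E n → ℝ) : Prop where
  isOpen : IsOpen V
  measurable : Measurable P
  leftInv : ∀ y ∈ V, P (G y) = y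
  measurable_inter : ∀ s ⊆ V, MeasurableSet s → MeasurableSet (G '' s)
  cont : ContinuousOn J V
  pos : ∀ y ∈ V, 0 < J y
  approx : ∀ y ∈ V, ∃ R : E n ≃L[ℝ] E n, |(R : E n →L[ℝ] E n).det| = J y ∧
    ∀ c : ℝ, 0 < c → c < 1 → ∃ W ∈ 𝓝 y, ∀ x ∈ W, ∀ x' ∈ W,
      (1 - c) * ‖R (x - x')‖ ≤ dist (G x) (G x') ∧ dist (G x) (G x') ≤ (1 + c) * ‖R (x - x')‖

namespace IsAreaParam

variable {G : E n → X} {P : X → E n} {V : Set (E n)} {J : E n → ℝ}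

theorem local_bounds (h : IsAreaParam G P V J) {y : E n} (hy : y ∈ V) {c : ℝ} (hc : 0 < c)
    (hc1 : c < 1) : ∃ W, IsOpen W ∧ y ∈ W ∧ ∀ s ⊆ W ∩ V, MeasurableSet s →
      μHE[n] (G '' s) ≤ ENNReal.ofReal ((1 + c) ^ n * (1 - c)⁻¹) *
        ∫⁻ z in s, ENNReal.ofReal (J z) ∧
      ∫⁻ z in s, ENNReal.ofReal (J z) ≤ ENNReal.ofReal ((1 + c) * (1 - c)⁻¹ ^ n) *
        μHE[n] (G '' s) := by
  obtain ⟨R, hR, happ⟩ := h.approx y hy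
  obtain ⟨W, hW, hGW⟩ := happ c hc hc1
  have hpos := h.pos y hy
  have hJ1 : ∀ᶠ z in 𝓝 y, (1 - c) * J y < J z ∧ J z < (1 + c) * J y := by
    have h1 := (h.cont.continuousAt (h.isOpen.mem_nhds hy))
    exact (h1.eventually_const_lt (by nlinarith)).and (h1.eventually_lt_const (by nlinarith))
  obtain ⟨U, hU, hUo, hyU⟩ := eventually_nhds_iff.1 (hJ1.and hW)
  refine ⟨U, hUo, hyU, fun s hs hsm => ?_⟩
  have h1c : (0 : ℝ) < 1 - c := by linarith
  have hlow : ENNReal.ofReal ((1 - c) * J y) * volume s ≤ ∫⁻ z in s, ENNReal.ofReal (J z) := by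
    rw [← setLIntegral_const]
    refine setLIntegral_mono' hsm fun z hz => ENNReal.ofReal_le_ofReal ?_
    exact (hU z (hs hz).1).1.1.le
  have hup : ∫⁻ z in s, ENNReal.ofReal (J z) ≤ ENNReal.ofReal ((1 + c) * J y) * volume s := by
    rw [← setLIntegral_const]
    refine setLIntegral_mono' hsm fun z hz => ENNReal.ofReal_le_ofReal ?_
    exact (hU z (hs hz).1).1.2.le
  have hsW : ∀ x ∈ s, x ∈ W := fun x hx => (hU x (hs hx).1).2
  have h1 := hausdorff_image_le_of_dist_le (G := G) (s := s) R (C := (1 + c).toNNReal) (by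
    intro x hx z hz
    rw [Real.coe_toNNReal _ (by linarith)]
    exact (hGW x (hsW x hx) z (hsW z hz)).2)
  have h2 := volume_le_hausdorff_image_of_le_dist (G := G) (P := P) (s := s)
    (fun z hz => h.leftInv z (hs hz).2) R (C := (1 - c)⁻¹.toNNReal) (by
    intro x hx z hz
    rw [Real.coe_toNNReal _ (by positivity), ← div_eq_inv_mul, le_div_iff₀ h1c, mul_comm]
    exact (hGW x (hsW x hx) z (hsW z hz)).1)
  rw [hR] at h1 h2
  change _ ≤ ENNReal.ofReal (1 + c) ^ n * _ at h1
  change _ ≤ ENNReal.ofReal ((1 - c)⁻¹) ^ n * _ at h2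
  rw [← ENNReal.ofReal_pow (by linarith)] at h1
  rw [← ENNReal.ofReal_pow (by positivity)] at h2
  constructor
  · refine h1.trans ?_
    rw [ENNReal.ofReal_mul (by positivity), mul_assoc]
    refine mul_le_mul_right ?_ _
    calc ENNReal.ofReal (J y) * volume s
        = ENNReal.ofReal ((1 - c)⁻¹) * (ENNReal.ofReal ((1 - c) * J y) * volume s) := by
          rw [← mul_assoc, ← ENNReal.ofReal_mul (by positivity)]
          congr 2
          field_simp
      _ ≤ _ := mul_le_mul_right hlow _
  · refine hup.trans ?_
    rw [ENNReal.ofReal_mul (by positivity), ENNReal.ofReal_mul (by positivity), mul_assoc,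
      mul_assoc]
    exact mul_le_mul_right h2 _

theorem hausdorff_image (h : IsAreaParam G P V J) {s : Set (E n)} (hs : MeasurableSet s)
    (hsV : s ⊆ V) : μHE[n] (G '' s) = ∫⁻ z in s, ENNReal.ofReal (J z) := by
  set S := G '' V
  have hS : MeasurableSet S := h.measurable_inter V subset_rfl h.isOpen.measurableSet
  set μ : Measure (E n) := (μHE[n].restrict S).map P with hμ
  have hμs : ∀ s ⊆ V, MeasurableSet s → μ s = μHE[n] (G '' s) := by
    intro s hsV hs
    rw [hμ, Measure.map_apply h.measurable hs, Measure.restrict_apply (h.measurable hs)]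
    congr 1
    ext x
    constructor
    · rintro ⟨hx, y, hy, rfl⟩
      refine ⟨y, ?_, rfl⟩
      rwa [mem_preimage, h.leftInv y hy] at hx
    · rintro ⟨y, hy, rfl⟩
      exact ⟨by rwa [mem_preimage, h.leftInv y (hsV hy)], y, hsV hy, rfl⟩
  set ν : Measure (E n) := volume.withDensity fun z => ENNReal.ofReal (J z) with hν
  have hνs : ∀ s, MeasurableSet s → ν s = ∫⁻ z in s, ENNReal.ofReal (J z) :=
    fun s hs => withDensity_apply _ hs
  have key : ∀ c : ℝ, 0 < c → c < 1 → μ s ≤ ENNReal.ofReal ((1 + c) ^ n * (1 - c)⁻¹) * ν s ∧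
      ν s ≤ ENNReal.ofReal ((1 + c) * (1 - c)⁻¹ ^ n) * μ s := by
    intro c hc hc1
    constructor
    · have := measure_le_of_locally_le μ (ENNReal.ofReal ((1 + c) ^ n * (1 - c)⁻¹) • ν) (V := V)
        (fun y hy => ?_) hs hsV
      · simpa using this
      obtain ⟨W, hWo, hyW, hW⟩ := h.local_bounds hy hc hc1
      refine ⟨W, hWo, hyW, fun s hs hsm => ?_⟩
      rw [hμs s (hs.trans inter_subset_right) hsm]
      simpa [hνs s hsm] using (hW s hs hsm).1
    · have := measure_le_of_locally_le ν (ENNReal.ofReal ((1 + c) * (1 - c)⁻¹ ^ n) • μ) (V := V)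
        (fun y hy => ?_) hs hsV
      · simpa using this
      obtain ⟨W, hWo, hyW, hW⟩ := h.local_bounds hy hc hc1
      refine ⟨W, hWo, hyW, fun s hs hsm => ?_⟩
      rw [hνs s hsm]
      simpa [hμs s (hs.trans inter_subset_right) hsm] using (hW s hs hsm).2
  have hlim : ∀ g : ℝ → ℝ, ContinuousAt g 0 → g 0 = 1 → ∀ a b : ℝ≥0∞,
      (∀ c, 0 < c → c < 1 → a ≤ ENNReal.ofReal (g c) * b) → a ≤ b := by
    intro g hg hg0 a b hab
    have ht : Tendsto (fun c => ENNReal.ofReal (g c) * b) (𝓝[>] 0) (𝓝 (ENNReal.ofReal 1 * b)) := by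
      refine ENNReal.Tendsto.mul_const ?_ (Or.inl (by simp))
      rw [← hg0]
      exact ENNReal.tendsto_ofReal (hg.tendsto.mono_left nhdsWithin_le_nhds)
    rw [ENNReal.ofReal_one, one_mul] at ht
    refine ge_of_tendsto ht ?_
    filter_upwards [Ioo_mem_nhdsGT (zero_lt_one (α := ℝ))] with c hc using hab c hc.1 hc.2
  rw [← hμs s hsV hs, ← hνs s hs]
  refine le_antisymm ?_ ?_
  · refine hlim (fun c => (1 + c) ^ n * (1 - c)⁻¹) ?_ (by simp) _ _ fun c h1 h2 => (key c h1 h2).1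
    exact ContinuousAt.mul (by fun_prop) (ContinuousAt.inv₀ (by fun_prop) (by simp))
  · refine hlim (fun c => (1 + c) * (1 - c)⁻¹ ^ n) ?_ (by simp) _ _ fun c h1 h2 => (key c h1 h2).2
    exact ContinuousAt.mul (by fun_prop)
      (ContinuousAt.pow (ContinuousAt.inv₀ (by fun_prop) (by simp)) _)

theorem map_restrict (h : IsAreaParam G P V J) :
    (μHE[n].restrict (G '' V)).map P =
      (volume.restrict V).withDensity fun z => ENNReal.ofReal (J z) := by
  ext s hs
  rw [withDensity_apply _ hs, Measure.restrict_restrict hs,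
    ← h.hausdorff_image (hs.inter h.isOpen.measurableSet) inter_subset_right,
    Measure.map_apply h.measurable hs, Measure.restrict_apply (h.measurable hs)]
  congr 1
  ext x
  constructor
  · rintro ⟨hx, y, hy, rfl⟩
    refine ⟨y, ⟨?_, hy⟩, rfl⟩
    rwa [mem_preimage, h.leftInv y hy] at hx
  · rintro ⟨y, hy, rfl⟩
    exact ⟨by rw [mem_preimage, h.leftInv y hy.2]; exact hy.1, y, hy.2, rfl⟩

theorem setIntegral_image (h : IsAreaParam G P V J) {q : X → ℝ}
    (hq : ContinuousOn (fun y => q (G y)) V) :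
    ∫ x in G '' V, q x ∂μHE[n] = ∫ y in V, q (G y) * J y := by
  have hS : MeasurableSet (G '' V) := h.measurable_inter V subset_rfl h.isOpen.measurableSet
  have h1 : ∫ x in G '' V, q x ∂μHE[n] = ∫ x in G '' V, q (G (P x)) ∂μHE[n] := by
    refine setIntegral_congr_fun hS ?_
    rintro _ ⟨y, hy, rfl⟩
    simp only [h.leftInv y hy]
  have hJm : AEMeasurable J (volume.restrict V) := h.cont.aemeasurable h.isOpen.measurableSet
  have hqm : AEStronglyMeasurable (fun y => q (G y))
      (Measure.map P (μHE[n].restrict (G '' V))) := by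
    rw [h.map_restrict]
    exact (hq.aestronglyMeasurable h.isOpen.measurableSet).mono_ac
      (withDensity_absolutelyContinuous _ _)
  rw [h1, ← integral_map (φ := P) (f := fun y => q (G y)) h.measurable.aemeasurable hqm,
    h.map_restrict, integral_withDensity_eq_integral_toReal_smul₀ hJm.ennreal_ofReal (by simp)]
  refine setIntegral_congr_fun h.isOpen.measurableSet fun y hy => ?_
  simp [ENNReal.toReal_ofReal (h.pos y hy).le, mul_comm]

theorem hausdorff_image_lt_top (h : IsAreaParam G P V J) {K : Set (E n)} (hK : IsCompact K)
    (hKV : K ⊆ V) : μHE[n] (G '' K) < ⊤ := by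
  rw [h.hausdorff_image hK.measurableSet hKV]
  have hJ : IntegrableOn J K := (h.cont.mono hKV).integrableOn_compact hK
  exact hJ.lintegral_lt_top

end IsAreaParam

end AreaFormula

end Magneto

namespace Magneto

section Chart

variable {n : ℕ}

/-- Insertion of a zero `i`-th coordinate. -/
noncomputable def insZero (i : Fin (n + 1)) : E n →L[ℝ] E (n + 1) :=
  LinearMap.toContinuousLinearMap
    { toFun := fun y => WithLp.toLp 2 (i.insertNth 0 y.ofLp : Fin (n + 1) → ℝ)
      map_add' := fun x y => by
        ext j; refine Fin.succAboveCases i ?_ (fun k => ?_) j <;> simp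
      map_smul' := fun c y => by
        ext j; refine Fin.succAboveCases i ?_ (fun k => ?_) j <;> simp }

/-- Removal of the `i`-th coordinate. -/
noncomputable def dropAt (i : Fin (n + 1)) : E (n + 1) →L[ℝ] E n :=
  LinearMap.toContinuousLinearMap
    { toFun := fun x => WithLp.toLp 2 (fun k => x (i.succAbove k))
      map_add' := fun x y => by ext j; simp
      map_smul' := fun c y => by ext j; simp }

@[simp] theorem insZero_apply_same (i : Fin (n + 1)) (y : E n) : insZero i y i = 0 := by
  simp [insZero]

@[simp] theorem insZero_apply_succAbove (i : Fin (n + 1)) (y : E n) (k : Fin n) :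
    insZero i y (i.succAbove k) = y k := by
  simp [insZero]

@[simp] theorem dropAt_apply (i : Fin (n + 1)) (x : E (n + 1)) (k : Fin n) :
    dropAt i x k = x (i.succAbove k) := rfl

@[simp] theorem dropAt_insZero (i : Fin (n + 1)) (y : E n) : dropAt i (insZero i y) = y := by
  ext k; simp

@[simp] theorem dropAt_single (i : Fin (n + 1)) (c : ℝ) :
    dropAt i (EuclideanSpace.single i c) = 0 := by
  ext k; simp [Fin.succAbove_ne]

theorem norm_insZero_add_single_sq (i : Fin (n + 1)) (y : E n) (s : ℝ) :
    ‖insZero i y + s • EuclideanSpace.single i (1 : ℝ)‖ ^ 2 = s ^ 2 + ‖y‖ ^ 2 := by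
  simp [EuclideanSpace.norm_sq_eq, Fin.sum_univ_succAbove _ i, Fin.succAbove_ne]

theorem eq_insZero_add_single (i : Fin (n + 1)) (x : E (n + 1)) :
    x = insZero i (dropAt i x) + x i • EuclideanSpace.single i (1 : ℝ) := by
  ext j
  refine Fin.succAboveCases i ?_ (fun k => ?_) j <;> simp [Fin.succAbove_ne]

theorem integral_eq_integral_integral_insZero (i : Fin (n + 1)) {Q : E (n + 1) → ℝ}
    (hQ : Integrable Q) : ∫ z, Q z =
      ∫ s : ℝ, ∫ y : E n, Q (insZero i y + s • EuclideanSpace.single i (1 : ℝ)) := by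
  have h1 := (volume_preserving_piFinSuccAbove (fun _ : Fin (n + 1) => ℝ) i).symm
  have h2 : MeasurePreserving (fun p : ℝ × (Fin n → ℝ) =>
      (WithLp.toLp 2 (i.insertNth p.1 p.2) : E (n + 1))) :=
    (PiLp.volume_preserving_toLp (Fin (n + 1))).comp h1
  have h3 : MeasurePreserving (fun p : ℝ × E n => ((p.1, p.2.ofLp) : ℝ × (Fin n → ℝ))) :=
    (MeasurePreserving.id volume).prod (PiLp.volume_preserving_ofLp (Fin n))
  have h4 : MeasurePreserving (fun p : ℝ × E n =>
      insZero i p.2 + p.1 • EuclideanSpace.single i (1 : ℝ)) := by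
    convert! h2.comp h3 using 2 with p
    ext j
    refine Fin.succAboveCases i ?_ (fun k => ?_) j <;> simp [Fin.succAbove_ne]
  have hcont : Continuous (fun p : ℝ × E n =>
      insZero i p.2 + p.1 • EuclideanSpace.single i (1 : ℝ)) := by fun_prop
  have hemb : MeasurableEmbedding (fun p : ℝ × E n =>
      insZero i p.2 + p.1 • EuclideanSpace.single i (1 : ℝ)) := by
    refine hcont.measurableEmbedding ?_
    intro p q hpq
    have e1 := congrArg (fun x => x i) hpq
    have e2 := congrArg (dropAt i) hpq
    simp only [map_add, dropAt_insZero, map_smul, dropAt_single, smul_zero, add_zero] at e2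
    simp at e1
    exact Prod.ext e1 e2
  rw [← h4.integral_comp hemb, Measure.volume_eq_prod, integral_prod]
  rw [← Measure.volume_eq_prod]
  exact (h4.integrable_comp_emb hemb).2 hQ

theorem det_transvection (ℓ : E n →L[ℝ] ℝ) (a : E n) :
    (ContinuousLinearMap.id ℝ (E n) + ℓ.smulRight a).det = 1 + ℓ a := by
  exact LinearMap.transvection.det (ℓ : E n →ₗ[ℝ] ℝ) a

/-- An automorphism with the metric distortion of the graph of the linear function `⟪a, ·⟫`. -/
theorem exists_graph_automorphism (a : E n) : ∃ R : E n ≃L[ℝ] E n,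
    (R : E n →L[ℝ] E n).det = √(1 + ‖a‖ ^ 2) ∧
      ∀ v, ‖R v‖ ^ 2 = inner ℝ a v ^ 2 + ‖v‖ ^ 2 := by
  set q := √(1 + ‖a‖ ^ 2) with hq
  have hq2 : q ^ 2 = 1 + ‖a‖ ^ 2 := Real.sq_sqrt (by positivity)
  have hq0 : 0 < q := Real.sqrt_pos.2 (by positivity)
  set b := (1 + q)⁻¹ with hb
  have hbq : b * (1 + q) = 1 := inv_mul_cancel₀ (by positivity)
  set f : E n →L[ℝ] E n := ContinuousLinearMap.id ℝ (E n) + (b • innerSL ℝ a).smulRight a with hf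
  have hdet : f.det = q := by
    rw [hf, det_transvection]
    have : ‖a‖ ^ 2 = (1 + q) * (q - 1) := by nlinarith
    simp only [smul_apply, innerSL_apply_apply, real_inner_self_eq_norm_sq, smul_eq_mul]
    rw [this, ← mul_assoc, hbq]; ring
  refine ⟨f.toContinuousLinearEquivOfDetNeZero (by rw [hdet]; exact hq0.ne'), by simpa using hdet,
    fun v => ?_⟩
  have : f v = v + (b * inner ℝ a v) • a := by simp [hf]
  rw [ContinuousLinearMap.toContinuousLinearEquivOfDetNeZero_apply, this, norm_add_sq_real,
    norm_smul, inner_smul_right, real_inner_comm, mul_pow, Real.norm_eq_abs, sq_abs,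
    real_inner_comm]
  have h2 : 2 * b + b ^ 2 * ‖a‖ ^ 2 = 1 := by
    have : ‖a‖ ^ 2 = (1 + q) * (q - 1) := by nlinarith
    rw [this]
    linear_combination (b * (q - 1) + 1) * hbq 
  rw [real_inner_comm v a] at *
  linear_combination (inner ℝ v a) ^ 2 * h2

end Chart

end Magneto

namespace Magneto

open scoped ENNReal

section Straighten

variable {n : ℕ}

/-- The map that replaces the `i`-th coordinate by the value of `f`. -/
noncomputable def straighten (f : E (n + 1) → ℝ) (i : Fin (n + 1)) (x : E (n + 1)) : E (n + 1) :=
  x + (f x - x i) • EuclideanSpace.single i (1 : ℝ)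

/-- The derivative of `straighten`. -/
noncomputable def straightenD (ℓ : E (n + 1) →L[ℝ] ℝ) (i : Fin (n + 1)) :
    E (n + 1) →L[ℝ] E (n + 1) :=
  ContinuousLinearMap.id ℝ (E (n + 1)) +
    (ℓ - EuclideanSpace.proj i).smulRight (EuclideanSpace.single i (1 : ℝ))

theorem straightenD_det (ℓ : E (n + 1) →L[ℝ] ℝ) (i : Fin (n + 1)) :
    (straightenD ℓ i).det = ℓ (EuclideanSpace.single i 1) := by
  rw [straightenD, det_transvection]
  simp

@[simp] theorem straighten_same (f : E (n + 1) → ℝ) (i : Fin (n + 1)) (x : E (n + 1)) :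
    straighten f i x i = f x := by
  simp [straighten]

@[simp] theorem dropAt_straighten (f : E (n + 1) → ℝ) (i : Fin (n + 1)) (x : E (n + 1)) :
    dropAt i (straighten f i x) = dropAt i x := by
  simp [straighten]

theorem straighten_hasStrictFDerivAt {f : E (n + 1) → ℝ} (hf : ContDiff ℝ ∞ f) (i : Fin (n + 1))
    (x : E (n + 1)) : HasStrictFDerivAt (straighten f i) (straightenD (fderiv ℝ f x) i) x := by
  have h1 : HasStrictFDerivAt f (fderiv ℝ f x) x :=
    hf.contDiffAt.hasStrictFDerivAt (by simp)
  have h2 : HasStrictFDerivAt (fun y : E (n + 1) => y i)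
      (EuclideanSpace.proj i : E (n + 1) →L[ℝ] ℝ) x :=
    (EuclideanSpace.proj i : E (n + 1) →L[ℝ] ℝ).hasStrictFDerivAt
  exact (hasStrictFDerivAt_id x).add ((h1.sub h2).smul_const _)

/-- An inverse chart of `straighten`, on which the `i`-th derivative of `f` does not vanish. -/
structure IsStraightChart (f : E (n + 1) → ℝ) (i : Fin (n + 1))
    (e : OpenPartialHomeomorph (E (n + 1)) (E (n + 1))) : Prop where
  smooth : ContDiff ℝ ∞ f
  coe : ∀ x, e x = straighten f i x
  ne_zero : ∀ x ∈ e.source, fderiv ℝ f x (EuclideanSpace.single i 1) ≠ 0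

theorem exists_straightChart {f : E (n + 1) → ℝ} (hf : ContDiff ℝ ∞ f) {x₀ : E (n + 1)}
    (h0 : gradient f x₀ ≠ 0) : ∃ i e, IsStraightChart f i e ∧ x₀ ∈ e.source := by
  obtain ⟨i, hi⟩ : ∃ i, fderiv ℝ f x₀ (EuclideanSpace.single i 1) ≠ 0 := by
    by_contra! hall
    apply h0
    have : fderiv ℝ f x₀ = 0 := by
      ext v
      rw [← (EuclideanSpace.basisFun (Fin (n + 1)) ℝ).sum_repr v]
      simp [hall]
    simp [gradient, this]
  set D : E (n + 1) ≃L[ℝ] E (n + 1) :=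
    (straightenD (fderiv ℝ f x₀) i).toContinuousLinearEquivOfDetNeZero
    (by rw [straightenD_det]; exact hi) with hD
  have hs : HasStrictFDerivAt (straighten f i) (D : E (n + 1) →L[ℝ] E (n + 1)) x₀ := by
    simpa [hD] using straighten_hasStrictFDerivAt hf i x₀
  have hc : Continuous fun x => fderiv ℝ f x (EuclideanSpace.single i 1) :=
    (hf.continuous_fderiv (by simp)).clm_apply continuous_const
  have hopen : IsOpen {x | fderiv ℝ f x (EuclideanSpace.single i 1) ≠ 0} :=
    isOpen_ne_fun hc continuous_const
  refine ⟨i, (hs.toOpenPartialHomeomorph _).restrOpen _ hopen, ⟨hf, fun x => ?_, fun x hx => ?_⟩,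
    ?_⟩
  · simp
  · rw [OpenPartialHomeomorph.restrOpen_source] at hx; exact hx.2
  · rw [OpenPartialHomeomorph.restrOpen_source]
    exact ⟨hs.mem_toOpenPartialHomeomorph_source, hi⟩

namespace IsStraightChart

variable {f : E (n + 1) → ℝ} {i : Fin (n + 1)}
  {e : OpenPartialHomeomorph (E (n + 1)) (E (n + 1))}

theorem integral_target (h : IsStraightChart f i e) (g : E (n + 1) → ℝ) :
    ∫ z in e.target, g z = ∫ x in e.source,
      |fderiv ℝ f x (EuclideanSpace.single i 1)| * g (straighten f i x) := by
  have himg : straighten f i '' e.source = e.target := by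
    rw [← e.image_source_eq_target]
    exact image_congr fun x _ => (h.coe x).symm
  rw [← himg, integral_image_eq_integral_abs_det_fderiv_smul volume e.open_source.measurableSet
    (fun x _ => (straighten_hasStrictFDerivAt h.smooth i x).hasFDerivAt.hasFDerivWithinAt)
    (fun x hx y hy hxy => e.injOn hx hy (by rw [h.coe, h.coe, hxy]))]
  simp [straightenD_det]

/-- The domain of the graph parametrization of the zero set. -/
def graphDom (_ : IsStraightChart f i e) : Set (E n) := {y | insZero i y ∈ e.target}

/-- The graph parametrization of the zero set. -/
noncomputable def graphMap (_ : IsStraightChart f i e) (y : E n) : E (n + 1) :=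
  e.symm (insZero i y)

theorem symm_apply_coord (h : IsStraightChart f i e) {z : E (n + 1)} (hz : z ∈ e.target) :
    f (e.symm z) = z i ∧ dropAt i (e.symm z) = dropAt i z := by
  have := e.right_inv hz
  rw [h.coe] at this
  constructor
  · rw [← straighten_same f i, this]
  · rw [← dropAt_straighten f i, this]

theorem image_graphMap (h : IsStraightChart f i e) :
    h.graphMap '' h.graphDom = e.source ∩ {x | f x = 0} := by
  ext x
  constructor
  · rintro ⟨y, hy, rfl⟩
    refine ⟨e.map_target hy, ?_⟩
    exact (h.symm_apply_coord hy).1.trans (insZero_apply_same i y)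
  · rintro ⟨hx, hfx⟩
    have h1 : insZero i (dropAt i x) = e x := by
      conv_rhs => rw [eq_insZero_add_single i (e x)]
      rw [h.coe, straighten_same, dropAt_straighten, show f x = 0 from hfx, zero_smul, add_zero]
    refine ⟨dropAt i x, ?_, ?_⟩
    · change insZero i (dropAt i x) ∈ e.target
      rw [h1]; exact e.map_source hx
    · rw [graphMap, h1, e.left_inv hx]

theorem norm_gradient_eq (ℓ : E (n + 1) →L[ℝ] ℝ) :
    ‖(InnerProductSpace.toDual ℝ (E (n + 1))).symm ℓ‖ ^ 2 =
      ℓ (EuclideanSpace.single i 1) ^ 2 +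
        ‖(InnerProductSpace.toDual ℝ (E n)).symm (ℓ.comp (insZero i))‖ ^ 2 := by
  set g := (InnerProductSpace.toDual ℝ (E (n + 1))).symm ℓ
  have hg : ∀ v, inner ℝ g v = ℓ v := fun v => InnerProductSpace.toDual_symm_apply
  have h1 : (InnerProductSpace.toDual ℝ (E n)).symm (ℓ.comp (insZero i)) = dropAt i g := by
    refine ext_inner_right ℝ fun v => ?_
    rw [InnerProductSpace.toDual_symm_apply, ContinuousLinearMap.comp_apply, ← hg]
    simp [PiLp.inner_apply, Fin.sum_univ_succAbove _ i]
  rw [h1, ← hg]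
  conv_lhs => rw [eq_insZero_add_single i g, norm_insZero_add_single_sq]
  simp [EuclideanSpace.inner_single_right]

/-- The area density of the graph parametrization. -/
noncomputable def density (h : IsStraightChart f i e) (y : E n) : ℝ :=
  ‖gradient f (h.graphMap y)‖ / |fderiv ℝ f (h.graphMap y) (EuclideanSpace.single i 1)|

theorem graphMap_strict (h : IsStraightChart f i e) {y : E n} (hy : y ∈ h.graphDom) :
    ∃ L : E n →L[ℝ] E (n + 1), HasStrictFDerivAt h.graphMap L y ∧ (∀ v, dropAt i (L v) = v) ∧
      ∀ v, fderiv ℝ f (h.graphMap y) (L v) = 0 := by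
  set x := h.graphMap y
  have hx : x ∈ e.source := e.map_target hy
  set D : E (n + 1) ≃L[ℝ] E (n + 1) :=
    (straightenD (fderiv ℝ f x) i).toContinuousLinearEquivOfDetNeZero
    (by rw [straightenD_det]; exact h.ne_zero x hx) with hD
  have hcoe : (e : E (n + 1) → E (n + 1)) = straighten f i := funext h.coe
  have hs : HasStrictFDerivAt e (D : E (n + 1) →L[ℝ] E (n + 1)) (e.symm (insZero i y)) := by
    rw [hcoe]
    exact straighten_hasStrictFDerivAt h.smooth i x
  have h2 := e.hasStrictFDerivAt_symm hy hs
  refine ⟨(D.symm : E (n + 1) →L[ℝ] E (n + 1)).comp (insZero i),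
    h2.comp y (insZero i).hasStrictFDerivAt, fun v => ?_, fun v => ?_⟩
  all_goals
    have h3 : straightenD (fderiv ℝ f x) i (D.symm (insZero i v)) = insZero i v :=
      D.apply_symm_apply (insZero i v)
    simp only [straightenD] at h3
  · have := congrArg (dropAt i) h3
    simpa using this
  · have := congrArg (fun z => z i) h3
    simpa using this

theorem isAreaParam (h : IsStraightChart f i e) :
    IsAreaParam h.graphMap (dropAt i) h.graphDom h.density := by
  have hopen : IsOpen h.graphDom := e.open_target.preimage (insZero i).continuous
  have hleft : ∀ y ∈ h.graphDom, dropAt i (h.graphMap y) = y := fun y hy => by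
    rw [graphMap, (h.symm_apply_coord hy).2, dropAt_insZero]
  have hGc : ContinuousOn h.graphMap h.graphDom :=
    e.continuousOn_symm.comp (insZero i).continuous.continuousOn fun y hy => hy
  have hne : ∀ y ∈ h.graphDom, fderiv ℝ f (h.graphMap y) (EuclideanSpace.single i 1) ≠ 0 :=
    fun y hy => h.ne_zero _ (e.map_target hy)
  have hgr : Continuous (gradient f) :=
    (InnerProductSpace.toDual ℝ (E (n + 1))).symm.continuous.comp
      (h.smooth.continuous_fderiv (by simp))
  have hpd : Continuous fun x => fderiv ℝ f x (EuclideanSpace.single i 1) :=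
    (h.smooth.continuous_fderiv (by simp)).clm_apply continuous_const
  refine ⟨hopen, (dropAt i).continuous.measurable, hleft, fun s hs hsm => ?_, ?_, fun y hy => ?_,
    fun y hy => ?_⟩
  · exact hsm.image_of_continuousOn_injOn (hGc.mono hs) fun y hy z hz hyz => by
      rw [← hleft y (hs hy), hyz, hleft z (hs hz)]
  · exact ((hgr.comp_continuousOn hGc).norm).div (hpd.comp_continuousOn hGc).abs
      fun y hy => abs_ne_zero.2 (hne y hy)
  · refine div_pos (norm_pos_iff.2 fun h0 => hne y hy ?_) (abs_pos.2 (hne y hy))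
    have : fderiv ℝ f (h.graphMap y) = 0 := by simpa [gradient] using h0
    simp [this]
  · obtain ⟨L, hL, hL1, hL2⟩ := h.graphMap_strict hy
    set x := h.graphMap y
    set ℓ := fderiv ℝ f x with hℓ
    set p := ℓ (EuclideanSpace.single i 1) with hp
    have hp0 : p ≠ 0 := hne y hy
    set b := (InnerProductSpace.toDual ℝ (E n)).symm (ℓ.comp (insZero i)) with hb
    set a : E n := (-p⁻¹) • b with ha
    obtain ⟨R, hRdet, hR⟩ := exists_graph_automorphism a
    have hLnorm : ∀ v, ‖L v‖ = ‖R v‖ := by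
      intro v
      have e1 : L v = insZero i v + (L v i) • EuclideanSpace.single i (1 : ℝ) := by
        conv_lhs => rw [eq_insZero_add_single i (L v), hL1]
      have e2 : L v i = inner ℝ a v := by
        have h0 := hL2 v
        rw [e1, map_add, map_smul, smul_eq_mul, ← hp] at h0
        have : inner ℝ b v = ℓ (insZero i v) := by
          rw [hb, InnerProductSpace.toDual_symm_apply]; rfl
        rw [ha, inner_smul_left, this]
        simp only [conj_trivial]
        field_simp
        linarith
      have e3 : ‖L v‖ ^ 2 = ‖R v‖ ^ 2 := by
        rw [hR, e1, norm_insZero_add_single_sq, e2]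
      exact (sq_eq_sq₀ (norm_nonneg _) (norm_nonneg _)).1 e3
    have hRle : ∀ v, ‖v‖ ≤ ‖R v‖ := fun v =>
      (sq_le_sq₀ (norm_nonneg _) (norm_nonneg _)).1
        (by rw [hR]; nlinarith [sq_nonneg (inner ℝ a v)])
    refine ⟨R, ?_, fun c hc hc1 => ?_⟩
    · rw [hRdet, abs_of_nonneg (Real.sqrt_nonneg _), density, Real.sqrt_eq_iff_mul_self_eq
        (by positivity) (by positivity), ← sq, div_pow, sq_abs]
      have := norm_gradient_eq (i := i) ℓ
      rw [show gradient f x = (InnerProductSpace.toDual ℝ (E (n + 1))).symm ℓ from rfl, this, ha,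
        norm_smul, mul_pow, Real.norm_eq_abs, sq_abs, ← hp, ← hb]
      field_simp
    · obtain ⟨W, hW, hLW⟩ := hL.approximates_deriv_on_nhds (c := c.toNNReal) (Or.inr (by simpa))
      refine ⟨W, hW, fun u hu w hw => ?_⟩
      have h1 := hLW u hu w hw
      rw [Real.coe_toNNReal _ hc.le] at h1
      have h2 : c * ‖u - w‖ ≤ c * ‖R (u - w)‖ := mul_le_mul_of_nonneg_left (hRle _) hc.le
      have h3 := hLnorm (u - w)
      rw [dist_eq_norm]
      have h4 := norm_sub_norm_le (h.graphMap u - h.graphMap w) (L (u - w))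
      have h5 := norm_sub_norm_le (L (u - w)) (h.graphMap u - h.graphMap w)
      rw [norm_sub_rev (L (u - w)) (h.graphMap u - h.graphMap w)] at h5
      constructor <;> linarith

end IsStraightChart

end Straighten

end Magneto

namespace Magneto

open scoped ENNReal

section Coarea

variable {n : ℕ} {f : E (n + 1) → ℝ} {i : Fin (n + 1)}
  {e : OpenPartialHomeomorph (E (n + 1)) (E (n + 1))}

namespace IsStraightChart

theorem exists_slice_integral (h : IsStraightChart f i e) {q : E (n + 1) → ℝ} (hq : Continuous q)
    (hqc : HasCompactSupport q) (hsub : tsupport q ⊆ e.source) :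
    ∃ I : ℝ → ℝ, Continuous I ∧
      (∀ δ : ℝ → ℝ, Continuous δ → ∫ x, q x * δ (f x) = ∫ s, δ s * I s) ∧
      I 0 = ∫ x in {x | f x = 0}, q x / ‖gradient f x‖ ∂μHE[n] := by
  have hpd : Continuous fun x => fderiv ℝ f x (EuclideanSpace.single i 1) :=
    (h.smooth.continuous_fderiv (by simp)).clm_apply continuous_const
  set r : E (n + 1) → ℝ := fun x => q x / |fderiv ℝ f x (EuclideanSpace.single i 1)| with hr
  have hrc : ContinuousOn r e.source :=
    hq.continuousOn.div hpd.abs.continuousOn fun x hx => abs_ne_zero.2 (h.ne_zero x hx)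
  set Q : E (n + 1) → ℝ := e.target.indicator fun z => r (e.symm z) with hQ
  set K := e '' tsupport q with hK
  have hKc : IsCompact K := hqc.isCompact.image_of_continuousOn (e.continuousOn.mono hsub)
  have hQK : ∀ z, z ∉ K → Q z = 0 := by
    intro z hz
    by_cases hzt : z ∈ e.target
    · rw [hQ, indicator_of_mem hzt, hr]
      have : q (e.symm z) = 0 := by
        by_contra hne
        exact hz ⟨e.symm z, subset_tsupport q hne, e.right_inv hzt⟩
      simp [this]
    · exact indicator_of_notMem hzt _
  have hQcont : Continuous Q := by
    refine continuous_iff_continuousAt.2 fun z => ?_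
    by_cases hzt : z ∈ e.target
    · have h1 : ContinuousOn (fun z => r (e.symm z)) e.target :=
        hrc.comp e.continuousOn_symm fun z hz => e.map_target hz
      refine (h1.continuousAt (e.open_target.mem_nhds hzt)).congr ?_
      filter_upwards [e.open_target.mem_nhds hzt] with w hw
      rw [hQ, indicator_of_mem hw]
    · have hzK : z ∉ K := fun ⟨x, hx, hxz⟩ => hzt (hxz ▸ e.map_source (hsub hx))
      refine (continuousAt_const (y := (0 : ℝ))).congr ?_
      filter_upwards [hKc.isClosed.isOpen_compl.mem_nhds hzK] with w hw
      exact (hQK w hw).symm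
  have hQsupp : HasCompactSupport Q := HasCompactSupport.intro hKc hQK
  refine ⟨fun s => ∫ y : E n, Q (insZero i y + s • EuclideanSpace.single i (1 : ℝ)), ?_, ?_, ?_⟩
  · have hK' : IsCompact (dropAt i '' K) := hKc.image (dropAt i).continuous
    have h1 : (fun s : ℝ => ∫ y : E n, Q (insZero i y + s • EuclideanSpace.single i (1 : ℝ))) =
        fun s => ∫ y in dropAt i '' K, Q (insZero i y + s • EuclideanSpace.single i (1 : ℝ)) := by
      funext s
      refine (setIntegral_eq_integral_of_forall_compl_eq_zero
        fun y hy => hQK _ fun hmem => hy ?_).symm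
      exact ⟨_, hmem, by simp⟩
    rw [h1]
    exact continuous_parametric_integral_of_continuous
      (f := fun (s : ℝ) (y : E n) => Q (insZero i y + s • EuclideanSpace.single i (1 : ℝ)))
      (hQcont.comp (by fun_prop)) hK'
  · intro δ hδ
    have hgc : Continuous fun z : E (n + 1) => Q z * δ (z i) :=
      hQcont.mul (hδ.comp (by fun_prop))
    have hgi : Integrable fun z : E (n + 1) => Q z * δ (z i) :=
      hgc.integrable_of_hasCompactSupport hQsupp.mul_right
    have h1 : ∫ z, Q z * δ (z i) = ∫ z in e.target, Q z * δ (z i) := by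
      refine (setIntegral_eq_integral_of_forall_compl_eq_zero fun z hz => ?_).symm
      rw [hQ, indicator_of_notMem hz, zero_mul]
    have h2 : ∫ x, q x * δ (f x) = ∫ x in e.source, q x * δ (f x) := by
      refine (setIntegral_eq_integral_of_forall_compl_eq_zero fun x hx => ?_).symm
      rw [image_eq_zero_of_notMem_tsupport fun hx' => hx (hsub hx'), zero_mul]
    have h3 : ∫ x in e.source, q x * δ (f x) = ∫ z in e.target, Q z * δ (z i) := by
      rw [h.integral_target]
      refine setIntegral_congr_fun e.open_source.measurableSet fun x hx => ?_
      have hx1 : straighten f i x ∈ e.target := by rw [← h.coe]; exact e.map_source hx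
      have hx2 : e.symm (straighten f i x) = x := by rw [← h.coe]; exact e.left_inv hx
      simp only [hQ, indicator_of_mem hx1, hx2, hr, straighten_same]
      have := abs_ne_zero.2 (h.ne_zero x hx)
      field_simp
    rw [h2, h3, ← h1, integral_eq_integral_integral_insZero i hgi]
    refine integral_congr_ae (Eventually.of_forall fun s => ?_)
    simp only [PiLp.add_apply, insZero_apply_same, PiLp.smul_apply, PiLp.single_apply, if_true,
      smul_eq_mul, mul_one, zero_add]
    rw [integral_mul_const, mul_comm]
  · have h1 : ∫ y : E n, Q (insZero i y + (0 : ℝ) • EuclideanSpace.single i (1 : ℝ)) =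
        ∫ y in h.graphDom, Q (insZero i y) := by
      simp only [zero_smul, add_zero]
      refine (setIntegral_eq_integral_of_forall_compl_eq_zero fun y hy => ?_).symm
      exact indicator_of_notMem (show insZero i y ∉ e.target from hy) _
    have hgr : Continuous (gradient f) :=
      (InnerProductSpace.toDual ℝ (E (n + 1))).symm.continuous.comp
        (h.smooth.continuous_fderiv (by simp))
    have hgr0 : ∀ x ∈ e.source, ‖gradient f x‖ ≠ 0 := fun x hx h0 => h.ne_zero x hx (by
      have : fderiv ℝ f x = 0 := by simpa [gradient] using h0
      simp [this])
    have hGc : ContinuousOn h.graphMap h.graphDom :=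
      e.continuousOn_symm.comp (insZero i).continuous.continuousOn fun y hy => hy
    have h2 := h.isAreaParam.setIntegral_image (q := fun x => q x / ‖gradient f x‖) (by
      refine ContinuousOn.div (hq.comp_continuousOn hGc) (hgr.comp_continuousOn hGc).norm ?_
      exact fun y hy => hgr0 _ (e.map_target hy))
    have hms : MeasurableSet (e.source ∩ {x | f x = 0}) :=
      e.open_source.measurableSet.inter
        (isClosed_eq h.smooth.continuous continuous_const).measurableSet
    have h3 : ∫ x in {x | f x = 0}, q x / ‖gradient f x‖ ∂μHE[n] =
        ∫ x in e.source ∩ {x | f x = 0}, q x / ‖gradient f x‖ ∂μHE[n] := by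
      refine setIntegral_eq_of_subset_of_forall_sdiff_eq_zero
        (isClosed_eq h.smooth.continuous continuous_const).measurableSet inter_subset_right ?_
      rintro x ⟨hx, hx'⟩
      rw [image_eq_zero_of_notMem_tsupport fun hxs => hx' ⟨hsub hxs, hx⟩, zero_div]
    refine h1.trans ?_
    rw [h3, ← h.image_graphMap, h2]
    refine setIntegral_congr_fun h.isAreaParam.isOpen.measurableSet fun y hy => ?_
    have hy' : insZero i y ∈ e.target := hy
    simp only [hQ, indicator_of_mem hy', hr, density, graphMap]
    have e1 := hgr0 _ (e.map_target hy')
    field_simp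

theorem hausdorff_lt_top (h : IsStraightChart f i e) {K : Set (E (n + 1))} (hK : IsCompact K)
    (hsub : K ⊆ e.source ∩ {x | f x = 0}) : μHE[n] K < ⊤ := by
  have hK' : IsCompact (dropAt i '' K) := hK.image (dropAt i).continuous
  have h1 : ∀ x ∈ K, dropAt i x ∈ h.graphDom ∧ h.graphMap (dropAt i x) = x := by
    intro x hx
    have hx1 := hsub hx
    rw [← h.image_graphMap] at hx1
    obtain ⟨y, hy, rfl⟩ := hx1
    rw [h.isAreaParam.leftInv y hy]
    exact ⟨hy, rfl⟩
  have h2 : h.graphMap '' (dropAt i '' K) = K := by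
    rw [image_image]
    exact (image_congr fun x hx => (h1 x hx).2).trans (image_id' K)
  rw [← h2]
  refine h.isAreaParam.hausdorff_image_lt_top hK' ?_
  rintro _ ⟨x, hx, rfl⟩
  exact (h1 x hx).1

end IsStraightChart

end Coarea

end Magneto

namespace Magneto

namespace SmoothDomain

variable {d : ℕ} (Ω : SmoothDomain d)

theorem mem_carrier {x : E d} : x ∈ Ω.carrier ↔ Ω.defFun x < 0 := by
  rw [Ω.carrier_eq]; rfl

theorem isOpen_carrier : IsOpen Ω.carrier := by
  rw [Ω.carrier_eq]
  exact isOpen_lt Ω.smooth.continuous continuous_const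

theorem carrier_subset_closed : Ω.carrier ⊆ Ω.closed := subset_closure

theorem isClosed_closed : IsClosed Ω.closed := isClosed_closure

theorem isCompact_closed : IsCompact Ω.closed := Ω.bounded.isCompact_closure

theorem isCompact_bdry : IsCompact Ω.bdry :=
  Ω.isCompact_closed.of_isClosed_subset isClosed_frontier frontier_subset_closure

theorem bdry_subset_closed : Ω.bdry ⊆ Ω.closed := frontier_subset_closure

theorem closed_mem_nhds {x : E d} (hx : x ∈ Ω.carrier) : Ω.closed ∈ 𝓝 x :=
  mem_of_superset (Ω.isOpen_carrier.mem_nhds hx) Ω.carrier_subset_closed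

theorem inner_gradient (x v : E d) :
    inner ℝ (gradient Ω.defFun x) v = fderiv ℝ Ω.defFun x v :=
  InnerProductSpace.toDual_symm_apply

theorem eventually_mem_carrier {x v : E d} (hx : Ω.defFun x = 0)
    (hv : inner ℝ (gradient Ω.defFun x) v < 0) : ∀ᶠ c in 𝓝[>] (0 : ℝ), x + c • v ∈ Ω.carrier := by
  have h1 : HasFDerivAt Ω.defFun (fderiv ℝ Ω.defFun x) (x + (0 : ℝ) • v) := by
    simpa using (Ω.smooth.differentiable (by simp) x).hasFDerivAt
  have h2 : HasDerivAt (fun c : ℝ => x + c • v) v 0 := by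
    simpa using ((hasDerivAt_id (0 : ℝ)).smul_const v).const_add x
  have h3 := h1.comp_hasDerivAt (0 : ℝ) h2
  rw [← Ω.inner_gradient] at h3
  have h4 := hasDerivAt_iff_tendsto_slope_zero.1 h3
  have h5 : ∀ᶠ c in 𝓝[>] (0 : ℝ), _ := ((h4.eventually_lt_const hv).filter_mono
    (nhdsWithin_mono 0 fun c (hc : 0 < c) => hc.ne'))
  filter_upwards [h5, self_mem_nhdsWithin] with c hc hc0
  have hc0 : (0 : ℝ) < c := hc0
  rw [mem_carrier]
  simp only [Function.comp_apply, zero_add, zero_smul, add_zero, hx, sub_zero, smul_eq_mul] at hc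
  have := inv_pos.2 hc0
  nlinarith

theorem zero_set_subset_closed {x : E d} (hx : Ω.defFun x = 0) : x ∈ Ω.closed := by
  have h := Ω.eventually_mem_carrier hx (v := -gradient Ω.defFun x) (by
    rw [inner_neg_right, real_inner_self_eq_norm_sq, neg_lt_zero]
    have := norm_pos_iff.2 (Ω.regular x hx)
    positivity)
  have ht : Tendsto (fun c : ℝ => x + c • -gradient Ω.defFun x) (𝓝[>] 0) (𝓝 x) := by
    have : Continuous (fun c : ℝ => x + c • -gradient Ω.defFun x) := by fun_prop
    simpa using (this.tendsto 0).mono_left nhdsWithin_le_nhds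
  exact mem_closure_of_tendsto ht h

theorem mem_closed {x : E d} : x ∈ Ω.closed ↔ Ω.defFun x ≤ 0 := by
  constructor
  · intro hx
    have : Ω.closed ⊆ {x | Ω.defFun x ≤ 0} := by
      refine closure_minimal (fun y hy => (Ω.mem_carrier.1 hy).le) ?_
      exact isClosed_le Ω.smooth.continuous continuous_const
    exact this hx
  · intro hx
    rcases hx.lt_or_eq with h | h
    · exact Ω.carrier_subset_closed (Ω.mem_carrier.2 h)
    · exact Ω.zero_set_subset_closed h

theorem mem_bdry {x : E d} : x ∈ Ω.bdry ↔ Ω.defFun x = 0 := by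
  rw [bdry, Ω.isOpen_carrier.frontier_eq, Set.mem_sdiff, Ω.mem_carrier]
  change x ∈ Ω.closed ∧ _ ↔ _
  rw [Ω.mem_closed]
  constructor
  · rintro ⟨h1, h2⟩; linarith
  · rintro h; rw [h]; simp

theorem bdry_eq : Ω.bdry = {x | Ω.defFun x = 0} := by
  ext x; exact Ω.mem_bdry

theorem uniqueDiffOn_closed : UniqueDiffOn ℝ Ω.closed := by
  intro x hx
  rcases (Ω.mem_closed.1 hx).lt_or_eq with h | h
  · exact uniqueDiffWithinAt_of_mem_nhds (Ω.closed_mem_nhds (Ω.mem_carrier.2 h))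
  refine ⟨?_, subset_closure hx⟩
  set g := gradient Ω.defFun x
  have hg : 0 < ‖g‖ := norm_pos_iff.2 (Ω.regular x h)
  have hcone : ∀ v, inner ℝ g v < 0 → v ∈ tangentConeAt ℝ Ω.closed x := by
    intro v hv
    have h1 := Ω.eventually_mem_carrier h hv
    refine mem_tangentConeAt_of_add_smul_mem (l := 𝓝[>] (0 : ℝ)) (c := id) ?_ ?_
    · exact tendsto_id.mono_left (nhdsWithin_mono 0 fun c (hc : 0 < c) => hc.ne')
    · exact h1.mono fun c hc => Ω.carrier_subset_closed hc
  have : (Submodule.span ℝ (tangentConeAt ℝ Ω.closed x) : Set (E d)) = univ := by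
    refine eq_univ_of_forall fun v => ?_
    set t := (|inner ℝ g v| + 1) / ‖g‖ ^ 2 with ht
    have hgg : inner ℝ g g = ‖g‖ ^ 2 := real_inner_self_eq_norm_sq g
    have ht' : t * ‖g‖ ^ 2 = |inner ℝ g v| + 1 := by rw [ht]; field_simp
    have e : v = (v - t • g) - (-(t • g)) := by simp
    rw [e]
    refine Submodule.sub_mem _ (Submodule.subset_span (hcone _ ?_))
      (Submodule.subset_span (hcone _ ?_))
    · rw [inner_sub_right, inner_smul_right, hgg, ht']
      linarith [le_abs_self (inner ℝ g v)]
    · rw [inner_neg_right, inner_smul_right, hgg, ht']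
      linarith [abs_nonneg (inner ℝ g v)]
  rw [this]; exact dense_univ

theorem contDiff_gradient : ContDiff ℝ ∞ (gradient Ω.defFun) :=
  (InnerProductSpace.toDual ℝ (E d)).symm.contDiff.comp (Ω.smooth.fderiv_right (by simp))

theorem norm_gradient_pos {x : E d} (hx : x ∈ Ω.bdry) : 0 < ‖gradient Ω.defFun x‖ :=
  norm_pos_iff.2 (Ω.regular x (Ω.mem_bdry.1 hx))

theorem continuousOn_normal : ContinuousOn Ω.normal Ω.bdry :=
  (Ω.contDiff_gradient.continuous.norm.continuousOn.inv₀ fun _ hx =>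
    (Ω.norm_gradient_pos hx).ne').smul Ω.contDiff_gradient.continuous.continuousOn

/-! ### Partial derivatives up to the boundary -/

theorem pd_eq_fderiv {x : E d} (hx : x ∈ Ω.carrier) (f : E d → ℝ) (j : Fin d) :
    Ω.pd f j x = fderiv ℝ f x (EuclideanSpace.single j 1) := by
  rw [pd, fderivWithin_of_mem_nhds (Ω.closed_mem_nhds hx)]

variable {Ω}

theorem contDiffOn_pd {f : E d → ℝ} {m k : WithTop ℕ∞} (hf : ContDiffOn ℝ k f Ω.closed)
    (hk : m + 1 ≤ k) (j : Fin d) : ContDiffOn ℝ m (Ω.pd f j) Ω.closed :=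
  (hf.fderivWithin Ω.uniqueDiffOn_closed hk).clm_apply contDiffOn_const

theorem continuousOn_pd {f : E d → ℝ} {k : WithTop ℕ∞} (hf : ContDiffOn ℝ k f Ω.closed)
    (hk : 1 ≤ k) (j : Fin d) : ContinuousOn (Ω.pd f j) Ω.closed :=
  (contDiffOn_pd (m := 0) hf (by simpa using hk) j).continuousOn

theorem pd_congr {f g : E d → ℝ} (h : EqOn f g Ω.closed) {x : E d} (hx : x ∈ Ω.closed)
    (j : Fin d) : Ω.pd f j x = Ω.pd g j x := by
  rw [pd, pd, fderivWithin_congr h (h hx)]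

variable {f g : E d → ℝ} {x : E d}

theorem pd_add (hx : x ∈ Ω.closed) (hf : DifferentiableWithinAt ℝ f Ω.closed x)
    (hg : DifferentiableWithinAt ℝ g Ω.closed x) (j : Fin d) :
    Ω.pd (fun y => f y + g y) j x = Ω.pd f j x + Ω.pd g j x := by
  rw [pd, fderivWithin_fun_add (Ω.uniqueDiffOn_closed x hx) hf hg]; rfl

theorem pd_sub (hx : x ∈ Ω.closed) (hf : DifferentiableWithinAt ℝ f Ω.closed x)
    (hg : DifferentiableWithinAt ℝ g Ω.closed x) (j : Fin d) :
    Ω.pd (fun y => f y - g y) j x = Ω.pd f j x - Ω.pd g j x := by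
  rw [pd, fderivWithin_fun_sub (Ω.uniqueDiffOn_closed x hx) hf hg]; rfl

theorem pd_mul (hx : x ∈ Ω.closed) (hf : DifferentiableWithinAt ℝ f Ω.closed x)
    (hg : DifferentiableWithinAt ℝ g Ω.closed x) (j : Fin d) :
    Ω.pd (fun y => f y * g y) j x = f x * Ω.pd g j x + Ω.pd f j x * g x := by
  rw [pd, fderivWithin_fun_mul (Ω.uniqueDiffOn_closed x hx) hf hg]
  simp [pd, mul_comm]

theorem pd_sum (hx : x ∈ Ω.closed) {ι : Type*} (s : Finset ι) {f : ι → E d → ℝ}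
    (hf : ∀ k ∈ s, DifferentiableWithinAt ℝ (f k) Ω.closed x) (j : Fin d) :
    Ω.pd (fun y => ∑ k ∈ s, f k y) j x = ∑ k ∈ s, Ω.pd (f k) j x := by
  rw [pd, fderivWithin_fun_sum (Ω.uniqueDiffOn_closed x hx) hf]
  simp [pd]

theorem pd_const (c : ℝ) (j : Fin d) : Ω.pd (fun _ => c) j x = 0 := by
  simp [pd]

theorem pd_const_mul (hx : x ∈ Ω.closed) (hf : DifferentiableWithinAt ℝ f Ω.closed x) (c : ℝ)
    (j : Fin d) : Ω.pd (fun y => c * f y) j x = c * Ω.pd f j x := by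
  rw [pd_mul hx (differentiableWithinAt_const c) hf, pd_const]; ring

end SmoothDomain

end Magneto

namespace Magneto

namespace SmoothDomain

open scoped Manifold

variable {n : ℕ} (Ω : SmoothDomain (n + 1))

theorem surf_eq : Ω.surf = (μHE[n] : Measure (E (n + 1))).restrict {x | Ω.defFun x = 0} := by
  rw [surf, bdry_eq]; rfl

instance isFiniteMeasure_surf : IsFiniteMeasure Ω.surf := by
  refine ⟨?_⟩
  rw [surf_eq, Measure.restrict_apply_univ, ← bdry_eq]
  refine Ω.isCompact_bdry.measure_lt_top_of_nhdsWithin fun x hx => ?_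
  obtain ⟨i, e, he, hxe⟩ := exists_straightChart Ω.smooth (Ω.regular x (Ω.mem_bdry.1 hx))
  obtain ⟨K, hK, hxK, hKe⟩ := exists_compact_subset e.open_source hxe
  refine ⟨K ∩ Ω.bdry, ?_, ?_⟩
  · exact inter_mem (mem_nhdsWithin_of_mem_nhds (mem_interior_iff_mem_nhds.1 hxK))
      self_mem_nhdsWithin
  · refine he.hausdorff_lt_top (hK.inter_right Ω.isCompact_bdry.isClosed) ?_
    rw [bdry_eq]
    exact inter_subset_inter_left _ hKe

theorem integrable_surf {q : E (n + 1) → ℝ} (hq : ContinuousOn q Ω.bdry) :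
    Integrable q Ω.surf := by
  have : IsFiniteMeasure ((μHE[n] : Measure (E (n + 1))).restrict Ω.bdry) :=
    Ω.isFiniteMeasure_surf
  have h : μHE[n] Ω.bdry < ⊤ := by
    have := measure_lt_top ((μHE[n] : Measure (E (n + 1))).restrict Ω.bdry) univ
    rwa [Measure.restrict_apply_univ] at this
  exact hq.integrableOn_of_subset_isCompact Ω.isCompact_bdry Ω.isCompact_bdry.measurableSet
    subset_rfl h.ne

theorem integrableOn_carrier {d : ℕ} (Ω : SmoothDomain d) {q : E d → ℝ}
    (hq : ContinuousOn q Ω.closed) : IntegrableOn q Ω.carrier :=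
  (hq.integrableOn_compact Ω.isCompact_closed).mono_set Ω.carrier_subset_closed

/-- The integrals of `q` over the level sets of the defining function, weighted by the inverse norm
of the gradient, depend continuously on the level near the level zero. -/
def HasSlices (q : E (n + 1) → ℝ) : Prop :=
  ∃ I : ℝ → ℝ, Continuous I ∧ ∃ η > 0,
    (∀ δ : ℝ → ℝ, Continuous δ → (∀ s, s ∉ Ioo (-η) 0 → δ s = 0) →
      ∫ x in Ω.carrier, q x * δ (Ω.defFun x) = ∫ s, δ s * I s) ∧
    I 0 = ∫ x, q x / ‖gradient Ω.defFun x‖ ∂Ω.surf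

variable {Ω}

theorem hasSlices_of_chart {q : E (n + 1) → ℝ} (hq : Continuous q) (hqc : HasCompactSupport q)
    {i : Fin (n + 1)} {e : OpenPartialHomeomorph (E (n + 1)) (E (n + 1))}
    (he : IsStraightChart Ω.defFun i e) (hsub : tsupport q ⊆ e.source) : Ω.HasSlices q := by
  obtain ⟨I, hI, h1, h2⟩ := he.exists_slice_integral hq hqc hsub
  refine ⟨I, hI, 1, one_pos, fun δ hδ hδ0 => ?_, by rw [h2, surf_eq]⟩
  rw [← h1 δ hδ]
  refine setIntegral_eq_integral_of_forall_compl_eq_zero fun x hx => ?_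
  rw [hδ0 _ fun h => hx (Ω.mem_carrier.2 h.2), mul_zero]

theorem hasSlices_of_interior {q : E (n + 1) → ℝ} (hqc : HasCompactSupport q)
    (hsub : tsupport q ⊆ Ω.carrier) : Ω.HasSlices q := by
  have h0 : ∀ x, Ω.defFun x = 0 → q x = 0 := fun x hx =>
    image_eq_zero_of_notMem_tsupport fun h => by
      have := Ω.mem_carrier.1 (hsub h); linarith
  obtain ⟨η, hη, hηq⟩ : ∃ η > 0, ∀ x, -η < Ω.defFun x → q x = 0 := by
    rcases (tsupport q).eq_empty_or_nonempty with h | h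
    · refine ⟨1, one_pos, fun x _ => image_eq_zero_of_notMem_tsupport (by simp [h])⟩
    · obtain ⟨z, hz, hmax⟩ := hqc.isCompact.exists_isMaxOn h Ω.smooth.continuous.continuousOn
      refine ⟨-Ω.defFun z, neg_pos.2 (Ω.mem_carrier.1 (hsub hz)), fun x hx => ?_⟩
      refine image_eq_zero_of_notMem_tsupport fun hxs => ?_
      have := hmax hxs
      simp only [mem_ofPred_eq] at this
      linarith
  refine ⟨fun _ => 0, continuous_const, η, hη, fun δ hδ hδ0 => ?_, ?_⟩
  · have : ∀ x, q x * δ (Ω.defFun x) = 0 := fun x => by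
      by_cases hx : -η < Ω.defFun x
      · rw [hηq x hx, zero_mul]
      · rw [hδ0 _ fun h => hx h.1, mul_zero]
    simp [this]
  · rw [surf_eq, setIntegral_eq_zero_of_forall_eq_zero]
    intro x hx
    rw [h0 x hx, zero_div]

theorem hasSlices_sum {ι : Type*} (s : Finset ι) {q : ι → E (n + 1) → ℝ}
    (hq : ∀ k ∈ s, Continuous (q k)) (h : ∀ k ∈ s, Ω.HasSlices (q k)) :
    Ω.HasSlices fun x => ∑ k ∈ s, q k x := by
  classical
  induction s using Finset.induction_on with
  | empty =>
    refine ⟨fun _ => 0, continuous_const, 1, one_pos, fun δ _ _ => by simp, by simp⟩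
  | insert a s ha ih =>
    have hqs : Continuous fun x => ∑ k ∈ s, q k x :=
      continuous_finsetSum _ fun k hk => hq k (Finset.mem_insert_of_mem hk)
    have hqa := hq a (Finset.mem_insert_self a s)
    obtain ⟨I, hI, η, hη, h1, h2⟩ := ih (fun k hk => hq k (Finset.mem_insert_of_mem hk))
      fun k hk => h k (Finset.mem_insert_of_mem hk)
    obtain ⟨J, hJ, θ, hθ, h3, h4⟩ := h a (Finset.mem_insert_self a s)
    have hint : ∀ q : E (n + 1) → ℝ, Continuous q →
        Integrable (fun x => q x / ‖gradient Ω.defFun x‖) Ω.surf := fun q hq =>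
      Ω.integrable_surf (hq.continuousOn.div Ω.contDiff_gradient.continuous.norm.continuousOn
        fun x hx => (Ω.norm_gradient_pos hx).ne')
    refine ⟨fun s => J s + I s, hJ.add hI, min θ η, lt_min hθ hη, fun δ hδ hδ0 => ?_, ?_⟩
    · have hδc : HasCompactSupport δ := HasCompactSupport.intro (isCompact_Icc (a := -(min θ η))
        (b := 0)) fun s hs => hδ0 s fun h => hs (Ioo_subset_Icc_self h)
      have e1 := h3 δ hδ fun s hs => hδ0 s fun h =>
        hs ⟨(neg_le_neg (min_le_left θ η)).trans_lt h.1, h.2⟩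
      have e2 := h1 δ hδ fun s hs => hδ0 s fun h =>
        hs ⟨(neg_le_neg (min_le_right θ η)).trans_lt h.1, h.2⟩
      simp only [Finset.sum_insert ha, add_mul, mul_add]
      have hδf := hδ.comp Ω.smooth.continuous
      rw [integral_add, integral_add, e1, e2]
      · exact (hδ.mul hJ).integrable_of_hasCompactSupport hδc.mul_right
      · exact (hδ.mul hI).integrable_of_hasCompactSupport hδc.mul_right
      · exact Ω.integrableOn_carrier (hqa.mul hδf).continuousOn
      · exact Ω.integrableOn_carrier (hqs.mul hδf).continuousOn
    · simp only [Finset.sum_insert ha, add_div, h2, h4]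
      rw [integral_add (hint _ hqa) (hint _ hqs)]

theorem hasSlices_of_continuous {q : E (n + 1) → ℝ} (hq : Continuous q) : Ω.HasSlices q := by
  have hloc : ∀ x : E (n + 1), ∃ U : Set (E (n + 1)), IsOpen U ∧ (x ∈ Ω.closed → x ∈ U) ∧
      ∀ g : E (n + 1) → ℝ, Continuous g → HasCompactSupport g → tsupport g ⊆ U → Ω.HasSlices g := by
    intro x
    by_cases hx : x ∈ Ω.bdry
    · obtain ⟨i, e, he, hxe⟩ := exists_straightChart Ω.smooth (Ω.regular x (Ω.mem_bdry.1 hx))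
      exact ⟨e.source, e.open_source, fun _ => hxe, fun g hg hgc hs =>
        hasSlices_of_chart hg hgc he hs⟩
    · refine ⟨Ω.carrier, Ω.isOpen_carrier, fun hxc => ?_, fun g hg hgc hs =>
        hasSlices_of_interior hgc hs⟩
      rw [mem_bdry] at hx
      exact Ω.mem_carrier.2 (lt_of_le_of_ne (Ω.mem_closed.1 hxc) hx)
  choose U hUo hxU hU using hloc
  obtain ⟨t, ht, hcov⟩ := Ω.isCompact_closed.elim_nhds_subcover
    (fun x => U x ∩ Metric.ball x 1)
    fun x hx => ((hUo x).inter Metric.isOpen_ball).mem_nhds ⟨hxU x hx, by simp⟩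
  obtain ⟨p, hp⟩ := SmoothPartitionOfUnity.exists_isSubordinate 𝓘(ℝ, E (n + 1))
    Ω.isClosed_closed (fun k : t => U k ∩ Metric.ball (k : E (n + 1)) 1)
    (fun k => (hUo k).inter Metric.isOpen_ball) (fun x hx => by
      obtain ⟨k, hk, hxk⟩ := mem_iUnion₂.1 (hcov hx)
      exact mem_iUnion.2 ⟨⟨k, hk⟩, hxk⟩)
  have hpc : ∀ k : t, Continuous (p k) := fun k => (p k).contMDiff.continuous
  have hsum : ∀ x ∈ Ω.closed, ∑ k, p k x * q x = q x := fun x hx => by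
    rw [← Finset.sum_mul, ← finsum_eq_sum_of_fintype, p.sum_eq_one hx, one_mul]
  have key : Ω.HasSlices fun x => ∑ k, p k x * q x := by
    refine hasSlices_sum _ (fun k _ => (hpc k).mul hq) fun k _ => ?_
    have hsub : tsupport (fun x => p k x * q x) ⊆ tsupport (p k) := tsupport_mul_subset_left
    refine hU k _ ((hpc k).mul hq) ?_ ((hsub.trans (hp k)).trans inter_subset_left)
    refine HasCompactSupport.mul_right ?_
    refine (isCompact_closedBall (k : E (n + 1)) 1).of_isClosed_subset (isClosed_tsupport _) ?_
    exact ((hp k).trans inter_subset_right).trans Metric.ball_subset_closedBall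
  obtain ⟨I, hI, η, hη, h1, h2⟩ := key
  refine ⟨I, hI, η, hη, fun δ hδ hδ0 => ?_, ?_⟩
  · rw [← h1 δ hδ hδ0]
    refine setIntegral_congr_fun Ω.isOpen_carrier.measurableSet fun x hx => ?_
    simp only [hsum x (Ω.carrier_subset_closed hx)]
  · rw [h2]
    refine setIntegral_congr_fun Ω.isCompact_bdry.measurableSet fun x hx => ?_
    simp only [hsum x (Ω.bdry_subset_closed hx)]

end SmoothDomain

end Magneto

namespace Magneto

/-- A smooth transition from `1` on `(-∞, -2]` to `0` on `[-1, ∞)`. -/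
noncomputable def cutoff (s : ℝ) : ℝ := Real.smoothTransition (-1 - s)

theorem contDiff_cutoff : ContDiff ℝ ∞ cutoff :=
  Real.smoothTransition.contDiff.comp (contDiff_const.sub contDiff_id)

theorem cutoff_of_le {s : ℝ} (hs : s ≤ -2) : cutoff s = 1 :=
  Real.smoothTransition.one_of_one_le (by linarith)

theorem cutoff_of_ge {s : ℝ} (hs : -1 ≤ s) : cutoff s = 0 :=
  Real.smoothTransition.zero_of_nonpos (by linarith)

theorem deriv_cutoff_eq_zero {s : ℝ} (hs : s ∉ Icc (-2 : ℝ) (-1)) : deriv cutoff s = 0 := by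
  rw [mem_Icc, not_and_or, not_le, not_le] at hs
  rcases hs with h | h
  · have : cutoff =ᶠ[𝓝 s] fun _ => 1 := by
      filter_upwards [Iio_mem_nhds h] with r hr using cutoff_of_le (le_of_lt hr)
    rw [this.deriv_eq, deriv_const]
  · have : cutoff =ᶠ[𝓝 s] fun _ => 0 := by
      filter_upwards [Ioi_mem_nhds h] with r hr using cutoff_of_ge (le_of_lt hr)
    rw [this.deriv_eq, deriv_const]

theorem continuous_deriv_cutoff : Continuous (deriv cutoff) :=
  contDiff_cutoff.continuous_deriv (by simp)

theorem tendsto_integral_deriv_cutoff {I : ℝ → ℝ} (hI : Continuous I) :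
    Tendsto (fun ε => ∫ s, -(deriv cutoff (s / ε) / ε) * I s) (𝓝[>] 0) (𝓝 (I 0)) := by
  have h1 : ∀ ε : ℝ, 0 < ε → ∫ s, -(deriv cutoff (s / ε) / ε) * I s =
      ∫ r in Icc (-2 : ℝ) (-1), -deriv cutoff r * I (ε * r) := by
    intro ε hε
    have := Measure.integral_comp_mul_left (fun s => -(deriv cutoff (s / ε) / ε) * I s) ε
    rw [abs_of_pos (inv_pos.2 hε), smul_eq_mul, eq_inv_mul_iff_mul_eq₀ hε.ne'] at this
    rw [← this, ← integral_const_mul, setIntegral_eq_integral_of_forall_compl_eq_zero]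
    · refine integral_congr_ae (Eventually.of_forall fun r => ?_)
      simp only
      rw [mul_div_cancel_left₀ _ hε.ne']
      field_simp
    · intro r hr
      rw [deriv_cutoff_eq_zero hr, neg_zero, zero_mul]
  have h2 : Continuous fun ε : ℝ => ∫ r in Icc (-2 : ℝ) (-1), -deriv cutoff r * I (ε * r) :=
    continuous_parametric_integral_of_continuous
      (f := fun ε r => -deriv cutoff r * I (ε * r))
      (((continuous_deriv_cutoff.comp continuous_snd).neg).mul
        (hI.comp (continuous_fst.mul continuous_snd))) isCompact_Icc
  have h3 : ∫ r in Icc (-2 : ℝ) (-1), -deriv cutoff r * I (0 * r) = I 0 := by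
    simp only [zero_mul]
    rw [integral_mul_const, integral_neg, integral_Icc_eq_integral_Ioc,
      ← intervalIntegral.integral_of_le (by norm_num),
      intervalIntegral.integral_deriv_eq_sub (fun x _ => contDiff_cutoff.differentiable (by simp) x)
        (continuous_deriv_cutoff.intervalIntegrable _ _), cutoff_of_le le_rfl, cutoff_of_ge le_rfl]
    ring
  rw [← h3]
  refine ((h2.tendsto 0).mono_left nhdsWithin_le_nhds).congr' ?_
  filter_upwards [self_mem_nhdsWithin] with ε hε using (h1 ε hε).symm

namespace SmoothDomain

variable {d : ℕ} {Ω : SmoothDomain d}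

theorem integral_cutoff_mul_divV {w : E d → E d}
    (hw : ContDiffOn ℝ 1 w Ω.closed) {ε : ℝ} (hε : 0 < ε) :
    ∫ x in Ω.carrier, cutoff (Ω.defFun x / ε) * Ω.divV w x =
      ∫ x in Ω.carrier, inner ℝ (w x) (gradient Ω.defFun x) *
        -(deriv cutoff (Ω.defFun x / ε) / ε) := by
  set a : E d → ℝ := fun x => cutoff (Ω.defFun x / ε) with ha
  have hac : ContDiff ℝ ∞ a := contDiff_cutoff.comp (Ω.smooth.div_const ε)
  have hsupp : ∀ x, a x ≠ 0 → Ω.defFun x < -ε := by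
    intro x hx
    by_contra! h
    refine hx (cutoff_of_ge ?_)
    rw [le_div_iff₀ hε]; linarith
  have hts : tsupport a ⊆ Ω.carrier := by
    have h1 : tsupport a ⊆ {x | Ω.defFun x ≤ -ε} :=
      closure_minimal (fun x hx => (hsupp x hx).le)
        (isClosed_le Ω.smooth.continuous continuous_const)
    intro x hx
    have : Ω.defFun x ≤ -ε := h1 hx
    exact Ω.mem_carrier.2 (by linarith)
  have ha' : ∀ x v, fderiv ℝ a x v =
      (deriv cutoff (Ω.defFun x / ε) / ε) * fderiv ℝ Ω.defFun x v := by
    intro x v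
    have h1 : HasFDerivAt (fun y => Ω.defFun y / ε) (ε⁻¹ • fderiv ℝ Ω.defFun x) x := by
      simpa [div_eq_inv_mul] using
        (Ω.smooth.differentiable (by simp) x).hasFDerivAt.const_mul ε⁻¹
    have h2 : HasDerivAt cutoff (deriv cutoff (Ω.defFun x / ε)) (Ω.defFun x / ε) :=
      (contDiff_cutoff.differentiable (by simp) _).hasDerivAt
    have h3 := h2.comp_hasFDerivAt x h1
    rw [show a = cutoff ∘ fun y => Ω.defFun y / ε from rfl, h3.fderiv]
    simp [div_eq_mul_inv, mul_assoc]
  have hwj : ∀ j, ContDiffOn ℝ 1 (fun y => w y j) Ω.closed := fun j =>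
    (EuclideanSpace.proj j : E d →L[ℝ] ℝ).contDiff.comp_contDiffOn hw
  have hj : ∀ j : Fin d, ∫ x in Ω.carrier, a x * Ω.pd (fun y => w y j) j x =
      -∫ x in Ω.carrier, fderiv ℝ a x (EuclideanSpace.single j 1) * w x j := by
    intro j
    set v : E d := EuclideanSpace.single j 1
    have hfa : Continuous fun x => fderiv ℝ a x v :=
      (hac.continuous_fderiv (by simp)).clm_apply continuous_const
    have z1 : ∀ x, x ∉ Ω.carrier → a x = 0 := fun x hx =>
      image_eq_zero_of_notMem_tsupport fun h => hx (hts h)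
    have z2 : ∀ x, x ∉ Ω.carrier → fderiv ℝ a x v = 0 := fun x hx => by
      rw [fderiv_of_notMem_tsupport ℝ fun h => hx (hts h)]; rfl
    have hint : ∀ g : E d → ℝ, ContinuousOn g Ω.closed → (∀ x, x ∉ Ω.carrier → g x = 0) →
        Integrable g := fun g hg hg0 => by
      refine (integrableOn_iff_integrable_of_support_subset fun x hx => ?_).1
        (Ω.integrableOn_carrier hg)
      by_contra h
      exact hx (hg0 x h)
    have hpd : ∀ x, a x * fderiv ℝ (fun y => w y j) x v = a x * Ω.pd (fun y => w y j) j x := by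
      intro x
      by_cases hx : x ∈ Ω.carrier
      · rw [Ω.pd_eq_fderiv hx]
      · rw [z1 x hx, zero_mul, zero_mul]
    have key := integral_mul_fderiv_eq_neg_fderiv_mul_of_integrable (𝕜 := ℝ) (μ := volume) (f := a)
      (g := fun y => w y j) (v := v)
      (hint _ (hfa.continuousOn.mul (hwj j).continuousOn) fun x hx => by rw [z2 x hx, zero_mul])
      (by
        simp only [hpd]
        exact hint _ (hac.continuous.continuousOn.mul (continuousOn_pd (hwj j) le_rfl j))
          fun x hx => by rw [z1 x hx, zero_mul])
      (hint _ (hac.continuous.continuousOn.mul (hwj j).continuousOn)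
        fun x hx => by rw [z1 x hx, zero_mul])
      (fun x _ => hac.differentiable (by simp) x)
      (fun x hx => ((hwj j).contDiffAt (Ω.closed_mem_nhds (hts hx))).differentiableAt (by simp))
    simp only [hpd] at key
    rw [setIntegral_eq_integral_of_forall_compl_eq_zero fun x hx => by rw [z1 x hx, zero_mul], key,
      setIntegral_eq_integral_of_forall_compl_eq_zero fun x hx => by rw [z2 x hx, zero_mul]]
  have hint1 : ∀ j, IntegrableOn (fun x => a x * Ω.pd (fun y => w y j) j x) Ω.carrier := fun j =>
    Ω.integrableOn_carrier (hac.continuous.continuousOn.mul (continuousOn_pd (hwj j) le_rfl j))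
  have hint2 : ∀ j : Fin d, IntegrableOn (fun x =>
      fderiv ℝ a x (EuclideanSpace.single j 1) * w x j) Ω.carrier := fun j =>
    Ω.integrableOn_carrier (((hac.continuous_fderiv (by simp)).clm_apply
      continuous_const).continuousOn.mul (hwj j).continuousOn)
  simp only [divV, Finset.mul_sum]
  rw [integral_finsetSum _ fun j _ => hint1 j, Finset.sum_congr rfl fun j _ => hj j,
    Finset.sum_neg_distrib, ← integral_finsetSum _ fun j _ => hint2 j, ← integral_neg]
  refine integral_congr_ae (Eventually.of_forall fun x => ?_)
  simp only [ha']
  have : inner ℝ (w x) (gradient Ω.defFun x) =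
      ∑ j, fderiv ℝ Ω.defFun x (EuclideanSpace.single j 1) * w x j := by
    rw [PiLp.inner_apply]
    refine Finset.sum_congr rfl fun j _ => ?_
    rw [← Ω.inner_gradient, EuclideanSpace.inner_single_right]
    simp
  rw [this, Finset.sum_mul, ← Finset.sum_neg_distrib]
  exact Finset.sum_congr rfl fun j _ => by ring

end SmoothDomain

namespace SmoothDomain

variable {n : ℕ} {Ω : SmoothDomain (n + 1)}

theorem continuousOn_divV {d : ℕ} {Ω : SmoothDomain d} {w : E d → E d}
    (hw : ContDiffOn ℝ 1 w Ω.closed) : ContinuousOn (Ω.divV w) Ω.closed :=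
  continuousOn_finsetSum _ fun j _ => continuousOn_pd (k := 1)
    ((EuclideanSpace.proj j : E d →L[ℝ] ℝ).contDiff.comp_contDiffOn hw) le_rfl j

/-- The divergence theorem. -/
theorem integral_divV {w : E (n + 1) → E (n + 1)} (hw : ContDiffOn ℝ 1 w Ω.closed) :
    ∫ x in Ω.carrier, Ω.divV w x = ∫ x, inner ℝ (w x) (Ω.normal x) ∂Ω.surf := by
  have hqc : ContinuousOn (fun x => inner ℝ (w x) (gradient Ω.defFun x)) Ω.closed :=
    hw.continuousOn.inner Ω.contDiff_gradient.continuous.continuousOn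
  obtain ⟨q, hq⟩ := ContinuousMap.exists_restrict_eq Ω.isClosed_closed
    (⟨_, continuousOn_iff_continuous_domRestrict.1 hqc⟩ : C(Ω.closed, ℝ))
  have hqe : ∀ x ∈ Ω.closed, q x = inner ℝ (w x) (gradient Ω.defFun x) := fun x hx =>
    DFunLike.congr_fun hq ⟨x, hx⟩
  obtain ⟨I, hI, η, hη, h1, h2⟩ := hasSlices_of_continuous (Ω := Ω) q.continuous
  have hI0 : I 0 = ∫ x, inner ℝ (w x) (Ω.normal x) ∂Ω.surf := by
    rw [h2]
    refine setIntegral_congr_fun Ω.isCompact_bdry.measurableSet fun x hx => ?_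
    simp only [hqe x (Ω.bdry_subset_closed hx), normal, inner_smul_right]
    rw [div_eq_inv_mul]
  have hlim1 : Tendsto (fun ε => ∫ x in Ω.carrier, cutoff (Ω.defFun x / ε) * Ω.divV w x) (𝓝[>] 0)
      (𝓝 (I 0)) := by
    refine (tendsto_integral_deriv_cutoff hI).congr' ?_
    filter_upwards [Ioo_mem_nhdsGT (show (0 : ℝ) < η / 2 by positivity)] with ε hε
    have hε0 : 0 < ε := hε.1
    have hc : Continuous fun s => -(deriv cutoff (s / ε) / ε) :=
      ((continuous_deriv_cutoff.comp (continuous_id.div_const ε)).div_const ε).neg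
    rw [integral_cutoff_mul_divV hw hε0, ← h1 _ hc]
    · refine setIntegral_congr_fun Ω.isOpen_carrier.measurableSet fun x hx => ?_
      simp only [hqe x (Ω.carrier_subset_closed hx)]
    · intro s hs
      have : s / ε ∉ Icc (-2 : ℝ) (-1) := fun h => hs ⟨?_, ?_⟩
      · simp [deriv_cutoff_eq_zero this]
      · have := (le_div_iff₀ hε0).1 h.1
        linarith [hε.2]
      · have := (div_le_iff₀ hε0).1 h.2
        linarith
  have hlim2 : Tendsto (fun ε => ∫ x in Ω.carrier, cutoff (Ω.defFun x / ε) * Ω.divV w x) (𝓝[>] 0)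
      (𝓝 (∫ x in Ω.carrier, Ω.divV w x)) := by
    have hdiv := continuousOn_divV hw
    refine tendsto_integral_filter_of_dominated_convergence (fun x => ‖Ω.divV w x‖)
      (Eventually.of_forall fun ε => ?_) (Eventually.of_forall fun ε => ?_)
      (Ω.integrableOn_carrier hdiv).norm ?_
    · exact (Ω.integrableOn_carrier ((contDiff_cutoff.continuous.comp
        (Ω.smooth.continuous.div_const ε)).continuousOn.mul hdiv)).aestronglyMeasurable
    · refine Eventually.of_forall fun x => ?_
      rw [norm_mul]
      refine mul_le_of_le_one_left (norm_nonneg _) ?_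
      rw [Real.norm_eq_abs, cutoff, abs_of_nonneg (Real.smoothTransition.nonneg _)]
      exact Real.smoothTransition.le_one _
    · refine (ae_restrict_mem Ω.isOpen_carrier.measurableSet).mono fun x hx => ?_
      have hx' := Ω.mem_carrier.1 hx
      refine tendsto_const_nhds.congr' ?_
      filter_upwards [Ioo_mem_nhdsGT (show (0 : ℝ) < -Ω.defFun x / 2 by linarith)] with ε hε
      have hε0 : 0 < ε := hε.1
      rw [cutoff_of_le, one_mul]
      rw [div_le_iff₀ hε0]
      linarith [hε.2]
  rw [← hI0]
  exact tendsto_nhds_unique hlim2 hlim1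

end SmoothDomain

end Magneto

namespace Magneto

section Components

variable {d : ℕ} {k : WithTop ℕ∞} {X : Type*} [NormedAddCommGroup X] [NormedSpace ℝ X] {s : Set X}

theorem contDiffOn_matrix {A : X → Mat d} :
    ContDiffOn ℝ k A s ↔ ∀ i j, ContDiffOn ℝ k (fun x => A x i j) s :=
  (contDiffOn_pi (Φ := fun x i => A x i)).trans (forall_congr' fun _ => contDiffOn_pi)

theorem contDiffOn_tensor {A : X → Ten d} :
    ContDiffOn ℝ k A s ↔ ∀ i j l, ContDiffOn ℝ k (fun x => A x i j l) s :=
  contDiffOn_pi.trans (forall_congr' fun _ =>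
    contDiffOn_pi.trans (forall_congr' fun _ => contDiffOn_pi))

theorem contDiffOn_vector {w : X → E d} :
    ContDiffOn ℝ k w s ↔ ∀ i, ContDiffOn ℝ k (fun x => w x i) s :=
  contDiffOn_euclidean

end Components

namespace SmoothDomain

variable {d : ℕ} {Ω : SmoothDomain d}

theorem pd_congr_nhds {f g : E d → ℝ} {x : E d} (h : f =ᶠ[𝓝 x] g)
    (j : Fin d) : Ω.pd f j x = Ω.pd g j x := by
  rw [pd, pd, (h.filter_mono nhdsWithin_le_nhds).fderivWithin_eq (h.self_of_nhds)]

theorem pd_comm {f : E d → ℝ} (hf : ContDiffOn ℝ 2 f Ω.closed) {x : E d} (hx : x ∈ Ω.carrier)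
    (i j : Fin d) : Ω.pd (Ω.pd f j) i x = Ω.pd (Ω.pd f i) j x := by
  have hfa : ContDiffAt ℝ 2 f x := hf.contDiffAt (Ω.closed_mem_nhds hx)
  have hd : DifferentiableAt ℝ (fderiv ℝ f) x :=
    (hfa.fderiv_right (m := 1) (by norm_num)).differentiableAt (by simp)
  have h1 : ∀ i j, Ω.pd (Ω.pd f j) i x =
      fderiv ℝ (fderiv ℝ f) x (EuclideanSpace.single i 1) (EuclideanSpace.single j 1) := by
    intro i j
    have he : Ω.pd f j =ᶠ[𝓝 x] fun y => fderiv ℝ f y (EuclideanSpace.single j 1) := by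
      filter_upwards [Ω.isOpen_carrier.mem_nhds hx] with y hy using Ω.pd_eq_fderiv hy f j
    rw [pd_congr_nhds he, Ω.pd_eq_fderiv hx,
      fderiv_clm_apply hd (differentiableAt_const _)]
    simp
  rw [h1, h1]
  exact (hfa.isSymmSndFDerivAt (by simp)).eq _ _

variable (Ω)

/-- The normal field extends to a smooth vector field. -/
theorem exists_normal_extension : ∃ N : E d → E d, ContDiff ℝ ∞ N ∧
    ∀ x ∈ Ω.bdry, N =ᶠ[𝓝 x] Ω.normal ∧ ∀ᶠ y in 𝓝 x, ‖Ω.normal y‖ = 1 := by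
  set g := gradient Ω.defFun with hg
  have hgc : ContDiff ℝ ∞ g := Ω.contDiff_gradient
  obtain ⟨c, hc, hcb⟩ : ∃ c > 0, ∀ x ∈ Ω.bdry, c < ‖g x‖ ^ 2 := by
    rcases Ω.bdry.eq_empty_or_nonempty with h | h
    · exact ⟨1, one_pos, by simp [h]⟩
    · obtain ⟨z, hz, hmin⟩ := Ω.isCompact_bdry.exists_isMinOn h
        (hgc.continuous.norm.pow 2).continuousOn
      have := Ω.norm_gradient_pos hz
      refine ⟨‖g z‖ ^ 2 / 2, by positivity, fun x hx => ?_⟩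
      have h1 : ‖g z‖ ^ 2 ≤ ‖g x‖ ^ 2 := hmin hx
      have h2 : 0 < ‖g z‖ ^ 2 := by positivity
      linarith
  set χ : E d → ℝ := fun x => Real.smoothTransition (2 * ‖g x‖ ^ 2 / c - 1) with hχ
  have hχc : ContDiff ℝ ∞ χ := Real.smoothTransition.contDiff.comp
    (((contDiff_const.mul (hgc.norm_sq ℝ)).div_const c).sub contDiff_const)
  have hev : ∀ x ∈ Ω.bdry, ∀ᶠ y in 𝓝 x, c < ‖g y‖ ^ 2 := fun x hx =>
    (hgc.continuous.norm.pow 2).continuousAt.eventually_const_lt (hcb x hx)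
  refine ⟨fun x => χ x • Ω.normal x, contDiff_iff_contDiffAt.2 fun x => ?_, fun x hx => ⟨?_, ?_⟩⟩
  · by_cases hx : g x = 0
    · refine (contDiffAt_const (c := (0 : E d))).congr_of_eventuallyEq ?_
      have : ∀ᶠ y in 𝓝 x, ‖g y‖ ^ 2 < c / 2 :=
        (hgc.continuous.norm.pow 2).continuousAt.eventually_lt_const (by simp [hx, hc])
      filter_upwards [this] with y hy
      have : χ y = 0 := by
        refine Real.smoothTransition.zero_of_nonpos ?_
        rw [sub_nonpos, div_le_one hc]; linarith
      rw [this, zero_smul]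
    · have h1 : ContDiffAt ℝ ∞ (fun y => ‖g y‖⁻¹) x :=
        (hgc.contDiffAt.norm ℝ hx).inv (norm_ne_zero_iff.2 hx)
      exact hχc.contDiffAt.smul (h1.smul hgc.contDiffAt)
  · filter_upwards [hev x hx] with y hy
    have : χ y = 1 := by
      refine Real.smoothTransition.one_of_one_le ?_
      rw [le_sub_iff_add_le, le_div_iff₀ hc]; linarith
    rw [this, one_smul]
  · filter_upwards [hev x hx] with y hy
    have hy0 : ‖g y‖ ≠ 0 := fun h => by rw [h] at hy; norm_num at hy; linarith
    rw [normal, norm_smul, norm_inv, norm_norm, inv_mul_cancel₀ hy0]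

variable {Ω}

theorem sum_normal_mul_pd_normal {N : E d → E d} (hN : ContDiff ℝ ∞ N) {x : E d} (hx : x ∈ Ω.bdry)
    (h1 : N =ᶠ[𝓝 x] Ω.normal) (h2 : ∀ᶠ y in 𝓝 x, ‖Ω.normal y‖ = 1) (j : Fin d) :
    ∑ i, N x i * Ω.pd (fun y => N y i) j x = 0 := by
  have hxc := Ω.bdry_subset_closed hx
  have hNi : ∀ i, DifferentiableWithinAt ℝ (fun y => N y i) Ω.closed x := fun i =>
    (((contDiff_euclidean.1 hN i).differentiable (by simp)) x).differentiableWithinAt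
  have e1 : (fun y => ∑ i, N y i * N y i) =ᶠ[𝓝 x] fun _ => 1 := by
    filter_upwards [h1, h2] with y hy1 hy2
    have := EuclideanSpace.real_norm_sq_eq (Ω.normal y)
    rw [hy2, one_pow] at this
    rw [hy1, this]
    exact Finset.sum_congr rfl fun i _ => (sq _).symm
  have e2 := pd_congr_nhds (Ω := Ω) e1 j
  rw [pd_const, pd_sum hxc _ fun i _ => (hNi i).fun_mul (hNi i)] at e2
  have e3 : ∑ i, Ω.pd (fun y => N y i * N y i) j x =
      2 * ∑ i, N x i * Ω.pd (fun y => N y i) j x := by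
    rw [Finset.mul_sum]
    refine Finset.sum_congr rfl fun i _ => ?_
    rw [pd_mul hxc (hNi i) (hNi i)]; ring
  linarith

end SmoothDomain

namespace SmoothDomain

variable {n : ℕ} {Ω : SmoothDomain (n + 1)}

/-- The surface divergence theorem for tangential vector fields. -/
theorem integral_surface_div {W : E (n + 1) → E (n + 1)} (hW : ContDiffOn ℝ 2 W Ω.closed)
    (hWn : ∀ x ∈ Ω.bdry, inner ℝ (W x) (Ω.normal x) = 0) :
    ∫ x, ∑ j, (Ω.pd (fun y => W y j) j x -
      (∑ k, Ω.pd (fun y => W y j) k x * Ω.normal x k) * Ω.normal x j) ∂Ω.surf = 0 := by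
  obtain ⟨N, hN, hNn⟩ := Ω.exists_normal_extension
  have hWi : ∀ i, ContDiffOn ℝ 2 (fun y => W y i) Ω.closed := contDiffOn_vector.1 hW
  have hNi : ∀ i, ContDiff ℝ ∞ (fun y => N y i) := contDiff_euclidean.1 hN
  have hNi2 : ∀ i, ContDiffOn ℝ 2 (fun y => N y i) Ω.closed := fun i =>
    (contDiff_infty.1 (hNi i) 2).contDiffOn
  set A : Fin (n + 1) → Fin (n + 1) → E (n + 1) → ℝ := fun i j y => W y i * N y j - W y j * N y i
    with hA
  have hAc : ∀ i j, ContDiffOn ℝ 2 (A i j) Ω.closed := fun i j =>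
    ((hWi i).mul (hNi2 j)).sub ((hWi j).mul (hNi2 i))
  have hpA : ∀ i j, ContDiffOn ℝ 1 (Ω.pd (A i j) j) Ω.closed := fun i j =>
    contDiffOn_pd (hAc i j) (by norm_num) j
  set w : E (n + 1) → E (n + 1) := fun x => WithLp.toLp 2 fun i => ∑ j, Ω.pd (A i j) j x with hw
  have hwc : ContDiffOn ℝ 1 w Ω.closed :=
    contDiffOn_vector.2 fun i => by
      simpa only [hw] using ContDiffOn.sum (s := Finset.univ) fun j _ => hpA i j
  have hdiv : ∀ x ∈ Ω.carrier, Ω.divV w x = 0 := by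
    intro x hx
    have hxc := Ω.carrier_subset_closed hx
    have e1 : Ω.divV w x = ∑ i, ∑ j, Ω.pd (Ω.pd (A i j) j) i x := by
      refine Finset.sum_congr rfl fun i _ => ?_
      exact pd_sum hxc Finset.univ (fun j _ => (hpA i j).differentiableOn (by simp) x hxc) i
    have e2 : ∀ i j, Ω.pd (Ω.pd (A i j) j) i x = -Ω.pd (Ω.pd (A j i) i) j x := by
      intro i j
      rw [pd_comm (hAc i j) hx]
      have : EqOn (Ω.pd (A i j) i) (fun y => (-1) * Ω.pd (A j i) i y) Ω.closed := fun y hy => by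
        have : A i j = fun z => (-1) * A j i z := by
          funext z; simp only [hA]; ring
        rw [this, pd_const_mul hy ((hAc j i).differentiableOn (by simp) y hy)]
      rw [pd_congr this hxc, pd_const_mul hxc ((hpA j i).differentiableOn (by simp) x hxc)]
      ring
    have e3 : ∑ i, ∑ j, Ω.pd (Ω.pd (A i j) j) i x = -∑ i, ∑ j, Ω.pd (Ω.pd (A i j) j) i x := by
      conv_lhs => rw [Finset.sum_comm]
      simp only [← Finset.sum_neg_distrib]
      exact Finset.sum_congr rfl fun i _ => Finset.sum_congr rfl fun j _ => e2 j i
    rw [e1]; linarith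
  have hdt := integral_divV hwc
  rw [setIntegral_eq_zero_of_forall_eq_zero hdiv] at hdt
  rw [← neg_eq_zero, ← integral_neg, hdt]
  refine setIntegral_congr_fun Ω.isCompact_bdry.measurableSet fun x hx => ?_
  have hxc := Ω.bdry_subset_closed hx
  obtain ⟨h1, h2⟩ := hNn x hx
  have hNx : ∀ i, N x i = Ω.normal x i := fun i => by rw [h1.self_of_nhds]
  have hWd : ∀ i, DifferentiableWithinAt ℝ (fun y => W y i) Ω.closed x := fun i =>
    (hWi i).differentiableOn (by simp) x hxc
  have hNd : ∀ i, DifferentiableWithinAt ℝ (fun y => N y i) Ω.closed x := fun i =>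
    (hNi2 i).differentiableOn (by simp) x hxc
  have hpd : ∀ i j, Ω.pd (A i j) j x = W x i * Ω.pd (fun y => N y j) j x +
      Ω.pd (fun y => W y i) j x * N x j - (W x j * Ω.pd (fun y => N y i) j x +
      Ω.pd (fun y => W y j) j x * N x i) := by
    intro i j
    rw [hA, pd_sub hxc ((hWd i).fun_mul (hNd j)) ((hWd j).fun_mul (hNd i)),
      pd_mul hxc (hWd i) (hNd j),
      pd_mul hxc (hWd j) (hNd i)]
  have hN1 : ∑ i, N x i * N x i = 1 := by
    have := EuclideanSpace.real_norm_sq_eq (Ω.normal x)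
    rw [h2.self_of_nhds, one_pow] at this
    rw [this]
    exact Finset.sum_congr rfl fun i _ => by rw [hNx]; ring
  have hWN : ∑ i, W x i * N x i = 0 := by
    rw [← hWn x hx, PiLp.inner_apply]
    exact Finset.sum_congr rfl fun i _ => by rw [hNx]; simp [mul_comm]
  have hNN := fun j => sum_normal_mul_pd_normal hN hx h1 h2 j
  have e : inner ℝ (w x) (Ω.normal x) =
      (∑ i, W x i * N x i) * (∑ j, Ω.pd (fun y => N y j) j x) +
      (∑ i, (∑ j, Ω.pd (fun y => W y i) j x * N x j) * N x i) -
      (∑ j, W x j * (∑ i, N x i * Ω.pd (fun y => N y i) j x)) -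
      (∑ i, N x i * N x i) * (∑ j, Ω.pd (fun y => W y j) j x) := by
    have s3 : ∑ j, W x j * (∑ i, N x i * Ω.pd (fun y => N y i) j x) =
        ∑ i, ∑ j, W x j * (N x i * Ω.pd (fun y => N y i) j x) := by
      rw [Finset.sum_comm]
      exact Finset.sum_congr rfl fun j _ => Finset.mul_sum _ _ _
    rw [PiLp.inner_apply, s3, Finset.sum_mul_sum, Finset.sum_mul_sum, ← Finset.sum_add_distrib.trans
      (congrArg₂ _ rfl rfl), ← Finset.sum_sub_distrib, ← Finset.sum_sub_distrib]
    refine Finset.sum_congr rfl fun i _ => ?_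
    simp only [hw, hpd, RCLike.inner_apply, conj_trivial, ← hNx]
    rw [Finset.mul_sum, Finset.sum_mul, ← Finset.sum_add_distrib, ← Finset.sum_sub_distrib,
      ← Finset.sum_sub_distrib]
    exact Finset.sum_congr rfl fun j _ => by ring
  simp only [e, hN1, hWN, hNN, Finset.sum_sub_distrib, ← hNx]
  simp

end SmoothDomain

end Magneto

namespace Magneto

/-- The full contraction of third-order tensors. -/
noncomputable def dddot {d : ℕ} (G H : Ten d) : ℝ := ∑ i, ∑ j, ∑ k, G i j k * H i j k

namespace SmoothDomain

section Continuity

variable {d : ℕ} {Ω : SmoothDomain d}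

theorem continuousOn_ddot {s : Set (E d)} {A B : E d → Mat d}
    (hA : ∀ i j, ContinuousOn (fun x => A x i j) s)
    (hB : ∀ i j, ContinuousOn (fun x => B x i j) s) :
    ContinuousOn (fun x => ddot (A x) (B x)) s :=
  continuousOn_finsetSum _ fun i _ => continuousOn_finsetSum _ fun j _ => (hA i j).mul (hB i j)

theorem continuousOn_dddot {s : Set (E d)} {A B : E d → Ten d}
    (hA : ∀ i j k, ContinuousOn (fun x => A x i j k) s)
    (hB : ∀ i j k, ContinuousOn (fun x => B x i j k) s) :
    ContinuousOn (fun x => dddot (A x) (B x)) s :=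
  continuousOn_finsetSum _ fun i _ => continuousOn_finsetSum _ fun j _ =>
    continuousOn_finsetSum _ fun k _ => (hA i j k).mul (hB i j k)

theorem contDiffOn_gradV {v : E d → E d} {m k : WithTop ℕ∞} (hv : ContDiffOn ℝ k v Ω.closed)
    (hk : m + 1 ≤ k) (i j : Fin d) : ContDiffOn ℝ m (fun x => Ω.gradV v x i j) Ω.closed :=
  contDiffOn_pd (contDiffOn_vector.1 hv i) hk j

theorem contDiffOn_divM {A : E d → Mat d} {m k : WithTop ℕ∞}
    (hA : ∀ i j, ContDiffOn ℝ k (fun x => A x i j) Ω.closed) (hk : m + 1 ≤ k) :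
    ContDiffOn ℝ m (Ω.divM A) Ω.closed :=
  contDiffOn_vector.2 fun i => by
    simpa only [divM] using ContDiffOn.sum (s := Finset.univ) fun j _ =>
      contDiffOn_pd (hA i j) hk j

theorem contDiffOn_divT {G : E d → Ten d} {m k : WithTop ℕ∞}
    (hG : ∀ i j k', ContDiffOn ℝ k (fun x => G x i j k') Ω.closed) (hk : m + 1 ≤ k) (i j : Fin d) :
    ContDiffOn ℝ m (fun x => Ω.divT G x i j) Ω.closed := by
  simpa only [divT, Matrix.of_apply] using ContDiffOn.sum (s := Finset.univ) fun l _ =>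
    contDiffOn_pd (hG i j l) hk l

theorem continuousOn_coord {s : Set (E d)} {w : E d → E d} (hw : ContinuousOn w s) (i : Fin d) :
    ContinuousOn (fun x => w x i) s :=
  (EuclideanSpace.proj i : E d →L[ℝ] ℝ).continuous.comp_continuousOn hw

theorem inner_eq_sum (a b : E d) : inner ℝ a b = ∑ i, a i * b i := by
  rw [PiLp.inner_apply]
  exact Finset.sum_congr rfl fun i _ => by simp [mul_comm]

end Continuity

variable {n : ℕ} {Ω : SmoothDomain (n + 1)}

theorem integral_divM {S : E (n + 1) → Mat (n + 1)} {v : E (n + 1) → E (n + 1)}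
    (hS : ∀ i j, ContDiffOn ℝ 1 (fun x => S x i j) Ω.closed) (hv : ContDiffOn ℝ 1 v Ω.closed) :
    ∫ x in Ω.carrier, inner ℝ (Ω.divM S x) (v x) =
      (∫ x, inner ℝ (mulV (S x) (Ω.normal x)) (v x) ∂Ω.surf) -
        ∫ x in Ω.carrier, ddot (S x) (Ω.gradV v x) := by
  have hvi : ∀ i, ContDiffOn ℝ 1 (fun y => v y i) Ω.closed := contDiffOn_vector.1 hv
  have hz : ContDiffOn ℝ 1 (fun x => (WithLp.toLp 2 fun j => ∑ i, S x i j * v x i : E (n + 1)))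
      Ω.closed := contDiffOn_vector.2 fun j => by
    simpa only using ContDiffOn.sum (s := Finset.univ) fun i _ => (hS i j).mul (hvi i)
  have hdt := integral_divV hz
  have h1 : ∀ x ∈ Ω.carrier, Ω.divV (fun x => (WithLp.toLp 2 fun j => ∑ i, S x i j * v x i)) x =
      inner ℝ (Ω.divM S x) (v x) + ddot (S x) (Ω.gradV v x) := by
    intro x hx
    have hxc := Ω.carrier_subset_closed hx
    have hSd := fun i j => (hS i j).differentiableOn (by simp) x hxc
    have hvd := fun i => (hvi i).differentiableOn (by simp) x hxc
    have e1 : ∀ j, Ω.pd (fun y => ∑ i, S y i j * v y i) j x =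
        ∑ i, (S x i j * Ω.pd (fun y => v y i) j x + Ω.pd (fun y => S y i j) j x * v x i) := by
      intro j
      rw [pd_sum hxc _ fun i _ => (hSd i j).fun_mul (hvd i)]
      exact Finset.sum_congr rfl fun i _ => pd_mul hxc (hSd i j) (hvd i) j
    simp only [divV, e1, inner_eq_sum, divM, ddot, gradV, Matrix.of_apply, Finset.sum_add_distrib,
      Finset.sum_mul]
    rw [Finset.sum_comm, add_comm]
    congr 1
    exact Finset.sum_comm
  have h2 : ∀ x, inner ℝ (WithLp.toLp 2 fun j => ∑ i, S x i j * v x i : E (n + 1)) (Ω.normal x) =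
      inner ℝ (mulV (S x) (Ω.normal x)) (v x) := by
    intro x
    simp only [inner_eq_sum, mulV, Matrix.mulVec, dotProduct, Finset.sum_mul]
    rw [Finset.sum_comm]
    exact Finset.sum_congr rfl fun i _ => Finset.sum_congr rfl fun j _ => by ring
  rw [setIntegral_congr_fun Ω.isOpen_carrier.measurableSet h1, integral_add] at hdt
  · simp only [h2] at hdt
    linarith
  · exact Ω.integrableOn_carrier ((contDiffOn_divM (m := 0) hS (by simp)).continuousOn.inner
      hv.continuousOn)
  · exact Ω.integrableOn_carrier (continuousOn_ddot (fun i j => (hS i j).continuousOn)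
      fun i j => (contDiffOn_gradV (m := 0) hv (by simp) i j).continuousOn)

theorem integral_divT {G : E (n + 1) → Ten (n + 1)} {A : E (n + 1) → Mat (n + 1)}
    (hG : ∀ i j k, ContDiffOn ℝ 1 (fun x => G x i j k) Ω.closed)
    (hA : ∀ i j, ContDiffOn ℝ 1 (fun x => A x i j) Ω.closed) :
    ∫ x in Ω.carrier, ddot (Ω.divT G x) (A x) =
      (∫ x, ddot (tenMulV (G x) (Ω.normal x)) (A x) ∂Ω.surf) -
        ∫ x in Ω.carrier, dddot (G x) (fun i j k => Ω.pd (fun y => A y i j) k x) := by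
  have hz : ContDiffOn ℝ 1 (fun x => (WithLp.toLp 2 fun k => ∑ i, ∑ j, G x i j k * A x i j :
      E (n + 1))) Ω.closed := contDiffOn_vector.2 fun k => by
    simpa only using ContDiffOn.sum (s := Finset.univ) fun i _ =>
      ContDiffOn.sum (s := Finset.univ) fun j _ => (hG i j k).mul (hA i j)
  have hdt := integral_divV hz
  have h1 : ∀ x ∈ Ω.carrier,
      Ω.divV (fun x => (WithLp.toLp 2 fun k => ∑ i, ∑ j, G x i j k * A x i j)) x =
      ddot (Ω.divT G x) (A x) + dddot (G x) (fun i j k => Ω.pd (fun y => A y i j) k x) := by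
    intro x hx
    have hxc := Ω.carrier_subset_closed hx
    have hGd := fun i j k => (hG i j k).differentiableOn (by simp) x hxc
    have hAd := fun i j => (hA i j).differentiableOn (by simp) x hxc
    have e1 : ∀ k, Ω.pd (fun y => ∑ i, ∑ j, G y i j k * A y i j) k x =
        ∑ i, ∑ j, (G x i j k * Ω.pd (fun y => A y i j) k x +
          Ω.pd (fun y => G y i j k) k x * A x i j) := by
      intro k
      rw [pd_sum hxc _ fun i _ => DifferentiableWithinAt.fun_sum fun j _ =>
        (hGd i j k).fun_mul (hAd i j)]
      refine Finset.sum_congr rfl fun i _ => ?_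
      rw [pd_sum hxc _ fun j _ => (hGd i j k).fun_mul (hAd i j)]
      exact Finset.sum_congr rfl fun j _ => pd_mul hxc (hGd i j k) (hAd i j) k
    simp only [divV, e1, ddot, dddot, divT, Matrix.of_apply, Finset.sum_mul,
      ← Finset.sum_add_distrib]
    rw [Finset.sum_comm]
    refine Finset.sum_congr rfl fun i _ => ?_
    rw [Finset.sum_comm]
    exact Finset.sum_congr rfl fun j _ => Finset.sum_congr rfl fun k _ => by ring
  have h2 : ∀ x, inner ℝ (WithLp.toLp 2 fun k => ∑ i, ∑ j, G x i j k * A x i j : E (n + 1))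
      (Ω.normal x) = ddot (tenMulV (G x) (Ω.normal x)) (A x) := by
    intro x
    simp only [inner_eq_sum, ddot, tenMulV, Matrix.of_apply, Finset.sum_mul]
    rw [Finset.sum_comm]
    refine Finset.sum_congr rfl fun i _ => ?_
    rw [Finset.sum_comm]
    exact Finset.sum_congr rfl fun j _ => Finset.sum_congr rfl fun k _ => by ring
  rw [setIntegral_congr_fun Ω.isOpen_carrier.measurableSet h1, integral_add] at hdt
  · simp only [h2] at hdt
    linarith
  · exact Ω.integrableOn_carrier (continuousOn_ddot
      (fun i j => (contDiffOn_divT (m := 0) hG (by simp) i j).continuousOn)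
      fun i j => (hA i j).continuousOn)
  · exact Ω.integrableOn_carrier (continuousOn_dddot (fun i j k => (hG i j k).continuousOn)
      fun i j k => continuousOn_pd (hA i j) le_rfl k)

theorem integral_hyperstress_boundary {G : E (n + 1) → Ten (n + 1)} {v : E (n + 1) → E (n + 1)}
    (hG : ∀ i j k, ContDiffOn ℝ 2 (fun x => G x i j k) Ω.closed) (hv : ContDiffOn ℝ 2 v Ω.closed)
    (hGn : ∀ x ∈ Ω.bdry, ∀ i, ∑ j, ∑ k, G x i j k * Ω.normal x j * Ω.normal x k = 0) :
    ContinuousOn (fun x => inner ℝ (Ω.surfDiv (fun y => tenMulV (G y) (Ω.normal y)) x) (v x))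
      Ω.bdry ∧
    ∫ x, ddot (tenMulV (G x) (Ω.normal x)) (Ω.gradV v x) ∂Ω.surf =
      -∫ x, inner ℝ (Ω.surfDiv (fun y => tenMulV (G y) (Ω.normal y)) x) (v x) ∂Ω.surf := by
  obtain ⟨N, hN, hNn⟩ := Ω.exists_normal_extension
  have hvi : ∀ i, ContDiffOn ℝ 2 (fun y => v y i) Ω.closed := contDiffOn_vector.1 hv
  have hNi : ∀ i, ContDiffOn ℝ 2 (fun y => N y i) Ω.closed := fun i =>
    (contDiff_infty.1 (contDiff_euclidean.1 hN i) 2).contDiffOn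
  set B : Fin (n + 1) → Fin (n + 1) → E (n + 1) → ℝ := fun i j y => ∑ k, G y i j k * N y k with hB
  have hBc : ∀ i j, ContDiffOn ℝ 2 (B i j) Ω.closed := fun i j => by
    simpa only using ContDiffOn.sum (s := Finset.univ) fun k _ => (hG i j k).mul (hNi k)
  set W : E (n + 1) → E (n + 1) := fun y => WithLp.toLp 2 fun j => ∑ i, B i j y * v y i with hW
  have hWc : ContDiffOn ℝ 2 W Ω.closed := contDiffOn_vector.2 fun j => by
    simpa only [hW] using ContDiffOn.sum (s := Finset.univ) fun i _ => (hBc i j).mul (hvi i)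
  have hNx : ∀ x ∈ Ω.bdry, N x = Ω.normal x := fun x hx => (hNn x hx).1.self_of_nhds
  have hBn : ∀ x ∈ Ω.bdry, ∀ i, ∑ j, B i j x * Ω.normal x j = 0 := by
    intro x hx i
    rw [← hGn x hx i]
    refine Finset.sum_congr rfl fun j _ => ?_
    rw [hB, Finset.sum_mul]
    exact Finset.sum_congr rfl fun k _ => by rw [hNx x hx]; ring
  have hWn : ∀ x ∈ Ω.bdry, inner ℝ (W x) (Ω.normal x) = 0 := by
    intro x hx
    simp only [inner_eq_sum, hW, Finset.sum_mul]
    rw [Finset.sum_comm]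
    refine Finset.sum_eq_zero fun i _ => ?_
    rw [Finset.sum_congr rfl fun j _ => mul_right_comm (B i j x) (v x i) (Ω.normal x j),
      ← Finset.sum_mul, hBn x hx i, zero_mul]
  have hsd := integral_surface_div hWc hWn
  set D : E (n + 1) → ℝ := fun x => ∑ j, (Ω.pd (fun y => W y j) j x -
      (∑ k, Ω.pd (fun y => W y j) k x * Ω.normal x k) * Ω.normal x j) with hD
  have hten : ∀ x ∈ Ω.bdry, ∀ i j, tenMulV (G x) (Ω.normal x) i j = B i j x := by
    intro x hx i j
    simp only [tenMulV, Matrix.of_apply, hB, hNx x hx]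
  have hDc : ContinuousOn D Ω.bdry := by
    have h1 : ∀ j k, ContinuousOn (Ω.pd (fun y => W y j) k) Ω.bdry := fun j k =>
      (continuousOn_pd (contDiffOn_vector.1 hWc j) (by norm_num) k).mono Ω.bdry_subset_closed
    have h2 := continuousOn_coord Ω.continuousOn_normal
    exact continuousOn_finsetSum _ fun j _ => (h1 j j).sub
      ((continuousOn_finsetSum _ fun k _ => (h1 j k).mul (h2 k)).mul (h2 j))
  have hddc : ContinuousOn (fun x => ddot (tenMulV (G x) (Ω.normal x)) (Ω.gradV v x)) Ω.bdry := by
    refine continuousOn_ddot (fun i j => ?_) fun i j =>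
      (contDiffOn_gradV (m := 1) hv (by norm_num) i j).continuousOn.mono Ω.bdry_subset_closed
    exact ((hBc i j).continuousOn.mono Ω.bdry_subset_closed).congr fun x hx => hten x hx i j
  have key : ∀ x ∈ Ω.bdry, inner ℝ (Ω.surfDiv (fun y => tenMulV (G y) (Ω.normal y)) x) (v x) =
      D x - ddot (tenMulV (G x) (Ω.normal x)) (Ω.gradV v x) := by
    intro x hx
    have hxc := Ω.bdry_subset_closed hx
    have hBd := fun i j => (hBc i j).differentiableOn (by simp) x hxc
    have hvd := fun i => (hvi i).differentiableOn (by simp) x hxc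
    have e1 : ∀ i j k, Ω.pd (fun y => tenMulV (G y) (Ω.normal y) i j) k x = Ω.pd (B i j) k x := by
      intro i j k
      refine pd_congr_nhds ?_ k
      filter_upwards [(hNn x hx).1] with y hy
      simp only [tenMulV, Matrix.of_apply, hB, hy]
    have e2 : ∀ j k, Ω.pd (fun y => W y j) k x =
        ∑ i, (B i j x * Ω.pd (fun y => v y i) k x + Ω.pd (B i j) k x * v x i) := by
      intro j k
      simp only [hW]
      rw [pd_sum hxc _ fun i _ => (hBd i j).fun_mul (hvd i)]
      exact Finset.sum_congr rfl fun i _ => pd_mul hxc (hBd i j) (hvd i) k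
    have e3 : ∑ j, (∑ k, (∑ i, B i j x * Ω.pd (fun y => v y i) k x) * Ω.normal x k) *
        Ω.normal x j = 0 := by
      have : ∀ j, (∑ k, (∑ i, B i j x * Ω.pd (fun y => v y i) k x) * Ω.normal x k) *
          Ω.normal x j = ∑ i, (B i j x * Ω.normal x j) *
            (∑ k, Ω.pd (fun y => v y i) k x * Ω.normal x k) := by
        intro j
        simp only [Finset.sum_mul, Finset.mul_sum]
        rw [Finset.sum_comm]
        exact Finset.sum_congr rfl fun i _ => Finset.sum_congr rfl fun k _ => by ring
      simp only [this]
      rw [Finset.sum_comm]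
      refine Finset.sum_eq_zero fun i _ => ?_
      rw [← Finset.sum_mul, hBn x hx i, zero_mul]
    have e4 : D x = (∑ j, ∑ i, B i j x * Ω.pd (fun y => v y i) j x) +
        (∑ j, ∑ i, (Ω.pd (B i j) j x - (∑ k, Ω.pd (B i j) k x * Ω.normal x k) * Ω.normal x j) *
          v x i) -
        ∑ j, (∑ k, (∑ i, B i j x * Ω.pd (fun y => v y i) k x) * Ω.normal x k) * Ω.normal x j := by
      simp only [hD, e2, ← Finset.sum_sub_distrib, ← Finset.sum_add_distrib]
      refine Finset.sum_congr rfl fun j _ => ?_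
      have : ∑ i, (B i j x * Ω.pd (fun y => v y i) j x +
          (Ω.pd (B i j) j x - (∑ k, Ω.pd (B i j) k x * Ω.normal x k) * Ω.normal x j) * v x i) =
          ∑ i, (B i j x * Ω.pd (fun y => v y i) j x + Ω.pd (B i j) j x * v x i) -
          (∑ k, (∑ i, Ω.pd (B i j) k x * v x i) * Ω.normal x k) * Ω.normal x j := by
        have s1 : (∑ k, (∑ i, Ω.pd (B i j) k x * v x i) * Ω.normal x k) * Ω.normal x j =
            ∑ i, (∑ k, Ω.pd (B i j) k x * Ω.normal x k) * Ω.normal x j * v x i := by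
          simp only [Finset.sum_mul]
          rw [Finset.sum_comm]
          exact Finset.sum_congr rfl fun i _ => Finset.sum_congr rfl fun k _ => by ring
        rw [s1, ← Finset.sum_sub_distrib]
        exact Finset.sum_congr rfl fun i _ => by ring
      rw [this]
      simp only [Finset.sum_add_distrib, add_mul]
      ring
    rw [e4, e3]
    simp only [inner_eq_sum, surfDiv, e1, ddot, hten x hx, gradV, Matrix.of_apply, Finset.sum_mul]
    rw [Finset.sum_comm (f := fun j i => B i j x * Ω.pd (fun y => v y i) j x),
      Finset.sum_comm (f := fun j i => (Ω.pd (B i j) j x - ∑ k, Ω.pd (B i j) k x * Ω.normal x k *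
        Ω.normal x j) * v x i)]
    ring
  refine ⟨(hDc.sub hddc).congr key, ?_⟩
  have h1 : ∫ x, inner ℝ (Ω.surfDiv (fun y => tenMulV (G y) (Ω.normal y)) x) (v x) ∂Ω.surf =
      ∫ x, (D x - ddot (tenMulV (G x) (Ω.normal x)) (Ω.gradV v x)) ∂Ω.surf :=
    setIntegral_congr_fun Ω.isCompact_bdry.measurableSet key
  rw [h1, integral_sub (Ω.integrable_surf hDc) (Ω.integrable_surf hddc), hsd]
  ring

/-- The principle of virtual power for a second-grade stress. -/
theorem integral_virtual_power {S : E (n + 1) → Mat (n + 1)} {G : E (n + 1) → Ten (n + 1)}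
    {v : E (n + 1) → E (n + 1)}
    (hS : ∀ i j, ContDiffOn ℝ 1 (fun x => S x i j) Ω.closed)
    (hG : ∀ i j k, ContDiffOn ℝ 2 (fun x => G x i j k) Ω.closed) (hv : ContDiffOn ℝ 2 v Ω.closed)
    (hGn : ∀ x ∈ Ω.bdry, ∀ i, ∑ j, ∑ k, G x i j k * Ω.normal x j * Ω.normal x k = 0) :
    ContinuousOn (fun x => inner ℝ (mulV (S x - Ω.divT G x) (Ω.normal x) -
      Ω.surfDiv (fun y => tenMulV (G y) (Ω.normal y)) x) (v x)) Ω.bdry ∧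
    ∫ x in Ω.carrier, inner ℝ (Ω.divM (fun y => S y - Ω.divT G y) x) (v x) =
      (∫ x, inner ℝ (mulV (S x - Ω.divT G x) (Ω.normal x) -
        Ω.surfDiv (fun y => tenMulV (G y) (Ω.normal y)) x) (v x) ∂Ω.surf) -
      (∫ x in Ω.carrier, ddot (S x) (Ω.gradV v x)) -
      ∫ x in Ω.carrier, dddot (G x) (Ω.grad2 v x) := by
  have hv1 : ContDiffOn ℝ 1 v Ω.closed := hv.of_le (by norm_num)
  have hgv : ∀ i j, ContDiffOn ℝ 1 (fun x => Ω.gradV v x i j) Ω.closed :=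
    contDiffOn_gradV hv (by norm_num)
  have hGt : ∀ i j, ContDiffOn ℝ 1 (fun x => Ω.divT G x i j) Ω.closed :=
    contDiffOn_divT hG (by norm_num)
  have hSG : ∀ i j, ContDiffOn ℝ 1 (fun x => (S x - Ω.divT G x) i j) Ω.closed := fun i j =>
    (hS i j).sub (hGt i j)
  obtain ⟨h1, h2⟩ := integral_hyperstress_boundary hG hv hGn
  have h3 := integral_divM hSG hv1
  have h4 := integral_divT (fun i j k => (hG i j k).of_le (by norm_num)) hgv
  have hc1 : ContinuousOn (fun x => inner ℝ (mulV (S x - Ω.divT G x) (Ω.normal x)) (v x))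
      Ω.bdry := by
    simp only [inner_eq_sum]
    refine continuousOn_finsetSum _ fun i _ => ContinuousOn.mul ?_
      ((continuousOn_coord hv.continuousOn i).mono Ω.bdry_subset_closed)
    exact continuousOn_finsetSum Finset.univ fun j _ =>
      ((hSG i j).continuousOn.mono Ω.bdry_subset_closed).mul
        (continuousOn_coord Ω.continuousOn_normal j)
  have hc2 : ContinuousOn (fun x => ddot (S x) (Ω.gradV v x)) Ω.closed :=
    continuousOn_ddot (fun i j => (hS i j).continuousOn) fun i j => (hgv i j).continuousOn
  have hc3 : ContinuousOn (fun x => ddot (Ω.divT G x) (Ω.gradV v x)) Ω.closed :=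
    continuousOn_ddot (fun i j => (hGt i j).continuousOn) fun i j => (hgv i j).continuousOn
  simp only [inner_sub_left]
  refine ⟨hc1.sub h1, ?_⟩
  rw [integral_sub (Ω.integrable_surf hc1) (Ω.integrable_surf h1), h3]
  have h5 : ∫ x in Ω.carrier, ddot (S x - Ω.divT G x) (Ω.gradV v x) =
      (∫ x in Ω.carrier, ddot (S x) (Ω.gradV v x)) -
        ∫ x in Ω.carrier, ddot (Ω.divT G x) (Ω.gradV v x) := by
    rw [← integral_sub (Ω.integrableOn_carrier hc2) (Ω.integrableOn_carrier hc3)]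
    refine integral_congr_ae (Eventually.of_forall fun x => ?_)
    simp only [ddot, Matrix.sub_apply, sub_mul, Finset.sum_sub_distrib]
  have h6 : ∫ x in Ω.carrier, dddot (G x) (Ω.grad2 v x) = ∫ x in Ω.carrier, dddot (G x)
      (fun i j k => Ω.pd (fun y => Ω.gradV v y i j) k x) := rfl
  rw [h5, h4, h2, h6]
  ring

end SmoothDomain

end Magneto

namespace Magneto

section WeakGradient

open scoped NNReal Convolution

variable {d : ℕ}

theorem inner_gradient_eq_fderiv (a x : E d) (f : E d → ℝ) :
    inner ℝ a (gradient f x) = fderiv ℝ f x a := by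
  rw [real_inner_comm]
  exact InnerProductSpace.toDual_symm_apply

theorem norm_gradient_eq_norm_fderiv (f : E d → ℝ) (x : E d) : ‖gradient f x‖ = ‖fderiv ℝ f x‖ :=
  LinearIsometryEquiv.norm_map _ _

theorem stronglyMeasurable_fderiv' (w : E d → ℝ) : StronglyMeasurable (fderiv ℝ w) := by
  have : SecondCountableTopology (E d →L[ℝ] ℝ) := by infer_instance
  exact (measurable_fderiv ℝ w).stronglyMeasurable

/-- Mollification of a compactly supported Lipschitz function. -/
theorem exists_mollification {w : E d → ℝ} {C : ℝ≥0} (hw : LipschitzWith C w)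
    (hwc : HasCompactSupport w) : ∃ η : ℕ → E d → ℝ,
      (∀ n, ContDiff ℝ ∞ (η n) ∧ HasCompactSupport (η n)) ∧
      ∀ A : E d → E d, LocallyIntegrable A →
        Tendsto (fun n => ∫ x, inner ℝ (A x) (gradient (η n) x)) atTop
          (𝓝 (∫ x, inner ℝ (A x) (gradient w x))) := by
  have hpos : ∀ n : ℕ, (0 : ℝ) < 1 / ((n : ℝ) + 1) := fun n => Nat.one_div_pos_of_nat
  let φ : ℕ → ContDiffBump (0 : E d) := fun n =>
    ⟨1 / ((n : ℝ) + 1), 2 * (1 / ((n : ℝ) + 1)), hpos n, by linarith [hpos n]⟩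
  have hφ0 : Tendsto (fun n => (φ n).rOut) atTop (𝓝 0) := by
    have := (tendsto_one_div_add_atTop_nhds_zero_nat (𝕜 := ℝ)).const_mul 2
    rwa [mul_zero] at this
  set L := ContinuousLinearMap.lsmul ℝ ℝ (E := ℝ)
  set L' := ContinuousLinearMap.lsmul ℝ ℝ (E := E d →L[ℝ] ℝ)
  have hwD : ∀ x, ‖fderiv ℝ w x‖ ≤ C := fun x => norm_fderiv_le_of_lipschitz ℝ hw
  have hloc : LocallyIntegrable (fderiv ℝ w) := by
    refine (locallyIntegrable_const (C : ℝ)).mono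
      (stronglyMeasurable_fderiv' w).aestronglyMeasurable
      (Eventually.of_forall fun x => ?_)
    simpa using hwD x
  let η : ℕ → E d → ℝ := fun n => (φ n).normed volume ⋆[L, volume] w
  have hderiv : ∀ n x, fderiv ℝ (η n) x = ((φ n).normed volume ⋆[L', volume] fderiv ℝ w) x := by
    intro n x
    have hφc : Continuous ((φ n).normed volume) := (φ n).continuous_normed
    have hφs : HasCompactSupport ((φ n).normed volume) := (φ n).hasCompactSupport_normed
    have hφi : Integrable ((φ n).normed volume) := hφc.integrable_of_hasCompactSupport hφs
    have hFc : ∀ y, Continuous fun t => (φ n).normed volume t * w (y - t) := fun y =>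
      hφc.mul (hw.continuous.comp (by fun_prop))
    have hae : ∀ᵐ t : E d, DifferentiableAt ℝ w (x - t) := by
      have := hw.ae_differentiableAt (μ := (volume : Measure (E d)))
      exact (Measure.measurePreserving_sub_left volume x).quasiMeasurePreserving.ae this
    have key := hasFDerivAt_integral_of_dominated_loc_of_lip' (𝕜 := ℝ) (μ := volume) (x₀ := x)
      (s := univ) (F := fun y t => (φ n).normed volume t * w (y - t))
      (F' := fun t => (φ n).normed volume t • fderiv ℝ w (x - t))
      (bound := fun t => ‖(φ n).normed volume t‖ * C) univ_mem
      (fun y _ => (hFc y).aestronglyMeasurable)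
      ((hFc x).integrable_of_hasCompactSupport hφs.mul_right)
      (hφc.aestronglyMeasurable.smul ((stronglyMeasurable_fderiv' w).comp_measurable
        (measurable_const.sub measurable_id)).aestronglyMeasurable)
      (Eventually.of_forall fun t y _ => by
        rw [← mul_sub, norm_mul, mul_assoc]
        refine mul_le_mul_of_nonneg_left ?_ (norm_nonneg _)
        have := hw.dist_le_mul (y - t) (x - t)
        rwa [dist_eq_norm, dist_eq_norm, sub_sub_sub_cancel_right] at this)
      (hφi.norm.mul_const _)
      (hae.mono fun t ht => by
        have h1 : HasFDerivAt (fun y : E d => y - t) (ContinuousLinearMap.id ℝ (E d)) x :=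
          (hasFDerivAt_id x).sub_const t
        have h2 := (ht.hasFDerivAt.comp x h1).const_mul ((φ n).normed volume t)
        simpa using h2)
    exact key.2.fderiv
  obtain ⟨R, hR⟩ : ∃ R, tsupport w ⊆ Metric.closedBall (0 : E d) R :=
    hwc.isCompact.isBounded.subset_closedBall 0
  have hsupp : ∀ n x, x ∉ Metric.closedBall (0 : E d) (R + 2) →
      ((φ n).normed volume ⋆[L', volume] fderiv ℝ w) x = 0 := by
    intro n x hx
    rw [convolution_def]
    refine integral_eq_zero_of_ae (Eventually.of_forall fun t => ?_)
    by_cases ht : t ∈ Metric.ball (0 : E d) (φ n).rOut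
    · have : fderiv ℝ w (x - t) = 0 := by
        refine fderiv_of_notMem_tsupport ℝ fun hmem => hx ?_
        have h1 := hR hmem
        have h2 : (φ n).rOut ≤ 2 := by
          change 2 * (1 / ((n : ℝ) + 1)) ≤ 2
          have : 1 / ((n : ℝ) + 1) ≤ 1 := by
            rw [div_le_one (by positivity)]; linarith [n.cast_nonneg (α := ℝ)]
          linarith
        rw [mem_closedBall_zero_iff] at h1 ⊢
        rw [mem_ball_zero_iff] at ht
        calc ‖x‖ = ‖(x - t) + t‖ := by rw [sub_add_cancel]
          _ ≤ ‖x - t‖ + ‖t‖ := norm_add_le _ _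
          _ ≤ R + 2 := by linarith
      simp [this]
    · have : (φ n).normed volume t = 0 := by
        rw [← Function.notMem_support, (φ n).support_normed_eq]; exact ht
      simp [this]
  have hbound : ∀ n x, ‖((φ n).normed volume ⋆[L', volume] fderiv ℝ w) x‖ ≤ C := by
    intro n x
    rw [convolution_def]
    have h1 : ∫ t, (φ n).normed volume t * (C : ℝ) = C := by
      rw [integral_mul_const, (φ n).integral_normed, one_mul]
    rw [← h1]
    refine norm_integral_le_of_norm_le
      (((φ n).continuous_normed.integrable_of_hasCompactSupport
        (φ n).hasCompactSupport_normed).mul_const _) (Eventually.of_forall fun t => ?_)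
    simp only [L', ContinuousLinearMap.lsmul_apply, norm_smul]
    rw [Real.norm_eq_abs, abs_of_nonneg ((φ n).nonneg_normed t)]
    exact mul_le_mul_of_nonneg_left (hwD _) ((φ n).nonneg_normed t)
  refine ⟨η, fun n => ⟨?_, ?_⟩, fun A hA => ?_⟩
  · exact (φ n).hasCompactSupport_normed.contDiff_convolution_left L (φ n).contDiff_normed
      hw.continuous.locallyIntegrable
  · exact (φ n).hasCompactSupport_normed.convolution L hwc
  · simp only [inner_gradient_eq_fderiv, hderiv]
    have hconv := ContDiffBump.ae_convolution_tendsto_right_of_locallyIntegrable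
      (μ := (volume : Measure (E d))) (K := 2) hφ0
      (Eventually.of_forall fun n => le_rfl) hloc
    refine tendsto_integral_filter_of_dominated_convergence
      ((Metric.closedBall (0 : E d) (R + 2)).indicator fun x => C * ‖A x‖)
      (Eventually.of_forall fun n => ?_) (Eventually.of_forall fun n =>
        Eventually.of_forall fun x => ?_) ?_ ?_
    · have h1 : AEStronglyMeasurable (fun x => fderiv ℝ (η n) x) volume :=
        (stronglyMeasurable_fderiv' (η n)).aestronglyMeasurable
      simp only [hderiv] at h1
      exact isBoundedBilinearMap_apply.continuous.comp_aestronglyMeasurable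
        (h1.prodMk hA.aestronglyMeasurable)
    · by_cases hx : x ∈ Metric.closedBall (0 : E d) (R + 2)
      · rw [indicator_of_mem hx]
        exact (ContinuousLinearMap.le_opNorm _ _).trans
          (mul_le_mul_of_nonneg_right (hbound n x) (norm_nonneg _))
      · rw [indicator_of_notMem hx, hsupp n x hx]
        simp
    · rw [integrable_indicator_iff Metric.isClosed_closedBall.measurableSet]
      exact ((hA.integrableOn_isCompact (isCompact_closedBall 0 (R + 2))).norm).const_mul _
    · filter_upwards [hconv] with x hx
      exact ((ContinuousLinearMap.apply ℝ ℝ (A x)).continuous.tendsto _).comp hx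

theorem ae_differentiableAt_of_locallyLipschitz {w : E d → ℝ} (hw : LocallyLipschitz w) :
    ∀ᵐ x, DifferentiableAt ℝ w x := by
  have h1 : ∀ n : ℕ, ∀ᵐ x : E d, x ∈ Metric.ball (0 : E d) n → DifferentiableAt ℝ w x := by
    intro n
    obtain ⟨K, hK⟩ :=
      (hw.locallyLipschitzOn (s := Metric.closedBall (0 : E d) n)).exists_lipschitzOnWith_of_compact
      (isCompact_closedBall 0 _)
    filter_upwards [(hK.mono Metric.ball_subset_closedBall).ae_differentiableWithinAt_of_mem
      (μ := (volume : Measure (E d)))] with x hx hmem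
    exact (hx hmem).differentiableAt (Metric.isOpen_ball.mem_nhds hmem)
  filter_upwards [ae_all_iff.2 h1] with x hx
  obtain ⟨n, hn⟩ := exists_nat_gt ‖x‖
  exact hx n (mem_ball_zero_iff.2 hn)

/-- The gradient of a Lipschitz function vanishes almost everywhere on its zero set. -/
theorem ae_fderiv_eq_zero_of_eq_zero {w : E d → ℝ} (hw : LocallyLipschitz w) :
    ∀ᵐ x, w x = 0 → fderiv ℝ w x = 0 := by
  have habs : LocallyLipschitz fun x => |w x| :=
    (lipschitzWith_one_norm (E := ℝ)).locallyLipschitz.comp hw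
  filter_upwards [ae_differentiableAt_of_locallyLipschitz habs] with x hx hx0
  have hmin : IsLocalMin (fun x => |w x|) x :=
    Eventually.of_forall fun y => by simp [hx0]
  have h1 := hx.hasFDerivAt
  rw [hmin.fderiv_eq_zero] at h1
  have h2 : HasFDerivAt w (0 : E d →L[ℝ] ℝ) x := by
    rw [hasFDerivAt_iff_isLittleO] at h1 ⊢
    simp only [hx0, abs_zero, sub_zero, zero_apply] at h1 ⊢
    exact h1.of_abs_left
  exact h2.fderiv

theorem lipschitzWith_of_locallyLipschitz_of_hasCompactSupport {w : E d → ℝ}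
    (hw : LocallyLipschitz w) (hwc : HasCompactSupport w) : ∃ C : ℝ≥0, LipschitzWith C w := by
  obtain ⟨R, hR0, hR⟩ : ∃ R > 0, tsupport w ⊆ Metric.closedBall (0 : E d) R := by
    obtain ⟨R, hR⟩ := hwc.isCompact.isBounded.subset_closedBall 0
    exact ⟨max R 1, by positivity, hR.trans (Metric.closedBall_subset_closedBall (le_max_left _ _))⟩
  obtain ⟨K, hK⟩ := (hw.locallyLipschitzOn
    (s := Metric.closedBall (0 : E d) (R + 1))).exists_lipschitzOnWith_of_compact
      (isCompact_closedBall 0 _)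
  obtain ⟨B, hB⟩ := hw.continuous.bounded_above_of_compact_support hwc
  have hB0 : 0 ≤ B := (norm_nonneg _).trans (hB 0)
  have hz : ∀ x : E d, R < ‖x‖ → w x = 0 := fun x hx =>
    image_eq_zero_of_notMem_tsupport fun h => by
      have := mem_closedBall_zero_iff.1 (hR h); linarith
  have hkey : ∀ x y : E d, ‖x‖ ≤ ‖y‖ → dist (w x) (w y) ≤ (K + B) * dist x y := by
    intro x y hxy
    by_cases hy : ‖y‖ ≤ R + 1
    · have := hK.dist_le_mul x (mem_closedBall_zero_iff.2 (hxy.trans hy)) y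
        (mem_closedBall_zero_iff.2 hy)
      nlinarith [dist_nonneg (x := x) (y := y)]
    · push Not at hy
      rw [hz y (by linarith), dist_zero_right]
      by_cases hx : ‖x‖ ≤ R
      · have h1 : 1 ≤ dist x y := by
          rw [dist_comm, dist_eq_norm]
          linarith [norm_sub_norm_le y x]
        have : 0 ≤ (K : ℝ) := K.2
        nlinarith [hB x]
      · rw [hz x (by linarith), norm_zero]
        have : 0 ≤ (K : ℝ) := K.2
        positivity
  refine ⟨K + ⟨B, hB0⟩, LipschitzWith.of_dist_le_mul fun x y => ?_⟩
  rcases le_total ‖x‖ ‖y‖ with h | h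
  · exact hkey x y h
  · rw [dist_comm, dist_comm x]; exact hkey y x h

/-- A smooth function that vanishes near zero and has derivative one away from zero. -/
noncomputable def shrink (y : ℝ) : ℝ := y * Real.smoothTransition (y ^ 2 - 1)

theorem contDiff_shrink : ContDiff ℝ ∞ shrink :=
  contDiff_id.mul (Real.smoothTransition.contDiff.comp ((contDiff_id.pow 2).sub contDiff_const))

theorem shrink_eq_zero {y : ℝ} (hy : |y| ≤ 1) : shrink y = 0 := by
  rw [shrink, Real.smoothTransition.zero_of_nonpos, mul_zero]
  rw [sub_nonpos, sq_le_one_iff_abs_le_one]; exact hy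

theorem deriv_shrink_of_two_lt {y : ℝ} (hy : 2 < |y|) : deriv shrink y = 1 := by
  have : shrink =ᶠ[𝓝 y] fun z => z := by
    filter_upwards [(continuous_abs.isOpen_preimage _ isOpen_Ioi).mem_nhds hy] with z hz
    have hz : 2 < |z| := hz
    rw [shrink, Real.smoothTransition.one_of_one_le, mul_one]
    nlinarith [sq_abs z]
  rw [this.deriv_eq, deriv_id'']

theorem exists_bound_deriv_shrink : ∃ B, ∀ y, |deriv shrink y| ≤ B := by
  obtain ⟨B, hB⟩ := (isCompact_Icc (a := (-2 : ℝ)) (b := 2)).exists_bound_of_continuousOn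
    (contDiff_shrink.continuous_deriv (by simp)).continuousOn
  refine ⟨max B 1, fun y => ?_⟩
  by_cases hy : |y| ≤ 2
  · exact (hB y (abs_le.1 hy)).trans (le_max_left _ _)
  · rw [deriv_shrink_of_two_lt (not_le.1 hy), abs_one]; exact le_max_right _ _

/-- A weak identity against smooth test functions extends to finite-energy test functions. -/
theorem integral_inner_gradient_eq {A B : E d → E d} (hA : MemLp A 2) (hB : MemLp B 2)
    (h : ∀ η : E d → ℝ, ContDiff ℝ ∞ η → HasCompactSupport η →
      ∫ x, inner ℝ (A x) (gradient η x) = ∫ x, inner ℝ (B x) (gradient η x))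
    {w : E d → ℝ} (hw : LocallyLipschitz w) (hw2 : MemLp (fun x => gradient w x) 2)
    (hw0 : Tendsto w (cocompact (E d)) (𝓝 0)) :
    ∫ x, inner ℝ (A x) (gradient w x) = ∫ x, inner ℝ (B x) (gradient w x) := by
  have hlip : ∀ (f : E d → ℝ), LocallyLipschitz f → HasCompactSupport f →
      ∫ x, inner ℝ (A x) (gradient f x) = ∫ x, inner ℝ (B x) (gradient f x) := by
    intro f hf hfc
    obtain ⟨C, hC⟩ := lipschitzWith_of_locallyLipschitz_of_hasCompactSupport hf hfc
    obtain ⟨η, hη, hlim⟩ := exists_mollification hC hfc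
    refine tendsto_nhds_unique (hlim A (hA.locallyIntegrable (by norm_num))) ?_
    simpa only [h _ (hη _).1 (hη _).2] using hlim B (hB.locallyIntegrable (by norm_num))
  obtain ⟨K, hK⟩ := exists_bound_deriv_shrink
  set f : ℕ → E d → ℝ := fun n x => shrink (w x * ((n : ℝ) + 1)) / ((n : ℝ) + 1) with hf
  have hf1 : ∀ n, LocallyLipschitz (f n) := by
    intro n
    have : ContDiff ℝ 1 fun y : ℝ => shrink (y * ((n : ℝ) + 1)) / ((n : ℝ) + 1) :=
      ((contDiff_infty.1 contDiff_shrink 1).comp (contDiff_id.mul contDiff_const)).div_const _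
    exact this.locallyLipschitz.comp hw
  have hf2 : ∀ n, HasCompactSupport (f n) := by
    intro n
    have h1 : ∀ᶠ x in cocompact (E d), |w x| < 1 / ((n : ℝ) + 1) := by
      have := hw0.abs
      rw [abs_zero] at this
      exact this.eventually_lt_const Nat.one_div_pos_of_nat
    obtain ⟨S, hS, hSw⟩ := mem_cocompact.1 h1
    refine HasCompactSupport.intro hS fun x hx => ?_
    have hx : |w x| < 1 / ((n : ℝ) + 1) := hSw hx
    simp only [hf]
    rw [shrink_eq_zero, zero_div]
    rw [abs_mul, abs_of_pos (show (0 : ℝ) < (n : ℝ) + 1 by positivity)]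
    exact ((lt_div_iff₀ (by positivity)).1 hx).le
  have hfd : ∀ n, ∀ᵐ x, fderiv ℝ (f n) x = deriv shrink (w x * ((n : ℝ) + 1)) • fderiv ℝ w x := by
    intro n
    filter_upwards [ae_differentiableAt_of_locallyLipschitz hw] with x hx
    have h1 : HasDerivAt shrink (deriv shrink (w x * ((n : ℝ) + 1))) (w x * ((n : ℝ) + 1)) :=
      (contDiff_shrink.differentiable (by simp) _).hasDerivAt
    have h2 := (h1.comp_hasFDerivAt x (hx.hasFDerivAt.mul_const ((n : ℝ) + 1))).mul_const
      ((n : ℝ) + 1)⁻¹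
    have h3 : f n = fun x => (shrink ∘ fun y => w y * ((n : ℝ) + 1)) x * ((n : ℝ) + 1)⁻¹ := by
      funext y; simp [hf, div_eq_mul_inv]
    have h0 : ((n : ℝ) + 1) ≠ 0 := by positivity
    rw [h3, h2.fderiv, smul_smul, smul_smul]
    congr 1
    field_simp
  have hlim : ∀ D : E d → E d, MemLp D 2 → Tendsto (fun n => ∫ x, inner ℝ (D x) (gradient (f n) x))
      atTop (𝓝 (∫ x, inner ℝ (D x) (gradient w x))) := by
    intro D hD
    simp only [inner_gradient_eq_fderiv]
    refine tendsto_integral_of_dominated_convergence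
      (fun x => K * (‖D x‖ * ‖gradient w x‖)) (fun n => ?_) ?_ (fun n => ?_) ?_
    · exact isBoundedBilinearMap_apply.continuous.comp_aestronglyMeasurable
        ((stronglyMeasurable_fderiv' (f n)).aestronglyMeasurable.prodMk hD.1)
    · exact (hD.norm.integrable_mul hw2.norm).const_mul K
    · filter_upwards [hfd n] with x hx
      rw [hx, smul_apply, norm_smul, norm_gradient_eq_norm_fderiv]
      refine mul_le_mul (hK _) ?_ (norm_nonneg _) ((abs_nonneg _).trans (hK 0))
      rw [mul_comm]
      exact ContinuousLinearMap.le_opNorm _ _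
    · filter_upwards [ae_all_iff.2 hfd, ae_fderiv_eq_zero_of_eq_zero hw] with x hx hx0
      simp only [hx]
      by_cases h0 : w x = 0
      · simp [hx0 h0]
      · refine tendsto_const_nhds.congr' ?_
        obtain ⟨N, hN⟩ := exists_nat_gt (2 / |w x|)
        filter_upwards [eventually_ge_atTop N] with n hn
        rw [deriv_shrink_of_two_lt, one_smul]
        rw [abs_mul, abs_of_pos (show (0 : ℝ) < (n : ℝ) + 1 by positivity)]
        have h1 : (N : ℝ) ≤ n := by exact_mod_cast hn
        have h2 := (div_lt_iff₀ (abs_pos.2 h0)).1 hN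
        nlinarith [abs_pos.2 h0]
  refine tendsto_nhds_unique (hlim A hA) ?_
  simpa only [hlip _ (hf1 _) (hf2 _)] using hlim B hB

end WeakGradient

end Magneto

namespace Magneto

/-! ### Fields depending on time and place -/

namespace SmoothDomain

variable {d : ℕ} {Ω : SmoothDomain d} {T : ℝ}
variable {V : Type*} [NormedAddCommGroup V] [NormedSpace ℝ V]

theorem uniqueDiffOn_Ioo_prod_closed (Ω : SmoothDomain d) (T : ℝ) :
    UniqueDiffOn ℝ (Ioo 0 T ×ˢ Ω.closed) :=
  isOpen_Ioo.uniqueDiffOn.prod Ω.uniqueDiffOn_closed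

theorem contDiffOn_slice {k : WithTop ℕ∞} {q : ℝ × E d → V}
    (hq : ContDiffOn ℝ k q (Ioo 0 T ×ˢ Ω.closed)) {t : ℝ} (ht : t ∈ Ioo 0 T) :
    ContDiffOn ℝ k (fun x => q (t, x)) Ω.closed :=
  hq.comp (contDiff_const.prodMk contDiff_id).contDiffOn fun _ hx => ⟨ht, hx⟩

theorem hasDerivAt_time {q : ℝ × E d → V}
    (hq : ContDiffOn ℝ 1 q (Ioo 0 T ×ˢ Ω.closed)) {t : ℝ} (ht : t ∈ Ioo 0 T) {x : E d}
    (hx : x ∈ Ω.closed) :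
    HasDerivAt (fun r => q (r, x))
      (fderivWithin ℝ q (Ioo 0 T ×ˢ Ω.closed) (t, x) ((1 : ℝ), (0 : E d))) t := by
  have h1 := (hq.differentiableOn one_ne_zero (t, x) ⟨ht, hx⟩).hasFDerivWithinAt
  have h2 : HasDerivWithinAt (fun r : ℝ => (r, x)) ((1 : ℝ), (0 : E d)) (Ioo 0 T) t :=
    ((hasDerivAt_id t).prodMk (hasDerivAt_const t x)).hasDerivWithinAt
  have h3 : MapsTo (fun r : ℝ => (r, x)) (Ioo 0 T) (Ioo 0 T ×ˢ Ω.closed) := fun r hr => ⟨hr, hx⟩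
  exact (h1.comp_hasDerivWithinAt t h2 h3).hasDerivAt (isOpen_Ioo.mem_nhds ht)

theorem deriv_time_eq {q : ℝ × E d → V}
    (hq : ContDiffOn ℝ 1 q (Ioo 0 T ×ˢ Ω.closed)) {t : ℝ} (ht : t ∈ Ioo 0 T) {x : E d}
    (hx : x ∈ Ω.closed) :
    deriv (fun r => q (r, x)) t =
      fderivWithin ℝ q (Ioo 0 T ×ˢ Ω.closed) (t, x) ((1 : ℝ), (0 : E d)) :=
  (hasDerivAt_time hq ht hx).deriv

theorem contDiffOn_deriv_time {m k : WithTop ℕ∞} {q : ℝ × E d → V}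
    (hq : ContDiffOn ℝ k q (Ioo 0 T ×ˢ Ω.closed)) (hk : m + 1 ≤ k) :
    ContDiffOn ℝ m (fun p : ℝ × E d => deriv (fun r => q (r, p.2)) p.1) (Ioo 0 T ×ˢ Ω.closed) := by
  have h1 : (1 : WithTop ℕ∞) ≤ k := le_trans (by simp) hk
  refine ((hq.fderivWithin (Ω.uniqueDiffOn_Ioo_prod_closed T) hk).clm_apply
    (contDiffOn_const (c := ((1 : ℝ), (0 : E d))))).congr fun p hp => ?_
  exact deriv_time_eq (hq.of_le h1) hp.1 hp.2

theorem pd_slice_eq {q : ℝ × E d → ℝ}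
    (hq : ContDiffOn ℝ 1 q (Ioo 0 T ×ˢ Ω.closed)) {t : ℝ} (ht : t ∈ Ioo 0 T) {x : E d}
    (hx : x ∈ Ω.closed) (j : Fin d) :
    Ω.pd (fun y => q (t, y)) j x =
      fderivWithin ℝ q (Ioo 0 T ×ˢ Ω.closed) (t, x) ((0 : ℝ), EuclideanSpace.single j 1) := by
  have h1 := (hq.differentiableOn one_ne_zero (t, x) ⟨ht, hx⟩).hasFDerivWithinAt
  have h2 : HasFDerivWithinAt (fun y : E d => (t, y))
      ((0 : E d →L[ℝ] ℝ).prod (ContinuousLinearMap.id ℝ (E d))) Ω.closed x :=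
    ((hasFDerivAt_const t x).prodMk (hasFDerivAt_id x)).hasFDerivWithinAt
  have h3 := h1.comp x h2 fun y hy => ⟨ht, hy⟩
  have h4 := h3.fderivWithin (Ω.uniqueDiffOn_closed x hx)
  rw [pd]
  change fderivWithin ℝ (q ∘ fun y => (t, y)) Ω.closed x _ = _
  rw [h4]
  rfl

theorem contDiffOn_pd_slice {m k : WithTop ℕ∞} {q : ℝ × E d → ℝ}
    (hq : ContDiffOn ℝ k q (Ioo 0 T ×ˢ Ω.closed)) (hk : m + 1 ≤ k) (j : Fin d) :
    ContDiffOn ℝ m (fun p : ℝ × E d => Ω.pd (fun y => q (p.1, y)) j p.2)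
      (Ioo 0 T ×ˢ Ω.closed) := by
  have h1 : (1 : WithTop ℕ∞) ≤ k := le_trans (by simp) hk
  refine ((hq.fderivWithin (Ω.uniqueDiffOn_Ioo_prod_closed T) hk).clm_apply
    (contDiffOn_const (c := ((0 : ℝ), (EuclideanSpace.single j 1 : E d))))).congr fun p hp => ?_
  exact pd_slice_eq (hq.of_le h1) hp.1 hp.2 j

theorem deriv_pd {q : ℝ × E d → ℝ} (hq : ContDiffOn ℝ 2 q (Ioo 0 T ×ˢ Ω.closed)) {t : ℝ}
    (ht : t ∈ Ioo 0 T) {x : E d} (hx : x ∈ Ω.carrier) (j : Fin d) :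
    deriv (fun r => Ω.pd (fun y => q (r, y)) j x) t =
      Ω.pd (fun y => deriv (fun r => q (r, y)) t) j x := by
  have hq1 : ContDiffOn ℝ 1 q (Ioo 0 T ×ˢ Ω.closed) := hq.of_le (by norm_num)
  have hnhd : Ioo 0 T ×ˢ Ω.closed ∈ 𝓝 (t, x) :=
    prod_mem_nhds (isOpen_Ioo.mem_nhds ht) (Ω.closed_mem_nhds hx)
  have hfd : ∀ r ∈ Ioo 0 T, ∀ y ∈ Ω.carrier,
      fderivWithin ℝ q (Ioo 0 T ×ˢ Ω.closed) (r, y) = fderiv ℝ q (r, y) := fun r hr y hy =>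
    fderivWithin_of_mem_nhds (prod_mem_nhds (isOpen_Ioo.mem_nhds hr) (Ω.closed_mem_nhds hy))
  have hqa : ContDiffAt ℝ 2 q (t, x) := hq.contDiffAt hnhd
  have hd : DifferentiableAt ℝ (fderiv ℝ q) (t, x) :=
    (hqa.fderiv_right (m := 1) (by norm_num)).differentiableAt (by simp)
  have hL : deriv (fun r => Ω.pd (fun y => q (r, y)) j x) t =
      fderiv ℝ (fderiv ℝ q) (t, x) ((1 : ℝ), (0 : E d))
        ((0 : ℝ), EuclideanSpace.single j 1) := by
    have he : (fun r => Ω.pd (fun y => q (r, y)) j x) =ᶠ[𝓝 t]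
        fun r => fderiv ℝ q (r, x) ((0 : ℝ), EuclideanSpace.single j 1) := by
      filter_upwards [isOpen_Ioo.mem_nhds ht] with r hr
      rw [pd_slice_eq hq1 hr (Ω.carrier_subset_closed hx), hfd r hr x hx]
    rw [he.deriv_eq]
    have h2 : HasDerivAt (fun r : ℝ => (r, x)) ((1 : ℝ), (0 : E d)) t :=
      (hasDerivAt_id t).prodMk (hasDerivAt_const t x)
    have h3 := hd.hasFDerivAt.comp_hasDerivAt t h2
    exact (h3.clm_apply (hasDerivAt_const t
      ((0 : ℝ), (EuclideanSpace.single j 1 : E d)))).deriv.trans (by simp)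
  have hR : Ω.pd (fun y => deriv (fun r => q (r, y)) t) j x =
      fderiv ℝ (fderiv ℝ q) (t, x) ((0 : ℝ), EuclideanSpace.single j 1)
        ((1 : ℝ), (0 : E d)) := by
    have he : (fun y => deriv (fun r => q (r, y)) t) =ᶠ[𝓝 x]
        fun y => fderiv ℝ q (t, y) ((1 : ℝ), (0 : E d)) := by
      filter_upwards [Ω.isOpen_carrier.mem_nhds hx] with y hy
      rw [deriv_time_eq hq1 ht (Ω.carrier_subset_closed hy), hfd t ht y hy]
    rw [pd_congr_nhds he, Ω.pd_eq_fderiv hx]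
    have h2 : HasFDerivAt (fun y : E d => (t, y))
        ((0 : E d →L[ℝ] ℝ).prod (ContinuousLinearMap.id ℝ (E d))) x :=
      (hasFDerivAt_const t x).prodMk (hasFDerivAt_id x)
    have h3 := hd.hasFDerivAt.comp x h2
    have h4 := (h3.clm_apply (hasFDerivAt_const ((1 : ℝ), (0 : E d)) x)).fderiv
    change fderiv ℝ (fun y => (fderiv ℝ q ∘ fun y => (t, y)) y ((1 : ℝ), (0 : E d))) x _ = _
    rw [h4]
    simp
  rw [hL, hR]
  exact (hqa.isSymmSndFDerivAt (by simp)).eq _ _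

/-- Differentiation under the integral over the domain. -/
theorem hasDerivAt_integral_time {q : ℝ × E d → ℝ}
    (hq : ContDiffOn ℝ 1 q (Ioo 0 T ×ˢ Ω.closed)) {t : ℝ} (ht : t ∈ Ioo 0 T) :
    HasDerivAt (fun r => ∫ x in Ω.carrier, q (r, x))
      (∫ x in Ω.carrier, deriv (fun r => q (r, x)) t) t := by
  obtain ⟨δ, hδ, hsub⟩ := Metric.isOpen_iff.1 isOpen_Ioo t ht
  have hsub' : Metric.closedBall t (δ / 2) ⊆ Ioo 0 T :=
    (Metric.closedBall_subset_ball (by linarith)).trans hsub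
  have hc := (contDiffOn_deriv_time (m := 0) hq (by simp)).continuousOn
  obtain ⟨C, hC⟩ :=
    ((isCompact_closedBall t (δ / 2)).prod Ω.isCompact_closed).exists_bound_of_continuousOn
    (hc.mono (prod_mono hsub' subset_rfl))
  have hmeas := Ω.isOpen_carrier.measurableSet
  refine (hasDerivAt_integral_of_dominated_loc_of_deriv_le (bound := fun _ => C)
    (F' := fun r x => deriv (fun r => q (r, x)) r)
    (Metric.ball_mem_nhds t (half_pos hδ)) ?_ ?_ ?_ ?_ ?_ ?_).2
  · filter_upwards [isOpen_Ioo.mem_nhds ht] with r hr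
    exact (Ω.integrableOn_carrier (contDiffOn_slice hq hr).continuousOn).aestronglyMeasurable
  · exact Ω.integrableOn_carrier (contDiffOn_slice hq ht).continuousOn
  · exact (Ω.integrableOn_carrier (hc.comp (continuous_const.prodMk continuous_id).continuousOn
      fun x hx => (⟨ht, hx⟩ : (t, x) ∈ Ioo 0 T ×ˢ Ω.closed))).aestronglyMeasurable
  · filter_upwards [ae_restrict_mem hmeas] with x hx r hr
    exact hC (r, x) ⟨Metric.ball_subset_closedBall hr, Ω.carrier_subset_closed hx⟩
  · exact integrableOn_const (Ω.bounded.measure_lt_top).ne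
  · filter_upwards [ae_restrict_mem hmeas] with x hx r hr
    have := hasDerivAt_time hq (hsub' (Metric.ball_subset_closedBall hr))
      (Ω.carrier_subset_closed hx)
    exact this.differentiableAt.hasDerivAt

theorem gradient_eq_grad {x : E d} (hx : x ∈ Ω.carrier) (f : E d → ℝ) :
    gradient f x = Ω.grad f x := by
  ext j
  have := inner_gradient_eq_fderiv (EuclideanSpace.single j 1) x f
  rw [grad]
  change _ = Ω.pd f j x
  rw [Ω.pd_eq_fderiv hx, ← this, EuclideanSpace.inner_single_left]
  simp only [map_one, one_mul]

end SmoothDomain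

open SmoothDomain

variable {d : ℕ} {Ω : SmoothDomain d} {M : Material d} {L : Loads d} {s : Fields d} {T : ℝ}

/-! ### The demagnetizing field -/

theorem memLp_indicator_of_continuousOn {w : E d → E d} (hw : ContinuousOn w Ω.closed) :
    MemLp (Ω.carrier.indicator w) 2 := by
  have hm := Ω.isOpen_carrier.measurableSet
  rw [memLp_indicator_iff_restrict hm]
  obtain ⟨C, hC⟩ := Ω.isCompact_closed.exists_bound_of_continuousOn hw
  have : IsFiniteMeasure (volume.restrict Ω.carrier) :=
    ⟨by simpa using Ω.bounded.measure_lt_top⟩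
  refine MemLp.of_bound ((hw.mono Ω.carrier_subset_closed).aestronglyMeasurable hm) C ?_
  filter_upwards [ae_restrict_mem hm] with x hx using hC x (Ω.carrier_subset_closed hx)

namespace IsSmoothSolution

variable (hs : IsSmoothSolution Ω M L s T)
include hs

theorem integral_inner_gradient {a b : ℝ} (ha : a ∈ Ioo 0 T) (hb : b ∈ Ioo 0 T) :
    ∫ x, inner ℝ (gradient (s.u a) x) (gradient (s.u b) x) =
      ∫ x in Ω.carrier, inner ℝ (s.m a x) (Ω.grad (s.u b) x) := by
  have hm := Ω.isOpen_carrier.measurableSet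
  have hind : ∀ G : E d → E d, ∫ x, inner ℝ (Ω.carrier.indicator (s.m a) x) (G x) =
      ∫ x in Ω.carrier, inner ℝ (s.m a x) (G x) := by
    intro G
    rw [← integral_indicator hm]
    refine integral_congr_ae (Eventually.of_forall fun x => ?_)
    by_cases hx : x ∈ Ω.carrier <;> simp [hx]
  rw [integral_inner_gradient_eq (hs.u_energy a ha)
    (memLp_indicator_of_continuousOn (contDiffOn_slice hs.smooth_m ha).continuousOn) ?_
    (hs.u_lipschitz b hb) (hs.u_energy b hb) (hs.u_infinity b hb), hind]
  · exact setIntegral_congr_fun hm fun x hx => by simp only [gradient_eq_grad hx]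
  · intro η h1 h2
    rw [hind, hs.poisson a ha η h1 h2]

theorem demag_symm {a b : ℝ} (ha : a ∈ Ioo 0 T) (hb : b ∈ Ioo 0 T) :
    ∫ x in Ω.carrier, inner ℝ (s.m a x) (Ω.grad (s.u b) x) =
      ∫ x in Ω.carrier, inner ℝ (s.m b x) (Ω.grad (s.u a) x) := by
  rw [← hs.integral_inner_gradient ha hb, ← hs.integral_inner_gradient hb ha]
  simp only [real_inner_comm]

theorem integral_demag {t : ℝ} (ht : t ∈ Ioo 0 T) :
    ∫ x, M.μ₀ / 2 * ‖gradient (s.u t) x‖ ^ 2 =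
      M.μ₀ / 2 * ∫ x in Ω.carrier, inner ℝ (s.m t x) (Ω.grad (s.u t) x) := by
  rw [← hs.integral_inner_gradient ht ht, integral_const_mul]
  simp only [real_inner_self_eq_norm_sq]

theorem contDiffOn_grad_u : ContDiffOn ℝ ∞ (fun q : ℝ × E d => Ω.grad (s.u q.1) q.2)
    (Ioo 0 T ×ˢ Ω.closed) :=
  contDiffOn_vector.2 fun j => contDiffOn_pd_slice hs.smooth_u (by simp) j

/-- The derivative of the interaction of the magnetization with the demagnetizing field. -/
theorem integral_inner_deriv_grad_u {t : ℝ} (ht : t ∈ Ioo 0 T) :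
    ∫ x in Ω.carrier, inner ℝ (s.m t x) (deriv (fun r => Ω.grad (s.u r) x) t) =
      ∫ x in Ω.carrier, inner ℝ (deriv (fun r => s.m r x) t) (Ω.grad (s.u t) x) := by
  have hu := contDiffOn_infty.1 hs.contDiffOn_grad_u 1
  have hm := contDiffOn_infty.1 hs.smooth_m 1
  have hmeas := Ω.isOpen_carrier.measurableSet
  have hproj : ContDiffOn ℝ 1 (fun q : ℝ × E d => (t, q.2)) (Ioo 0 T ×ˢ Ω.closed) :=
    (contDiff_const.prodMk contDiff_snd).contDiffOn
  have hmaps : MapsTo (fun q : ℝ × E d => (t, q.2)) (Ioo 0 T ×ˢ Ω.closed) (Ioo 0 T ×ˢ Ω.closed) :=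
    fun q hq => ⟨ht, hq.2⟩
  have h1 := hasDerivAt_integral_time ((hm.comp hproj hmaps).inner ℝ hu) ht
  have h2 := hasDerivAt_integral_time (hm.inner ℝ (hu.comp hproj hmaps)) ht
  have he : (fun r => ∫ x in Ω.carrier, inner ℝ (s.m t x) (Ω.grad (s.u r) x)) =ᶠ[𝓝 t]
      fun r => ∫ x in Ω.carrier, inner ℝ (s.m r x) (Ω.grad (s.u t) x) := by
    filter_upwards [isOpen_Ioo.mem_nhds ht] with r hr using hs.demag_symm ht hr
  have h3 := h1.unique (h2.congr_of_eventuallyEq he)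
  have e1 : ∀ x ∈ Ω.carrier, deriv (fun r => inner ℝ (s.m t x) (Ω.grad (s.u r) x)) t =
      inner ℝ (s.m t x) (deriv (fun r => Ω.grad (s.u r) x) t) := by
    intro x hx
    have := (hasDerivAt_time hu ht (Ω.carrier_subset_closed hx)).differentiableAt.hasDerivAt
    simpa using ((hasDerivAt_const t (s.m t x)).inner ℝ this).deriv
  have e2 : ∀ x ∈ Ω.carrier, deriv (fun r => inner ℝ (s.m r x) (Ω.grad (s.u t) x)) t =
      inner ℝ (deriv (fun r => s.m r x) t) (Ω.grad (s.u t) x) := by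
    intro x hx
    have := (hasDerivAt_time hm ht (Ω.carrier_subset_closed hx)).differentiableAt.hasDerivAt
    simpa using (this.inner ℝ (hasDerivAt_const t (Ω.grad (s.u t) x))).deriv
  rw [← setIntegral_congr_fun hmeas e1, ← setIntegral_congr_fun hmeas e2]
  exact h3

end IsSmoothSolution

end Magneto

namespace Magneto

/-! ### Calculus of functions of matrices and vectors -/

section MatrixCalculus

variable {d : ℕ}

theorem continuous_det : Continuous fun F : Mat d => F.det :=
  Continuous.matrix_det (continuous_id (X := Matrix (Fin d) (Fin d) ℝ))

theorem isOpen_det_pos : IsOpen {F : Mat d | 0 < F.det} :=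
  isOpen_lt continuous_const continuous_det

/-- The determinant as a continuous multilinear function of the rows. -/
noncomputable def detMultilinear (d : ℕ) :
    ContinuousMultilinearMap ℝ (fun _ : Fin d => Fin d → ℝ) ℝ where
  toMultilinearMap := (Matrix.detRowAlternating (n := Fin d) (R := ℝ)).toMultilinearMap
  cont := continuous_det

theorem contDiff_det : ContDiff ℝ ⊤ fun F : Mat d => F.det :=
  (detMultilinear d).contDiff

/-- Jacobi's formula, along a curve with `Ḟ = A F`. -/
theorem hasDerivAt_det {F : ℝ → Mat d} {A : Mat d} {a : ℝ} (hF : HasDerivAt F (A * F a) a) :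
    HasDerivAt (fun r => (F r).det) (A.trace * (F a).det) a := by
  have h1 := ((detMultilinear d).hasFDerivAt (x := F a)).comp_hasDerivAt a hF
  refine h1.congr_deriv ?_
  refine (ContinuousMultilinearMap.linearDeriv_apply (detMultilinear d) (F a) (A * F a)).trans ?_
  rw [Matrix.trace, Finset.sum_mul]
  refine Finset.sum_congr rfl fun i _ => ?_
  change ((F a).updateRow i ((A * F a) i)).det = _
  have e : (A * F a) i = ∑ k, A i k • (F a) k := by
    ext j; simp [Matrix.mul_apply, Finset.sum_apply]
  rw [e, Matrix.det_updateRow_sum (F a) i (fun k => A i k)]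
  rfl

theorem fderiv_matrix_apply (f : Mat d → ℝ) (F B : Mat d) :
    fderiv ℝ f F B = ddot (matDeriv f F) B := by
  conv_lhs => rw [Matrix.matrix_eq_sum_single B]
  rw [map_sum, ddot]
  refine Finset.sum_congr rfl fun i _ => ?_
  rw [map_sum]
  refine Finset.sum_congr rfl fun j _ => ?_
  have : Matrix.single i j (B i j) = B i j • Matrix.single i j (1 : ℝ) := by
    rw [Matrix.smul_single, smul_eq_mul, mul_one]
  rw [this, map_smul, smul_eq_mul, mul_comm]
  rfl

theorem ddot_mul_right (P A F : Mat d) : ddot P (A * F) = ddot (P * Fᵀ) A := by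
  simp only [ddot, Matrix.mul_apply, Matrix.transpose_apply, Finset.mul_sum, Finset.sum_mul]
  refine Finset.sum_congr rfl fun i _ => ?_
  rw [Finset.sum_comm]
  exact Finset.sum_congr rfl fun k _ => Finset.sum_congr rfl fun j _ => by ring

variable {f : Mat d × E d → ℝ} {F : Mat d} {m : E d}

theorem hasFDerivAt_left (hf : DifferentiableAt ℝ f (F, m)) :
    HasFDerivAt (fun G => f (G, m))
      ((fderiv ℝ f (F, m)).comp (ContinuousLinearMap.inl ℝ (Mat d) (E d))) F :=
  hf.hasFDerivAt.comp F (hasFDerivAt_prodMk_left F m)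

theorem hasFDerivAt_right (hf : DifferentiableAt ℝ f (F, m)) :
    HasFDerivAt (fun a => f (F, a))
      ((fderiv ℝ f (F, m)).comp (ContinuousLinearMap.inr ℝ (Mat d) (E d))) m :=
  hf.hasFDerivAt.comp m (hasFDerivAt_prodMk_right F m)

theorem matDeriv_left (hf : DifferentiableAt ℝ f (F, m)) (i j : Fin d) :
    matDeriv (fun G => f (G, m)) F i j = fderiv ℝ f (F, m) (Matrix.single i j 1, 0) := by
  change fderiv ℝ (fun G => f (G, m)) F _ = _
  rw [(hasFDerivAt_left hf).fderiv]
  simp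

theorem gradient_right (hf : DifferentiableAt ℝ f (F, m)) (i : Fin d) :
    gradient (fun a => f (F, a)) m i = fderiv ℝ f (F, m) (0, EuclideanSpace.single i 1) := by
  have := inner_gradient_eq_fderiv (EuclideanSpace.single i 1) m (fun a => f (F, a))
  rw [EuclideanSpace.inner_single_left, (hasFDerivAt_right hf).fderiv] at this
  simpa using this

theorem fderiv_prod_apply (hf : DifferentiableAt ℝ f (F, m)) (B : Mat d) (b : E d) :
    fderiv ℝ f (F, m) (B, b) =
      ddot (matDeriv (fun G => f (G, m)) F) B + inner ℝ (gradient (fun a => f (F, a)) m) b := by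
  rw [← fderiv_matrix_apply, real_inner_comm, inner_gradient_eq_fderiv,
    (hasFDerivAt_left hf).fderiv, (hasFDerivAt_right hf).fderiv]
  simp only [ContinuousLinearMap.comp_apply, ContinuousLinearMap.inl_apply,
    ContinuousLinearMap.inr_apply]
  rw [← map_add]
  simp

theorem hasDerivAt_matrix {F : ℝ → Mat d} {B : Mat d} {a : ℝ}
    (h : ∀ i j, HasDerivAt (fun r => F r i j) (B i j) a) : HasDerivAt F B a :=
  hasDerivAt_pi.2 fun i => hasDerivAt_pi.2 fun j => h i j

theorem hasDerivAt_vector {w : ℝ → E d} {b : E d} {a : ℝ} :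
    HasDerivAt w b a ↔ ∀ i, HasDerivAt (fun r => w r i) (b i) a := by
  constructor
  · intro h i
    exact (EuclideanSpace.proj (𝕜 := ℝ) i).hasFDerivAt.comp_hasDerivAt a h
  · intro h
    have h1 : HasDerivAt (fun r => (w r).ofLp) b.ofLp a := hasDerivAt_pi.2 h
    exact ((PiLp.continuousLinearEquiv 2 ℝ fun _ : Fin d => ℝ).symm :
      (Fin d → ℝ) →L[ℝ] E d).hasFDerivAt.comp_hasDerivAt a h1

end MatrixCalculus

/-! ### Convective derivatives -/

namespace SmoothDomain

variable {d : ℕ} {Ω : SmoothDomain d} {T : ℝ}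

/-- The derivative `∂q/∂t + w·∇q` along the flow with velocity `w`. -/
noncomputable def conv (Ω : SmoothDomain d) (w : E d) (q : ℝ × E d → ℝ) (t : ℝ) (x : E d) : ℝ :=
  deriv (fun r => q (r, x)) t + ∑ k, w k * Ω.pd (fun y => q (t, y)) k x

theorem hasDerivAt_conv {q : ℝ × E d → ℝ} (hq : ContDiffOn ℝ 1 q (Ioo 0 T ×ˢ Ω.closed)) {t : ℝ}
    (ht : t ∈ Ioo 0 T) {x : E d} (hx : x ∈ Ω.carrier) (w : E d) :
    HasDerivAt (fun ε : ℝ => q (t + ε, x + ε • w)) (Ω.conv w q t x) 0 := by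
  have hnhd : Ioo 0 T ×ˢ Ω.closed ∈ 𝓝 (t, x) :=
    prod_mem_nhds (isOpen_Ioo.mem_nhds ht) (Ω.closed_mem_nhds hx)
  have h1 : HasFDerivAt q (fderiv ℝ q (t, x)) (t, x) :=
    ((hq.contDiffAt hnhd).differentiableAt one_ne_zero).hasFDerivAt
  have h2 : HasDerivAt (fun ε : ℝ => (t + ε, x + ε • w)) ((1 : ℝ), w) 0 := by
    have e1 : HasDerivAt (fun ε : ℝ => t + ε) 1 0 := by
      simpa using (hasDerivAt_id (0 : ℝ)).const_add t
    have e2 : HasDerivAt (fun ε : ℝ => x + ε • w) w 0 := by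
      simpa using ((hasDerivAt_id (0 : ℝ)).smul_const w).const_add x
    exact e1.prodMk e2
  have h1' : HasFDerivAt q (fderiv ℝ q (t, x)) (t + 0, x + (0 : ℝ) • w) := by simpa using h1
  refine (h1'.comp_hasDerivAt (0 : ℝ) h2).congr_deriv ?_
  rw [conv, deriv_time_eq hq ht (Ω.carrier_subset_closed hx), fderivWithin_of_mem_nhds hnhd]
  have e : ((1 : ℝ), w) = ((1 : ℝ), (0 : E d)) +
      ∑ k, w k • ((0 : ℝ), (EuclideanSpace.single k 1 : E d)) := by
    refine Prod.ext ?_ ?_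
    · simp [Prod.fst_sum]
    · ext i
      simp [Prod.snd_sum, Pi.single_apply]
  rw [e, map_add, map_sum]
  congr 1
  refine Finset.sum_congr rfl fun k _ => ?_
  rw [map_smul, smul_eq_mul, pd_slice_eq hq ht (Ω.carrier_subset_closed hx),
    fderivWithin_of_mem_nhds hnhd]

theorem conv_eq_of_hasDerivAt {q : ℝ × E d → ℝ} (hq : ContDiffOn ℝ 1 q (Ioo 0 T ×ˢ Ω.closed))
    {t : ℝ} (ht : t ∈ Ioo 0 T) {x : E d} (hx : x ∈ Ω.carrier) {w : E d} {a : ℝ}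
    (h : HasDerivAt (fun ε : ℝ => q (t + ε, x + ε • w)) a 0) : Ω.conv w q t x = a :=
  (hasDerivAt_conv hq ht hx w).unique h

theorem divV_smul {q : E d → ℝ} {w : E d → E d} {x : E d} (hx : x ∈ Ω.closed)
    (hq : DifferentiableWithinAt ℝ q Ω.closed x)
    (hw : ∀ j, DifferentiableWithinAt ℝ (fun y => w y j) Ω.closed x) :
    Ω.divV (fun y => q y • w y) x = ∑ k, w x k * Ω.pd q k x + q x * Ω.divV w x := by
  have : ∀ j, Ω.pd (fun y => (q y • w y) j) j x =
      w x j * Ω.pd q j x + q x * Ω.pd (fun y => w y j) j x := by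
    intro j
    have := pd_mul hx hq (hw j) j
    simp only [PiLp.smul_apply, smul_eq_mul]
    rw [this]; ring
  simp only [divV, this, Finset.sum_add_distrib, Finset.mul_sum]

theorem continuousOn_conv {q : ℝ × E d → ℝ} (hq : ContDiffOn ℝ 1 q (Ioo 0 T ×ˢ Ω.closed)) {t : ℝ}
    (ht : t ∈ Ioo 0 T) {w : E d → E d} (hw : ContinuousOn w Ω.closed) :
    ContinuousOn (fun x => Ω.conv (w x) q t x) Ω.closed := by
  refine ContinuousOn.add ?_ ?_
  · exact (contDiffOn_slice (contDiffOn_deriv_time (m := 0) hq (by simp)) ht).continuousOn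
  · exact continuousOn_finsetSum _ fun k _ => (continuousOn_coord hw k).mul
      (continuousOn_pd (contDiffOn_slice hq ht) le_rfl k)

/-- Reynolds' transport theorem in a domain with impermeable boundary. -/
theorem integral_deriv_eq_integral_conv {n : ℕ} {Ω : SmoothDomain (n + 1)} {q : ℝ × E (n + 1) → ℝ}
    (hq : ContDiffOn ℝ 1 q (Ioo 0 T ×ˢ Ω.closed)) {t : ℝ} (ht : t ∈ Ioo 0 T)
    {w : E (n + 1) → E (n + 1)} (hw : ContDiffOn ℝ 1 w Ω.closed)
    (hn : ∀ x ∈ Ω.bdry, inner ℝ (w x) (Ω.normal x) = 0) :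
    ∫ x in Ω.carrier, deriv (fun r => q (r, x)) t =
      ∫ x in Ω.carrier, (Ω.conv (w x) q t x + q (t, x) * Ω.divV w x) := by
  have hqt := contDiffOn_slice hq ht
  have hqw : ContDiffOn ℝ 1 (fun y => q (t, y) • w y) Ω.closed := hqt.smul hw
  have hmeas := Ω.isOpen_carrier.measurableSet
  have h1 : ∫ x in Ω.carrier, Ω.divV (fun y => q (t, y) • w y) x = 0 := by
    rw [integral_divV hqw, surf]
    refine setIntegral_eq_zero_of_forall_eq_zero fun x hx => ?_
    rw [inner_smul_left, hn x hx, mul_zero]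
  have hd : IntegrableOn (fun x => deriv (fun r => q (r, x)) t) Ω.carrier :=
    Ω.integrableOn_carrier
      (contDiffOn_slice (contDiffOn_deriv_time (m := 0) hq (by simp)) ht).continuousOn
  have hi : IntegrableOn (Ω.divV fun y => q (t, y) • w y) Ω.carrier :=
    Ω.integrableOn_carrier (continuousOn_divV hqw)
  calc ∫ x in Ω.carrier, deriv (fun r => q (r, x)) t
      = ∫ x in Ω.carrier, (deriv (fun r => q (r, x)) t + Ω.divV (fun y => q (t, y) • w y) x) := by
        rw [integral_add hd hi, h1, add_zero]
    _ = _ := by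
        refine setIntegral_congr_fun hmeas fun x hx => ?_
        have hx' := Ω.carrier_subset_closed hx
        rw [divV_smul hx' (hqt.differentiableOn one_ne_zero x hx')
          fun j => (contDiffOn_vector.1 hw j).differentiableOn one_ne_zero x hx', conv]
        ring

end SmoothDomain

end Magneto

namespace Magneto

open SmoothDomain

section Algebra

variable {d : ℕ}

theorem frob_sq (A : Mat d) : frob A ^ 2 = ∑ i, ∑ j, A i j ^ 2 :=
  Real.sq_sqrt (Finset.sum_nonneg fun _ _ => Finset.sum_nonneg fun _ _ => sq_nonneg _)

theorem mulV_apply (A : Mat d) (x : E d) (i : Fin d) : mulV A x i = ∑ j, A i j * x j := rfl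

theorem skw_apply (A : Mat d) (i j : Fin d) : skw A i j = (A i j - A j i) / 2 := by
  simp [skw]; ring

theorem sum_skw (A B : Fin d → Fin d → ℝ) (h : ∀ i j, B j i = -B i j) :
    ∑ i, ∑ j, A i j * B i j = ∑ i, ∑ j, (A i j - A j i) / 2 * B i j := by
  have : ∑ i, ∑ j, A i j * B i j = -∑ i, ∑ j, A j i * B i j := by
    rw [Finset.sum_comm, ← Finset.sum_neg_distrib]
    refine Finset.sum_congr rfl fun i _ => ?_
    rw [← Finset.sum_neg_distrib]
    exact Finset.sum_congr rfl fun j _ => by rw [h j i]; ring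
  have e : ∑ i, ∑ j, (A i j - A j i) / 2 * B i j =
      (∑ i, ∑ j, A i j * B i j) / 2 - (∑ i, ∑ j, A j i * B i j) / 2 := by
    rw [Finset.sum_div, Finset.sum_div, ← Finset.sum_sub_distrib]
    refine Finset.sum_congr rfl fun i _ => ?_
    rw [Finset.sum_div, Finset.sum_div, ← Finset.sum_sub_distrib]
    exact Finset.sum_congr rfl fun j _ => by ring
  rw [e]; linarith

theorem ddot_skw_outer (a b : E d) (A : Mat d) :
    ddot (skw (outer a b)) A = -inner ℝ b (mulV (skw A) a) := by
  have h1 : ddot (skw (outer a b)) A = ∑ i, ∑ j, skw (outer a b) i j * skw A i j := by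
    simp only [ddot]
    have := sum_skw A (skw (outer a b)) (fun i j => by simp only [skw_apply]; ring)
    simp only [mul_comm (A _ _)] at this
    rw [this]
    exact Finset.sum_congr rfl fun i _ => Finset.sum_congr rfl fun j _ => by
      rw [skw_apply A]; ring
  have h2 := sum_skw (outer a b) (skw A) (fun i j => by simp only [skw_apply]; ring)
  simp only [h1, inner_eq_sum, mulV_apply, ← Finset.sum_neg_distrib, Finset.mul_sum]
  simp only [skw_apply (outer a b), ← h2]
  rw [Finset.sum_comm]
  exact Finset.sum_congr rfl fun i _ => Finset.sum_congr rfl fun j _ => by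
    simp only [outer, Matrix.of_apply, skw_apply]; ring

theorem sum_mul_skw_mul (G : Mat d) (W : Mat d) :
    ∑ i, ∑ k, G i k * ∑ j, skw W i j * G j k = 0 := by
  have h1 : ∑ i, ∑ k, G i k * ∑ j, skw W i j * G j k =
      ∑ i, ∑ j, (∑ k, G i k * G j k) * skw W i j := by
    refine Finset.sum_congr rfl fun i _ => ?_
    simp only [Finset.mul_sum, Finset.sum_mul]
    rw [Finset.sum_comm]
    exact Finset.sum_congr rfl fun j _ => Finset.sum_congr rfl fun k _ => by ring
  rw [h1, sum_skw _ (skw W) (fun i j => by simp only [skw_apply]; ring)]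
  refine Finset.sum_eq_zero fun i _ => Finset.sum_eq_zero fun j _ => ?_
  rw [show ∑ k, G i k * G j k = ∑ k, G j k * G i k from
    Finset.sum_congr rfl fun k _ => mul_comm _ _]
  simp

end Algebra

variable {d : ℕ} {Ω : SmoothDomain d} {M : Material d} {L : Loads d} {s : Fields d} {T : ℝ}

/-- The stored energy density per actual volume, including the exchange energy. -/
noncomputable def storedDensity (Ω : SmoothDomain d) (M : Material d) (s : Fields d) (t : ℝ)
    (x : E d) : ℝ :=
  M.φ (s.F t x) (s.m t x) / (s.F t x).det + M.κ (s.F t x) * gradMsq Ω s t x / (2 * (s.F t x).det)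

namespace IsSmoothSolution

variable (hs : IsSmoothSolution Ω M L s T)
include hs

/-! ### Regularity of composite fields -/

theorem joint_m (i : Fin d) :
    ContDiffOn ℝ ∞ (fun q : ℝ × E d => s.m q.1 q.2 i) (Ioo 0 T ×ˢ Ω.closed) :=
  contDiffOn_vector.1 hs.smooth_m i

theorem joint_v (i : Fin d) :
    ContDiffOn ℝ ∞ (fun q : ℝ × E d => s.v q.1 q.2 i) (Ioo 0 T ×ˢ Ω.closed) :=
  contDiffOn_vector.1 hs.smooth_v i

theorem joint_F (i j : Fin d) :
    ContDiffOn ℝ ∞ (fun q : ℝ × E d => s.F q.1 q.2 i j) (Ioo 0 T ×ˢ Ω.closed) :=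
  contDiffOn_matrix.1 hs.smooth_F i j

theorem joint_gradM (i j : Fin d) :
    ContDiffOn ℝ ∞ (fun q : ℝ × E d => Ω.gradV (s.m q.1) q.2 i j) (Ioo 0 T ×ˢ Ω.closed) :=
  contDiffOn_pd_slice (hs.joint_m i) (by simp) j

theorem joint_gradMsq :
    ContDiffOn ℝ ∞ (fun q : ℝ × E d => gradMsq Ω s q.1 q.2) (Ioo 0 T ×ˢ Ω.closed) := by
  simp only [gradMsq, frob_sq]
  exact ContDiffOn.sum fun i _ => ContDiffOn.sum fun j _ => (hs.joint_gradM i j).pow 2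

theorem joint_det :
    ContDiffOn ℝ ∞ (fun q : ℝ × E d => (s.F q.1 q.2).det) (Ioo 0 T ×ˢ Ω.closed) :=
  (contDiff_det.of_le le_top).comp_contDiffOn hs.smooth_F

theorem joint_phi :
    ContDiffOn ℝ 1 (fun q : ℝ × E d => M.φ (s.F q.1 q.2) (s.m q.1 q.2)) (Ioo 0 T ×ˢ Ω.closed) :=
  M.φ_C1.comp ((contDiffOn_infty.1 hs.smooth_F 1).prodMk (contDiffOn_infty.1 hs.smooth_m 1))
    fun q hq => hs.det_pos q.1 hq.1 q.2 hq.2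

theorem joint_kappa :
    ContDiffOn ℝ 1 (fun q : ℝ × E d => M.κ (s.F q.1 q.2)) (Ioo 0 T ×ˢ Ω.closed) :=
  M.κ_C1.comp (contDiffOn_infty.1 hs.smooth_F 1) fun q hq => hs.det_pos q.1 hq.1 q.2 hq.2

theorem joint_exch :
    ContDiffOn ℝ 1 (fun q : ℝ × E d => exch M s q.1 q.2) (Ioo 0 T ×ˢ Ω.closed) :=
  hs.joint_kappa.div (contDiffOn_infty.1 hs.joint_det 1) fun q hq =>
    (hs.det_pos q.1 hq.1 q.2 hq.2).ne'

theorem joint_storedDensity :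
    ContDiffOn ℝ 1 (fun q : ℝ × E d => storedDensity Ω M s q.1 q.2) (Ioo 0 T ×ˢ Ω.closed) := by
  have hdet := contDiffOn_infty.1 hs.joint_det 1
  refine (hs.joint_phi.div hdet fun q hq => (hs.det_pos q.1 hq.1 q.2 hq.2).ne').add
    ((hs.joint_kappa.mul (contDiffOn_infty.1 hs.joint_gradMsq 1)).div
      (contDiffOn_const.mul hdet) fun q hq => ?_)
  have := hs.det_pos q.1 hq.1 q.2 hq.2
  positivity

theorem joint_mDot :
    ContDiffOn ℝ ∞ (fun q : ℝ × E d => mDot Ω s q.1 q.2) (Ioo 0 T ×ˢ Ω.closed) := by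
  refine (contDiffOn_deriv_time hs.smooth_m (by simp)).add (contDiffOn_vector.2 fun i => ?_)
  simp only [mulV_apply]
  exact ContDiffOn.sum fun j _ => (hs.joint_gradM i j).mul (hs.joint_v j)

variable {t : ℝ} (ht : t ∈ Ioo 0 T)
include ht

theorem slice_v : ContDiffOn ℝ ∞ (s.v t) Ω.closed := contDiffOn_slice hs.smooth_v ht

theorem slice_m : ContDiffOn ℝ ∞ (s.m t) Ω.closed := contDiffOn_slice hs.smooth_m ht

theorem slice_F : ContDiffOn ℝ ∞ (s.F t) Ω.closed := contDiffOn_slice hs.smooth_F ht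

theorem slice_exch : ContDiffOn ℝ 1 (exch M s t) Ω.closed := contDiffOn_slice hs.joint_exch ht

theorem slice_mDot : ContDiffOn ℝ ∞ (mDot Ω s t) Ω.closed := contDiffOn_slice hs.joint_mDot ht

theorem slice_gradV (i j : Fin d) : ContDiffOn ℝ ∞ (fun x => Ω.gradV (s.v t) x i j) Ω.closed :=
  contDiffOn_gradV (hs.slice_v ht) (by simp) i j

theorem slice_gradM (i j : Fin d) : ContDiffOn ℝ ∞ (fun x => Ω.gradV (s.m t) x i j) Ω.closed :=
  contDiffOn_gradV (hs.slice_m ht) (by simp) i j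

theorem slice_skw_mul :
    ContDiffOn ℝ ∞ (fun x => mulV (skw (Ω.gradV (s.v t) x)) (s.m t x)) Ω.closed := by
  refine contDiffOn_vector.2 fun i => ?_
  simp only [mulV_apply, skw_apply]
  exact ContDiffOn.sum fun j _ => (((hs.slice_gradV ht i j).sub (hs.slice_gradV ht j i)).div_const
    2).mul (contDiffOn_vector.1 (hs.slice_m ht) j)

theorem slice_mZJ : ContDiffOn ℝ ∞ (mZJ Ω s t) Ω.closed :=
  (hs.slice_mDot ht).sub (hs.slice_skw_mul ht)

variable {x : E d} (hx : x ∈ Ω.carrier)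
include hx

/-! ### Derivatives along the flow -/

theorem hasDerivAt_F :
    HasDerivAt (fun ε : ℝ => s.F (t + ε) (x + ε • s.v t x)) (Ω.gradV (s.v t) x * s.F t x) 0 := by
  refine hasDerivAt_matrix fun i j => ?_
  refine (hasDerivAt_conv (contDiffOn_infty.1 (hs.joint_F i j) 1) ht hx (s.v t x)).congr_deriv ?_
  rw [conv, hs.transport t ht x hx i j]
  ring

theorem hasDerivAt_m :
    HasDerivAt (fun ε : ℝ => s.m (t + ε) (x + ε • s.v t x)) (mDot Ω s t x) 0 := by
  refine hasDerivAt_vector.2 fun i => ?_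
  refine (hasDerivAt_conv (contDiffOn_infty.1 (hs.joint_m i) 1) ht hx (s.v t x)).congr_deriv ?_
  have h1 := (hasDerivAt_time (contDiffOn_infty.1 hs.smooth_m 1) ht
    (Ω.carrier_subset_closed hx)).differentiableAt.hasDerivAt
  rw [conv, (hasDerivAt_vector.1 h1 i).deriv, mDot, PiLp.add_apply, mulV_apply]
  congr 1
  exact Finset.sum_congr rfl fun k _ => mul_comm _ _

theorem pd_mDot (i j : Fin d) :
    Ω.pd (fun y => mDot Ω s t y i) j x =
      Ω.conv (s.v t x) (fun q => Ω.gradV (s.m q.1) q.2 i j) t x +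
        ∑ k, Ω.gradV (s.v t) x k j * Ω.gradV (s.m t) x i k := by
  have hx' := Ω.carrier_subset_closed hx
  have hD : ∀ {f : E d → ℝ}, ContDiffOn ℝ ∞ f Ω.closed → DifferentiableWithinAt ℝ f Ω.closed x :=
    fun hf => hf.differentiableOn (by simp) x hx'
  have hm : ContDiffOn ℝ ∞ (fun y => deriv (fun r => s.m r y i) t) Ω.closed :=
    contDiffOn_slice (contDiffOn_deriv_time (hs.joint_m i) (by simp)) ht
  have hv : ∀ k, ContDiffOn ℝ ∞ (fun y => s.v t y k) Ω.closed := contDiffOn_vector.1 (hs.slice_v ht)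
  have e : EqOn (fun y => mDot Ω s t y i)
      (fun y => deriv (fun r => s.m r y i) t + ∑ k, Ω.gradV (s.m t) y i k * s.v t y k)
      Ω.closed := by
    intro y hy
    have h1 :=
      (hasDerivAt_time (contDiffOn_infty.1 hs.smooth_m 1) ht hy).differentiableAt.hasDerivAt
    simp only [mDot, PiLp.add_apply, mulV_apply]
    rw [(hasDerivAt_vector.1 h1 i).deriv]
  rw [pd_congr e hx', pd_add hx' (hD hm) (DifferentiableWithinAt.fun_sum fun k _ =>
    (hD (hs.slice_gradM ht i k)).fun_mul (hD (hv k))),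
    pd_sum hx' _ fun k _ => (hD (hs.slice_gradM ht i k)).fun_mul (hD (hv k))]
  simp only [pd_mul hx' (hD (hs.slice_gradM ht i _)) (hD (hv _)), Finset.sum_add_distrib]
  rw [← deriv_pd (contDiffOn_infty.1 (hs.joint_m i) 2) ht hx j, conv, ← add_assoc, add_right_comm]
  congr 1
  · congr 1
    · refine Finset.sum_congr rfl fun k _ => ?_
      have := pd_comm (contDiffOn_infty.1 (contDiffOn_vector.1 (hs.slice_m ht) i) 2) hx j k
      simp only [gradV, Matrix.of_apply]
      rw [mul_comm]
      congr 1
  · exact Finset.sum_congr rfl fun k _ => by simp only [gradV, Matrix.of_apply]; ring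

end IsSmoothSolution

end Magneto

namespace Magneto

open SmoothDomain

section Algebra

variable {d : ℕ}

theorem ddot_add_left (A B C : Mat d) : ddot (A + B) C = ddot A C + ddot B C := by
  simp only [ddot, Matrix.add_apply, add_mul, Finset.sum_add_distrib]

theorem ddot_smul_left (c : ℝ) (A C : Mat d) : ddot (c • A) C = c * ddot A C := by
  simp only [ddot, Matrix.smul_apply, smul_eq_mul, mul_assoc, Finset.mul_sum]

theorem dddot_add_left (A B C : Ten d) : dddot (A + B) C = dddot A C + dddot B C := by
  simp only [dddot, Pi.add_apply, add_mul, Finset.sum_add_distrib]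

theorem ddot_gram (G A : Mat d) :
    ∑ i, ∑ j, G i j * ∑ k, A k j * G i k = ddot (Gᵀ * G) A := by
  have h1 : ∑ i, ∑ j, G i j * ∑ k, A k j * G i k = ∑ k, ∑ j, ∑ i, G i j * (A k j * G i k) := by
    simp only [Finset.mul_sum]
    rw [Finset.sum_congr rfl fun i _ => Finset.sum_comm (s := Finset.univ) (t := Finset.univ)
      (f := fun j k => G i j * (A k j * G i k)), Finset.sum_comm]
    exact Finset.sum_congr rfl fun k _ => Finset.sum_comm
  simp only [h1, ddot, Matrix.mul_apply, Matrix.transpose_apply, Finset.sum_mul]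
  exact Finset.sum_congr rfl fun k _ => Finset.sum_congr rfl fun j _ =>
    Finset.sum_congr rfl fun i _ => by ring

theorem sum_mul_skw (G : Mat d) (a : E d) (H : Ten d) :
    ∑ i, ∑ k, G i k * ∑ j, (H i j k - H j i k) / 2 * a j =
      ∑ i, ∑ j, ∑ k, (G i k * a j - a i * G j k) / 2 * H i j k := by
  have h0 : ∀ f : Fin d → Fin d → Fin d → ℝ, ∑ i, ∑ j, ∑ k, f i j k = ∑ i, ∑ j, ∑ k, f j i k :=
    fun f => Finset.sum_comm
  have h1 : ∑ i, ∑ k, G i k * ∑ j, (H i j k - H j i k) / 2 * a j =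
      ∑ i, ∑ j, ∑ k, G i k * a j * H i j k / 2 - ∑ i, ∑ j, ∑ k, G i k * a j * H j i k / 2 := by
    simp only [Finset.mul_sum, ← Finset.sum_sub_distrib]
    refine Finset.sum_congr rfl fun i _ => ?_
    rw [Finset.sum_comm]
    exact Finset.sum_congr rfl fun k _ => Finset.sum_congr rfl fun j _ => by ring
  rw [h1, h0 fun i j k => G i k * a j * H j i k / 2]
  simp only [← Finset.sum_sub_distrib]
  exact Finset.sum_congr rfl fun i _ => Finset.sum_congr rfl fun j _ =>
    Finset.sum_congr rfl fun k _ => by ring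

end Algebra

variable {d : ℕ} {Ω : SmoothDomain d} {M : Material d} {L : Loads d} {s : Fields d} {T : ℝ}

namespace IsSmoothSolution

variable (hs : IsSmoothSolution Ω M L s T) {t : ℝ} (ht : t ∈ Ioo 0 T)
include hs ht

theorem slice_stressK : ContDiffOn ℝ 1 (stressK Ω M s t) Ω.closed := by
  refine contDiffOn_matrix.2 fun i j => ?_
  have hG := fun i j => contDiffOn_infty.1 (hs.slice_gradM ht i j) 1
  simpa only [stressK, Matrix.neg_apply, Matrix.smul_apply, Matrix.mul_apply, smul_eq_mul,
    Matrix.transpose_apply] using ((hs.slice_exch ht).mul (ContDiffOn.sum (s := Finset.univ)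
      fun k _ => (hG k i).mul (hG k j))).neg

theorem slice_hyper (i j k : Fin d) : ContDiffOn ℝ 2 (fun x => hyper Ω M s t x i j k) Ω.closed :=
  contDiffOn_tensor.1 ((hs.hyperH_C2 t ht).add (hs.hyperS_C2 t ht)) i j k

theorem slice_stressTKSD : ContDiffOn ℝ 1 (fun x => stressT Ω M s t x + stressK Ω M s t x +
    stressS Ω M L s t x + stressD Ω M s t x) Ω.closed :=
  (((hs.stressT_C1 t ht).add (hs.slice_stressK ht)).add (hs.stressS_C1 t ht)).add
    (hs.stressD_C1 t ht)

theorem slice_stress (i j : Fin d) : ContDiffOn ℝ 1 (fun x => stress Ω M L s t x i j) Ω.closed :=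
  (contDiffOn_matrix.1 (hs.slice_stressTKSD ht) i j).sub
    (contDiffOn_divT (hs.slice_hyper ht) (by norm_num) i j)

theorem slice_hField : ContDiffOn ℝ 1 (hField Ω L s t) Ω.closed :=
  (contDiffOn_slice hs.smooth_hext ht).add
    (contDiffOn_slice (contDiffOn_infty.1 hs.contDiffOn_grad_u 1) ht)

variable {x : E d} (hx : x ∈ Ω.carrier)
include hx

theorem hasDerivAt_phi :
    HasDerivAt (fun ε : ℝ => M.φ (s.F (t + ε) (x + ε • s.v t x)) (s.m (t + ε) (x + ε • s.v t x)))
      (ddot (phiF M s t x * (s.F t x)ᵀ) (Ω.gradV (s.v t) x) +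
        inner ℝ (phiM M s t x) (mDot Ω s t x)) 0 := by
  have hdet := hs.det_pos t ht x (Ω.carrier_subset_closed hx)
  have hφ : DifferentiableAt ℝ (fun q : Mat d × E d => M.φ q.1 q.2) (s.F t x, s.m t x) :=
    (M.φ_C1.contDiffAt ((isOpen_det_pos.preimage continuous_fst).mem_nhds hdet)).differentiableAt
      one_ne_zero
  have h0 : HasFDerivAt (fun q : Mat d × E d => M.φ q.1 q.2)
      (fderiv ℝ (fun q : Mat d × E d => M.φ q.1 q.2) (s.F t x, s.m t x))
      (s.F (t + 0) (x + (0 : ℝ) • s.v t x), s.m (t + 0) (x + (0 : ℝ) • s.v t x)) := by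
    simpa using hφ.hasFDerivAt
  refine (h0.comp_hasDerivAt (0 : ℝ) ((hs.hasDerivAt_F ht hx).prodMk
    (hs.hasDerivAt_m ht hx))).congr_deriv ?_
  refine (fderiv_prod_apply hφ _ _).trans ?_
  rw [ddot_mul_right]
  rfl

theorem hasDerivAt_kappa :
    HasDerivAt (fun ε : ℝ => M.κ (s.F (t + ε) (x + ε • s.v t x)))
      (ddot (matDeriv M.κ (s.F t x) * (s.F t x)ᵀ) (Ω.gradV (s.v t) x)) 0 := by
  have hdet := hs.det_pos t ht x (Ω.carrier_subset_closed hx)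
  have hκ : DifferentiableAt ℝ M.κ (s.F t x) :=
    (M.κ_C1.contDiffAt (isOpen_det_pos.mem_nhds hdet)).differentiableAt one_ne_zero
  have h0 : HasFDerivAt M.κ (fderiv ℝ M.κ (s.F t x)) (s.F (t + 0) (x + (0 : ℝ) • s.v t x)) := by
    simpa using hκ.hasFDerivAt
  refine (h0.comp_hasDerivAt (0 : ℝ) (hs.hasDerivAt_F ht hx)).congr_deriv ?_
  exact (fderiv_matrix_apply _ _ _).trans (ddot_mul_right _ _ _)

theorem hasDerivAt_detF :
    HasDerivAt (fun ε : ℝ => (s.F (t + ε) (x + ε • s.v t x)).det)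
      (Ω.divV (s.v t) x * (s.F t x).det) 0 := by
  have h1 := hs.hasDerivAt_F ht hx
  have h2 : HasDerivAt (fun ε : ℝ => s.F (t + ε) (x + ε • s.v t x))
      (Ω.gradV (s.v t) x * s.F (t + 0) (x + (0 : ℝ) • s.v t x)) 0 := by simpa using h1
  refine (hasDerivAt_det h2).congr_deriv ?_
  simp [Matrix.trace, divV, gradV]

theorem hasDerivAt_gradMsq :
    HasDerivAt (fun ε : ℝ => gradMsq Ω s (t + ε) (x + ε • s.v t x))
      (2 * (ddot (Ω.gradV (s.m t) x) (Ω.gradV (mDot Ω s t) x) -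
        ddot ((Ω.gradV (s.m t) x)ᵀ * Ω.gradV (s.m t) x) (Ω.gradV (s.v t) x))) 0 := by
  have h1 : ∀ i j, HasDerivAt (fun ε : ℝ => Ω.gradV (s.m (t + ε)) (x + ε • s.v t x) i j)
      (Ω.pd (fun y => mDot Ω s t y i) j x -
        ∑ k, Ω.gradV (s.v t) x k j * Ω.gradV (s.m t) x i k) 0 := by
    intro i j
    rw [hs.pd_mDot ht hx, add_sub_cancel_right]
    exact hasDerivAt_conv (contDiffOn_infty.1 (hs.joint_gradM i j) 1) ht hx (s.v t x)
  simp only [gradMsq, frob_sq]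
  refine (HasDerivAt.fun_sum fun i _ => HasDerivAt.fun_sum fun j _ =>
    (h1 i j).fun_pow 2).congr_deriv ?_
  rw [← ddot_gram, ddot, ← Finset.sum_sub_distrib, Finset.mul_sum]
  refine Finset.sum_congr rfl fun i _ => ?_
  rw [← Finset.sum_sub_distrib, Finset.mul_sum]
  refine Finset.sum_congr rfl fun j _ => ?_
  simp [gradV]
  ring

/-- The stored energy balance along the flow. -/
theorem conv_storedDensity :
    Ω.conv (s.v t x) (fun q => storedDensity Ω M s q.1 q.2) t x +
        storedDensity Ω M s t x * Ω.divV (s.v t) x =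
      ddot (stressT Ω M s t x) (Ω.gradV (s.v t) x) -
        ddot (((s.F t x).det)⁻¹ • (zetaF M s t x * (s.F t x)ᵀ)) (Ω.gradV (s.v t) x) +
        ddot (stressK Ω M s t x) (Ω.gradV (s.v t) x) +
        inner ℝ (((s.F t x).det)⁻¹ • phiM M s t x) (mDot Ω s t x) +
        exch M s t x * ddot (Ω.gradV (s.m t) x) (Ω.gradV (mDot Ω s t) x) := by
  have hdet := hs.det_pos t ht x (Ω.carrier_subset_closed hx)
  have hJ := hs.hasDerivAt_detF ht hx
  have hJ0 : (s.F (t + 0) (x + (0 : ℝ) • s.v t x)).det ≠ 0 := by simpa using hdet.ne'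
  have h1 := ((hs.hasDerivAt_phi ht hx).fun_div hJ hJ0).fun_add
    (((hs.hasDerivAt_kappa ht hx).fun_mul (hs.hasDerivAt_gradMsq ht hx)).fun_div
      (hJ.const_mul 2) (mul_ne_zero two_ne_zero hJ0))
  rw [conv_eq_of_hasDerivAt hs.joint_storedDensity ht hx h1]
  simp only [add_zero, zero_smul, storedDensity, stressT, stressK, Matrix.add_mul, Matrix.smul_mul,
    ddot_smul_left, ddot_add_left, inner_smul_left, exch, ← neg_smul]
  simp only [conj_trivial]
  field_simp
  ring

/-- The exchange power splits into a corotational part and the power of the magnetic hyperstress. -/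
theorem exch_power :
    exch M s t x * ddot (Ω.gradV (s.m t) x) (Ω.gradV (mDot Ω s t) x) =
      ddot (exch M s t x • Ω.gradV (s.m t) x) (Ω.gradV (mZJ Ω s t) x) +
        dddot (hyperS Ω M s t x) (Ω.grad2 (s.v t) x) := by
  have hx' := Ω.carrier_subset_closed hx
  have hD : ∀ {f : E d → ℝ}, ContDiffOn ℝ ∞ f Ω.closed → DifferentiableWithinAt ℝ f Ω.closed x :=
    fun hf => hf.differentiableOn (by simp) x hx'
  have hm : ∀ i, DifferentiableWithinAt ℝ (fun y => s.m t y i) Ω.closed x := fun i =>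
    hD (contDiffOn_vector.1 (hs.slice_m ht) i)
  have hg : ∀ i j, DifferentiableWithinAt ℝ (fun y => Ω.gradV (s.v t) y i j) Ω.closed x :=
    fun i j => hD (hs.slice_gradV ht i j)
  have hW : ∀ i j, DifferentiableWithinAt ℝ (fun y => (1 / 2 : ℝ) *
      (Ω.gradV (s.v t) y i j - Ω.gradV (s.v t) y j i)) Ω.closed x := fun i j =>
    ((hg i j).fun_sub (hg j i)).const_mul _
  have hpd : ∀ i k, Ω.gradV (mDot Ω s t) x i k = Ω.gradV (mZJ Ω s t) x i k +
      (∑ j, skw (Ω.gradV (s.v t) x) i j * Ω.gradV (s.m t) x j k +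
        ∑ j, (Ω.grad2 (s.v t) x i j k - Ω.grad2 (s.v t) x j i k) / 2 * s.m t x j) := by
    intro i k
    have e1 : (fun y => mDot Ω s t y i) = fun y => mZJ Ω s t y i + ∑ j, (1 / 2 : ℝ) *
        (Ω.gradV (s.v t) y i j - Ω.gradV (s.v t) y j i) * s.m t y j := by
      ext y
      simp only [mZJ, PiLp.sub_apply, mulV_apply, skw_apply]
      rw [eq_comm, sub_add, sub_eq_self, sub_eq_zero]
      exact Finset.sum_congr rfl fun j _ => by ring
    change Ω.pd (fun y => mDot Ω s t y i) k x = _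
    rw [e1, pd_add hx' (hD (contDiffOn_vector.1 (hs.slice_mZJ ht) i))
      (DifferentiableWithinAt.fun_sum fun j _ => (hW i j).fun_mul (hm j)),
      pd_sum hx' _ fun j _ => (hW i j).fun_mul (hm j), ← Finset.sum_add_distrib]
    congr 1
    refine Finset.sum_congr rfl fun j _ => ?_
    rw [pd_mul hx' (hW i j) (hm j), pd_const_mul hx' ((hg i j).fun_sub (hg j i)),
      pd_sub hx' (hg i j) (hg j i), skw_apply]
    simp only [gradV, Matrix.of_apply, grad2]
    ring
  have h2 := sum_mul_skw_mul (Ω.gradV (s.m t) x) (Ω.gradV (s.v t) x)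
  have h3 := sum_mul_skw (Ω.gradV (s.m t) x) (s.m t x) (Ω.grad2 (s.v t) x)
  have h4 : dddot (hyperS Ω M s t x) (Ω.grad2 (s.v t) x) = exch M s t x *
      ∑ i, ∑ k, Ω.gradV (s.m t) x i k *
        ∑ j, (Ω.grad2 (s.v t) x i j k - Ω.grad2 (s.v t) x j i k) / 2 * s.m t x j := by
    rw [h3]
    simp only [dddot, hyperS, Finset.mul_sum, mul_assoc]
  rw [ddot_smul_left, h4, ← mul_add]
  congr 1
  simp only [ddot, hpd, mul_add, Finset.sum_add_distrib]
  rw [h2, zero_add]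

/-- The kinetic energy balance along the flow. -/
theorem conv_kinetic :
    Ω.conv (s.v t x) (fun q => s.ρ q.1 q.2 / 2 * ‖s.v q.1 q.2‖ ^ 2) t x +
        s.ρ t x / 2 * ‖s.v t x‖ ^ 2 * Ω.divV (s.v t) x =
      inner ℝ (Ω.divM (stress Ω M L s t) x + magForce Ω M L s t x + s.ρ t x • L.g t x)
        (s.v t x) := by
  have hx' := Ω.carrier_subset_closed hx
  have hD : ∀ {f : E d → ℝ}, ContDiffOn ℝ ∞ f Ω.closed → DifferentiableWithinAt ℝ f Ω.closed x :=
    fun hf => hf.differentiableOn (by simp) x hx'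
  have hρ1 := contDiffOn_infty.1 hs.smooth_ρ 1
  have hv1 := fun i => contDiffOn_infty.1 (hs.joint_v i) 1
  have hρs : DifferentiableWithinAt ℝ (s.ρ t) Ω.closed x := hD (contDiffOn_slice hs.smooth_ρ ht)
  have hvs : ∀ i, DifferentiableWithinAt ℝ (fun y => s.v t y i) Ω.closed x := fun i =>
    hD (contDiffOn_vector.1 (hs.slice_v ht) i)
  set δ := Ω.divV (s.v t) x with hδ
  have hρ := hasDerivAt_conv hρ1 ht hx (s.v t x)
  have hv := fun i => hasDerivAt_conv (hv1 i) ht hx (s.v t x)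
  set ρ' := Ω.conv (s.v t x) (fun q => s.ρ q.1 q.2) t x with hρ'
  set v' : Fin d → ℝ := fun i => Ω.conv (s.v t x) (fun q => s.v q.1 q.2 i) t x with hv'
  have eρ : ρ' = -(s.ρ t x * δ) := by
    rw [hρ', conv, hs.mass t ht x hx, divV_smul hx' hρs hvs]
    ring
  have hp1 : ∀ i, ContDiffOn ℝ 1 (fun q : ℝ × E d => s.ρ q.1 q.2 * s.v q.1 q.2 i)
    (Ioo 0 T ×ˢ Ω.closed) := fun i => hρ1.mul (hv1 i)
  have hmom : ∀ i, s.ρ t x * v' i =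
      (Ω.divM (stress Ω M L s t) x + magForce Ω M L s t x + s.ρ t x • L.g t x) i := by
    intro i
    have e1 : Ω.conv (s.v t x) (fun q => s.ρ q.1 q.2 * s.v q.1 q.2 i) t x =
        ρ' * s.v t x i + s.ρ t x * v' i :=
      conv_eq_of_hasDerivAt (hp1 i) ht hx (by simpa using hρ.fun_mul (hv i))
    have e2 : deriv (fun r => s.ρ r x * s.v r x i) t =
        (deriv (fun r => s.ρ r x • s.v r x) t) i := by
      have h1 := (hasDerivAt_time (hρ1.smul (contDiffOn_infty.1 hs.smooth_v 1)) ht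
        hx').differentiableAt.hasDerivAt
      exact (hasDerivAt_vector.1 h1 i).deriv
    have e3 : ∀ j, Ω.pd
        (fun y => (stress Ω M L s t y - s.ρ t y • outer (s.v t y) (s.v t y)) i j) j x =
        Ω.pd (fun y => stress Ω M L s t y i j) j x -
          (s.ρ t x * s.v t x i * Ω.pd (fun y => s.v t y j) j x +
            s.v t x j * Ω.pd (fun y => s.ρ t y * s.v t y i) j x) := by
      intro j
      have hp := hρs.fun_mul (hvs i)
      have e : (fun y => (stress Ω M L s t y - s.ρ t y • outer (s.v t y) (s.v t y)) i j) =
          fun y => stress Ω M L s t y i j - s.ρ t y * s.v t y i * s.v t y j := by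
        ext y; simp [outer, mul_assoc]
      rw [e, pd_sub hx' ((hs.slice_stress ht i j).differentiableOn one_ne_zero x hx')
        (hp.fun_mul (hvs j)), pd_mul hx' hp (hvs j)]
      ring
    have e4 := congrArg (fun a : E d => a i) (hs.momentum t ht x hx)
    simp only [PiLp.add_apply, divM, e3, Finset.sum_sub_distrib, Finset.sum_add_distrib,
      ← Finset.mul_sum] at e4
    rw [conv, e2, e4] at e1
    have e5 : ∑ j, Ω.pd (fun y => s.v t y j) j x = δ := rfl
    simp only [PiLp.add_apply, divM]
    rw [e5] at e1
    rw [eρ] at e1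
    linarith
  have hn : ∀ q : ℝ × E d, ‖s.v q.1 q.2‖ ^ 2 = ∑ i, s.v q.1 q.2 i ^ 2 := fun q => by
    rw [EuclideanSpace.norm_sq_eq]; simp
  have hK1 : ContDiffOn ℝ 1 (fun q : ℝ × E d => s.ρ q.1 q.2 / 2 * ‖s.v q.1 q.2‖ ^ 2)
      (Ioo 0 T ×ˢ Ω.closed) :=
    (hρ1.div_const 2).mul ((contDiffOn_infty.1 hs.smooth_v 1).norm_sq ℝ)
  have hK : HasDerivAt (fun ε : ℝ => s.ρ (t + ε) (x + ε • s.v t x) / 2 *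
      ‖s.v (t + ε) (x + ε • s.v t x)‖ ^ 2)
      (ρ' / 2 * ‖s.v t x‖ ^ 2 + s.ρ t x * ∑ i, s.v t x i * v' i) 0 := by
    have h1 := (hρ.div_const 2).fun_mul (HasDerivAt.fun_sum fun i (_ : i ∈ Finset.univ) =>
      (hv i).fun_pow 2)
    have hn' := fun ε : ℝ => hn (t + ε, x + ε • s.v t x)
    simp only at hn' h1
    simp only [hn']
    refine h1.congr_deriv ?_
    simp only [add_zero, zero_smul]
    have e6 : ∑ i, ((2 : ℕ) : ℝ) * s.v t x i ^ (2 - 1) * v' i = 2 * ∑ i, s.v t x i * v' i := by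
      rw [Finset.mul_sum]
      exact Finset.sum_congr rfl fun i _ => by simp; ring
    rw [hn (t, x)]
    simp only [hv'] at e6 ⊢
    rw [e6]
    ring
  rw [conv_eq_of_hasDerivAt hK1 ht hx hK, eρ, inner_eq_sum]
  simp only [← hmom, Finset.mul_sum]
  have : ∑ i, s.ρ t x * (s.v t x i * v' i) = ∑ i, s.ρ t x * v' i * s.v t x i :=
    Finset.sum_congr rfl fun i _ => by ring
  rw [this]
  ring

/-- The power of the magnetic force. -/
theorem inner_magForce :
    inner ℝ (magForce Ω M L s t x) (s.v t x) =
      -(M.μ₀ * inner ℝ (hField Ω L s t x) (mulV (Ω.gradV (s.m t) x) (s.v t x))) := by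
  have hx' := Ω.carrier_subset_closed hx
  have hh : ∀ i, DifferentiableWithinAt ℝ (fun y => hField Ω L s t y i) Ω.closed x := fun i =>
    (contDiffOn_vector.1 (hs.slice_hField ht) i).differentiableOn one_ne_zero x hx'
  have hm : ∀ i, DifferentiableWithinAt ℝ (fun y => s.m t y i) Ω.closed x := fun i =>
    (contDiffOn_vector.1 (hs.slice_m ht) i).differentiableOn (by simp) x hx'
  have e : ∀ i, Ω.pd (fun y => inner ℝ (hField Ω L s t y) (s.m t y)) i x =
      ∑ j, (hField Ω L s t x j * Ω.gradV (s.m t) x j i +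
        Ω.gradV (hField Ω L s t) x j i * s.m t x j) := by
    intro i
    simp only [inner_eq_sum]
    rw [pd_sum hx' _ fun j _ => (hh j).fun_mul (hm j)]
    exact Finset.sum_congr rfl fun j _ => pd_mul hx' (hh j) (hm j) i
  have e2 : ∀ i, magForce Ω M L s t x i =
      -(M.μ₀ * ∑ j, hField Ω L s t x j * Ω.gradV (s.m t) x j i) := by
    intro i
    simp only [magForce, PiLp.sub_apply, PiLp.smul_apply, smul_eq_mul, mulV_apply, grad,
      Matrix.transpose_apply, e, Finset.sum_add_distrib]
    ring
  simp only [inner_eq_sum, e2, mulV_apply, neg_mul, Finset.sum_neg_distrib, neg_inj]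
  simp only [Finset.mul_sum, Finset.sum_mul]
  rw [Finset.sum_comm]
  exact Finset.sum_congr rfl fun i _ => Finset.sum_congr rfl fun j _ => by ring

/-- The power identity for the mechanical energy in the magnetic field. -/
theorem power_identity :
    Ω.conv (s.v t x) (fun q => s.ρ q.1 q.2 / 2 * ‖s.v q.1 q.2‖ ^ 2) t x +
        s.ρ t x / 2 * ‖s.v t x‖ ^ 2 * Ω.divV (s.v t) x +
        (Ω.conv (s.v t x) (fun q => storedDensity Ω M s q.1 q.2) t x +
        storedDensity Ω M s t x * Ω.divV (s.v t) x) -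
        M.μ₀ * inner ℝ (hField Ω L s t x) (deriv (fun r => s.m r x) t) =
      inner ℝ (Ω.divM (stress Ω M L s t) x) (s.v t x) +
        ddot (stressT Ω M s t x + stressK Ω M s t x + stressS Ω M L s t x) (Ω.gradV (s.v t) x) +
        dddot (hyperS Ω M s t x) (Ω.grad2 (s.v t) x) +
        ddot (exch M s t x • Ω.gradV (s.m t) x) (Ω.gradV (mZJ Ω s t) x) -
        inner ℝ (drive Ω M L s t x) (mZJ Ω s t x) +
        s.ρ t x * inner ℝ (L.g t x) (s.v t x) -
        ddot (((s.F t x).det)⁻¹ • (zetaF M s t x * (s.F t x)ᵀ)) (Ω.gradV (s.v t) x) -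
        inner ℝ (((s.F t x).det)⁻¹ • zetaM M s t x) (mDot Ω s t x) := by
  rw [hs.conv_kinetic ht hx, hs.conv_storedDensity ht hx, hs.exch_power ht hx, inner_add_left,
    inner_add_left, hs.inner_magForce ht hx, inner_smul_left, ddot_add_left, ddot_add_left]
  have e1 : inner ℝ (hField Ω L s t x) (mDot Ω s t x) =
      inner ℝ (hField Ω L s t x) (deriv (fun r => s.m r x) t) +
        inner ℝ (hField Ω L s t x) (mulV (Ω.gradV (s.m t) x) (s.v t x)) := by
    rw [mDot, inner_add_right]
  have e2 : ddot (stressS Ω M L s t x) (Ω.gradV (s.v t) x) =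
      -inner ℝ (drive Ω M L s t x) (mDot Ω s t x) + inner ℝ (drive Ω M L s t x) (mZJ Ω s t x) := by
    rw [stressS, ddot_skw_outer, mZJ, inner_sub_right]
    ring
  have e3 : inner ℝ (drive Ω M L s t x) (mDot Ω s t x) =
      M.μ₀ * inner ℝ (hField Ω L s t x) (mDot Ω s t x) -
        inner ℝ (((s.F t x).det)⁻¹ • phiM M s t x) (mDot Ω s t x) -
        inner ℝ (((s.F t x).det)⁻¹ • zetaM M s t x) (mDot Ω s t x) := by
    rw [drive, smul_add, inner_sub_left, inner_add_left, inner_smul_left]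
    simp only [conj_trivial]
    ring
  rw [e2, e3, e1]
  simp only [conj_trivial]
  ring

end IsSmoothSolution

end Magneto

namespace Magneto

open SmoothDomain

section Algebra

variable {d : ℕ}

theorem rpow_sub_two_mul_sq {c p : ℝ} (hc : 0 ≤ c) (hp : 1 ≤ p) : c ^ (p - 2) * c ^ 2 = c ^ p := by
  rcases hc.eq_or_lt with rfl | h
  · simp [Real.zero_rpow (zero_lt_one.trans_le hp).ne']
  · rw [← Real.rpow_natCast, ← Real.rpow_add h]; norm_num

theorem ddot_sym_self (A : Mat d) : ddot (sym A) A = frob (sym A) ^ 2 := by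
  have h : ddot (sym A) A = ∑ i, ∑ j, sym A i j * A j i := by
    rw [ddot, Finset.sum_comm]
    exact Finset.sum_congr rfl fun i _ => Finset.sum_congr rfl fun j _ => by
      simp only [sym, Matrix.smul_apply, Matrix.add_apply, Matrix.transpose_apply]
      rw [add_comm (A j i)]
  have h2 : 2 * frob (sym A) ^ 2 = ddot (sym A) A + ∑ i, ∑ j, sym A i j * A j i := by
    rw [frob_sq, ddot, Finset.mul_sum, ← Finset.sum_add_distrib]
    refine Finset.sum_congr rfl fun i _ => ?_
    rw [Finset.mul_sum, ← Finset.sum_add_distrib]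
    exact Finset.sum_congr rfl fun j _ => by simp [sym]; ring
  rw [← h] at h2
  linarith

theorem frob3_sq (G : Ten d) : frob3 G ^ 2 = dddot G G := by
  rw [frob3, Real.sq_sqrt (Finset.sum_nonneg fun _ _ => Finset.sum_nonneg fun _ _ =>
    Finset.sum_nonneg fun _ _ => sq_nonneg _), dddot]
  simp only [sq]

theorem inner_cross_self (hd : d = 2 ∨ d = 3) (a b : E d) : inner ℝ (cross a b) b = 0 := by
  rcases hd with rfl | rfl
  · simp [inner_eq_sum, cross, pad, Fin.sum_univ_succ, crossProduct]
  · simp [inner_eq_sum, cross, pad, Fin.sum_univ_succ, crossProduct]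
    ring

theorem inner_of_mem_Dir {r e : E d} (he : e ∈ Dir r) : inner ℝ e r = ‖r‖ := by
  rcases he with ⟨h, -⟩ | ⟨h, rfl⟩
  · simp [h]
  · rw [inner_smul_left, real_inner_self_eq_norm_sq]
    have := norm_ne_zero_iff.2 h
    simp only [map_inv₀, conj_trivial]
    field_simp

theorem ddot_sym_of_symm {Z : Mat d} (hZ : ∀ i j, Z i j = Z j i) (A : Mat d) :
    ddot Z (sym A) = ddot Z A := by
  have h : ddot Z A = ∑ i, ∑ j, Z i j * A j i := by
    rw [ddot, Finset.sum_comm]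
    exact Finset.sum_congr rfl fun i _ => Finset.sum_congr rfl fun j _ => by rw [hZ]
  have h2 : 2 * ddot Z (sym A) = ddot Z A + ∑ i, ∑ j, Z i j * A j i := by
    rw [ddot, ddot, Finset.mul_sum, ← Finset.sum_add_distrib]
    refine Finset.sum_congr rfl fun i _ => ?_
    rw [Finset.mul_sum, ← Finset.sum_add_distrib]
    exact Finset.sum_congr rfl fun j _ => by simp [sym]; ring
  rw [← h] at h2
  linarith

/-- The rotation by the angle `ε` in the plane of two coordinates. -/
noncomputable def planeRot (i j : Fin d) (ε : ℝ) : Mat d :=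
  1 + (Real.cos ε - 1) • (Matrix.single i i 1 + Matrix.single j j 1) +
    Real.sin ε • (Matrix.single i j 1 - Matrix.single j i 1)

theorem planeRot_zero (i j : Fin d) : planeRot i j 0 = 1 := by simp [planeRot]

theorem planeRot_orthogonal {i j : Fin d} (hij : i ≠ j) (ε : ℝ) :
    planeRot i j ε * (planeRot i j ε)ᵀ = 1 := by
  set P : Mat d := Matrix.single i i 1 + Matrix.single j j 1 with hP
  set W : Mat d := Matrix.single i j 1 - Matrix.single j i 1 with hW
  have hPt : Pᵀ = P := by simp [hP]
  have hWt : Wᵀ = -W := by simp [hW]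
  have hPP : P * P = P := by
    simp [hP, Matrix.add_mul, Matrix.mul_add, hij, hij.symm]
  have hPW : P * W = W := by
    simp [hP, hW, Matrix.add_mul, Matrix.mul_sub, hij, hij.symm]
  have hWP : W * P = W := by
    simp [hP, hW, Matrix.sub_mul, Matrix.mul_add, hij, hij.symm]; abel
  have hWW : W * W = -P := by
    simp [hP, hW, Matrix.sub_mul, Matrix.mul_sub, hij, hij.symm]; abel
  have e : planeRot i j ε = 1 + (Real.cos ε - 1) • P + Real.sin ε • W := rfl
  rw [e]
  simp only [Matrix.transpose_add, Matrix.transpose_one, Matrix.transpose_smul, hPt, hWt,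
    Matrix.add_mul, Matrix.mul_add, Matrix.smul_mul, Matrix.mul_smul, Matrix.mul_neg, hPP, hPW, hWP,
    hWW, Matrix.one_mul, Matrix.mul_one, smul_neg, smul_add, neg_add, smul_smul, neg_neg]
  have hcs := Real.sin_sq_add_cos_sq ε
  have : (Real.cos ε - 1) + (Real.cos ε - 1) + (Real.cos ε - 1) * (Real.cos ε - 1) +
      Real.sin ε * Real.sin ε = 0 := by linarith
  have h2 := congrArg (fun c : ℝ => c • P) this
  simp only [add_smul, zero_smul] at h2
  have h3 : (Real.sin ε * (Real.cos ε - 1)) • W = ((Real.cos ε - 1) * Real.sin ε) • W := by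
    rw [mul_comm]
  rw [h3]
  have h4 : ∀ X : Mat d, X = 1 + ((Real.cos ε - 1) • P + (Real.cos ε - 1) • P +
      ((Real.cos ε - 1) * (Real.cos ε - 1)) • P + (Real.sin ε * Real.sin ε) • P) → X = 1 := by
    intro X h; rw [h, h2, add_zero]
  refine h4 _ ?_
  abel

theorem hasDerivAt_planeRot (i j : Fin d) :
    HasDerivAt (planeRot i j) (Matrix.single i j 1 - Matrix.single j i 1) 0 := by
  have h1 := ((Real.hasDerivAt_cos 0).sub_const 1).smul_const
    (Matrix.single i i 1 + Matrix.single j j 1 : Mat d)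
  have h2 := (Real.hasDerivAt_sin 0).smul_const (Matrix.single i j 1 - Matrix.single j i 1 : Mat d)
  refine ((h1.const_add (1 : Mat d)).add h2).congr_deriv ?_
  simp

theorem eventually_planeRot_mem {i j : Fin d} (hij : i ≠ j) :
    ∀ᶠ ε in 𝓝 (0 : ℝ), planeRot i j ε ∈ Matrix.specialOrthogonalGroup (Fin d) ℝ := by
  have hc : ContinuousAt (fun ε => (planeRot i j ε).det) 0 :=
    (continuous_det (d := d)).continuousAt.comp (hasDerivAt_planeRot i j).continuousAt
  have h0 : 0 < (planeRot i j 0).det := by rw [planeRot_zero]; simp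
  filter_upwards [hc.eventually_const_lt h0] with ε hε
  have ho := planeRot_orthogonal hij ε
  rw [Matrix.mem_specialOrthogonalGroup_iff, Matrix.mem_orthogonalGroup_iff]
  refine ⟨ho, ?_⟩
  have h1 := congrArg Matrix.det ho
  rw [Matrix.det_mul, Matrix.det_transpose, Matrix.det_one] at h1
  nlinarith

/-- The Cauchy stress of a frame-indifferent free energy is symmetric. -/
theorem symm_of_frameIndifferent {f : Mat d → ℝ} {F : Mat d} (hf : DifferentiableAt ℝ f F)
    (hinv : ∀ Q ∈ Matrix.specialOrthogonalGroup (Fin d) ℝ, f (Q * F) = f F) (i j : Fin d) :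
    (matDeriv f F * Fᵀ) i j = (matDeriv f F * Fᵀ) j i := by
  rcases eq_or_ne i j with rfl | hij
  · rfl
  set W : Mat d := Matrix.single i j 1 - Matrix.single j i 1 with hW
  have h1 : HasDerivAt (fun ε => planeRot i j ε * F) (W * F) 0 := by
    refine hasDerivAt_matrix fun a b => ?_
    simp only [Matrix.mul_apply]
    refine HasDerivAt.fun_sum fun c _ => HasDerivAt.mul_const ?_ _
    exact hasDerivAt_pi.1 (hasDerivAt_pi.1 (hasDerivAt_planeRot i j) a) c
  have hf' : HasFDerivAt f (fderiv ℝ f F) (planeRot i j 0 * F) := by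
    rw [planeRot_zero, Matrix.one_mul]; exact hf.hasFDerivAt
  have h2 := hf'.comp_hasDerivAt (0 : ℝ) h1
  have h3 : (f ∘ fun ε => planeRot i j ε * F) =ᶠ[𝓝 0] fun _ => f F := by
    filter_upwards [eventually_planeRot_mem hij] with ε hε using hinv _ hε
  have h4 := h2.unique ((hasDerivAt_const (0 : ℝ) (f F)).congr_of_eventuallyEq h3)
  have h5 : ddot (matDeriv f F * Fᵀ) W = 0 := by
    rw [← ddot_mul_right, ← fderiv_matrix_apply]; exact h4
  have h6 : ddot (matDeriv f F * Fᵀ) W = (matDeriv f F * Fᵀ) i j - (matDeriv f F * Fᵀ) j i := by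
    simp only [ddot, hW, Matrix.sub_apply, mul_sub, Finset.sum_sub_distrib, Matrix.single_apply]
    simp [ite_and]
  linarith

end Algebra

variable {d : ℕ} {Ω : SmoothDomain d} {M : Material d} {L : Loads d} {s : Fields d} {T : ℝ}

theorem continuousOn_vector {w : E d → E d} {S : Set (E d)}
    (h : ∀ i, ContinuousOn (fun x => w x i) S) : ContinuousOn w S :=
  (contDiffOn_zero (𝕜 := ℝ)).1 (contDiffOn_vector.2 fun i => contDiffOn_zero.2 (h i))

namespace IsSmoothSolution

variable (hs : IsSmoothSolution Ω M L s T) {t : ℝ} (ht : t ∈ Ioo 0 T)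
include hs ht

/-! ### Continuity of the constitutive fields -/

theorem continuousOn_det : ContinuousOn (fun x => (s.F t x).det) Ω.closed :=
  continuous_det.comp_continuousOn (hs.slice_F ht).continuousOn

theorem continuousOn_inv_det : ContinuousOn (fun x => ((s.F t x).det)⁻¹) Ω.closed :=
  (hs.continuousOn_det ht).inv₀ fun x hx => (hs.det_pos t ht x hx).ne'

theorem continuousOn_phiM : ContinuousOn (phiM M s t) Ω.closed := by
  have h1 := M.φ_C1.continuousOn_fderiv_of_isOpen (isOpen_det_pos.preimage continuous_fst) le_rfl
  have h2 : ContinuousOn (fun x => (s.F t x, s.m t x)) Ω.closed :=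
    (hs.slice_F ht).continuousOn.prodMk (hs.slice_m ht).continuousOn
  have h3 := h1.comp h2 fun x hx => hs.det_pos t ht x hx
  refine continuousOn_vector fun i => ?_
  refine (h3.clm_apply (continuousOn_const
    (c := ((0 : Mat d), (EuclideanSpace.single i 1 : E d))))).congr fun x hx => ?_
  have hφ : DifferentiableAt ℝ (fun q : Mat d × E d => M.φ q.1 q.2) (s.F t x, s.m t x) :=
    (M.φ_C1.contDiffAt ((isOpen_det_pos.preimage continuous_fst).mem_nhds
      (hs.det_pos t ht x hx))).differentiableAt one_ne_zero
  exact gradient_right hφ i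

theorem continuousOn_zeta : ContinuousOn (fun x => fderiv ℝ
    (fun q : Mat d × E d => M.ζ q.1 q.2 (s.θ t x)) (s.F t x, s.m t x)) Ω.closed := by
  have h2 : ContinuousOn (fun x => (s.F t x, s.m t x, s.θ t x)) Ω.closed :=
    (hs.slice_F ht).continuousOn.prodMk ((hs.slice_m ht).continuousOn.prodMk (hs.cont_θ t ht))
  exact M.ζ_C1.comp h2 fun x hx => ⟨hs.det_pos t ht x hx, hs.θ_nonneg t ht x hx⟩

theorem differentiableAt_zeta {x : E d} (hx : x ∈ Ω.closed) :
    DifferentiableAt ℝ (fun q : Mat d × E d => M.ζ q.1 q.2 (s.θ t x)) (s.F t x, s.m t x) :=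
  M.ζ_diff _ (hs.θ_nonneg t ht x hx) _ _ (hs.det_pos t ht x hx)

theorem continuousOn_zetaM : ContinuousOn (zetaM M s t) Ω.closed := by
  refine continuousOn_vector fun i => ?_
  exact ((hs.continuousOn_zeta ht).clm_apply (continuousOn_const
    (c := ((0 : Mat d), (EuclideanSpace.single i 1 : E d))))).congr fun x hx =>
      gradient_right (hs.differentiableAt_zeta ht hx) i

theorem continuousOn_zetaF (i j : Fin d) : ContinuousOn (fun x => zetaF M s t x i j) Ω.closed := by
  refine ((hs.continuousOn_zeta ht).clm_apply (continuousOn_const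
    (c := (Matrix.single i j (1 : ℝ), (0 : E d))))).congr fun x hx => ?_
  exact matDeriv_left (f := fun q : Mat d × E d => M.ζ q.1 q.2 (s.θ t x))
    (hs.differentiableAt_zeta ht hx) i j

theorem continuousOn_drive : ContinuousOn (drive Ω M L s t) Ω.closed := by
  have h1 : ContinuousOn (fun x => M.μ₀ • hField Ω L s t x) Ω.closed :=
    (hs.slice_hField ht).continuousOn.const_smul M.μ₀
  have h2 : ContinuousOn (fun x => ((s.F t x).det)⁻¹ • (phiM M s t x + zetaM M s t x)) Ω.closed :=
    (hs.continuousOn_inv_det ht).smul ((hs.continuousOn_phiM ht).add (hs.continuousOn_zetaM ht))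
  exact h1.sub h2

theorem continuousOn_thermal_stress (i j : Fin d) : ContinuousOn
    (fun x => (((s.F t x).det)⁻¹ • (zetaF M s t x * (s.F t x)ᵀ)) i j) Ω.closed := by
  simp only [Matrix.smul_apply, Matrix.mul_apply, Matrix.transpose_apply, smul_eq_mul]
  exact (hs.continuousOn_inv_det ht).mul (continuousOn_finsetSum _ fun k _ =>
    (hs.continuousOn_zetaF ht i k).mul
      (contDiffOn_matrix.1 (hs.slice_F ht) j k).continuousOn)

theorem continuousOn_frob_strainRate :
    ContinuousOn (fun x => frob (strainRate Ω s t x)) Ω.closed := by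
  refine ContinuousOn.sqrt (continuousOn_finsetSum _ fun i _ => continuousOn_finsetSum _ fun j _ =>
    ContinuousOn.pow ?_ 2)
  simp only [strainRate, sym, Matrix.smul_apply, Matrix.add_apply, Matrix.transpose_apply]
  exact ((hs.slice_gradV ht i j).continuousOn.add
    (hs.slice_gradV ht j i).continuousOn).const_smul (1 / 2 : ℝ)

theorem continuousOn_grad2 (i j k : Fin d) :
    ContinuousOn (fun x => Ω.grad2 (s.v t) x i j k) Ω.closed :=
  continuousOn_pd (hs.slice_gradV ht i j) (by norm_num) k

theorem continuousOn_frob3_grad2 : ContinuousOn (fun x => frob3 (Ω.grad2 (s.v t) x)) Ω.closed :=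
  ContinuousOn.sqrt (continuousOn_finsetSum _ fun i _ => continuousOn_finsetSum _ fun j _ =>
    continuousOn_finsetSum _ fun k _ => (hs.continuousOn_grad2 ht i j k).pow 2)

/-! ### Dissipation and boundary conditions -/

omit hs ht in
theorem ddot_stressD (x : E d) :
    ddot (stressD Ω M s t x) (Ω.gradV (s.v t) x) = M.ν₁ * frob (strainRate Ω s t x) ^ M.p := by
  rw [stressD, ddot_smul_left, strainRate, ddot_sym_self, mul_assoc,
    rpow_sub_two_mul_sq (c := frob _) (Real.sqrt_nonneg _) M.one_le_p]

omit hs ht in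
theorem dddot_hyperH (x : E d) :
    dddot (hyperH Ω M s t x) (Ω.grad2 (s.v t) x) = M.ν₂ * frob3 (Ω.grad2 (s.v t) x) ^ M.p := by
  have : dddot (hyperH Ω M s t x) (Ω.grad2 (s.v t) x) =
      M.ν₂ * frob3 (Ω.grad2 (s.v t) x) ^ (M.p - 2) *
        dddot (Ω.grad2 (s.v t) x) (Ω.grad2 (s.v t) x) := by
    simp only [dddot, hyperH, Pi.smul_apply, smul_eq_mul, Finset.mul_sum, mul_assoc]
  rw [this, ← frob3_sq, mul_assoc,
    rpow_sub_two_mul_sq (c := frob3 _) (Real.sqrt_nonneg _) M.one_le_p]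

theorem llg_power (hd : d = 2 ∨ d = 3) {x : E d} (hx : x ∈ Ω.carrier) :
    inner ℝ (drive Ω M L s t x) (mZJ Ω s t x) +
        inner ℝ (Ω.divM (fun y => exch M s t y • Ω.gradV (s.m t) y) x) (mZJ Ω s t x) =
      M.τ * ‖mZJ Ω s t x‖ ^ 2 + M.hc (s.F t x) (s.θ t x) * ‖mZJ Ω s t x‖ := by
  obtain ⟨e, he, h⟩ := hs.llg t ht x hx
  rw [← inner_add_left, ← h, inner_sub_left, inner_add_left, inner_smul_left, inner_smul_left,
    inner_smul_left, inner_cross_self hd, inner_of_mem_Dir he, real_inner_self_eq_norm_sq]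
  simp

theorem hyper_normal_normal {x : E d} (hx : x ∈ Ω.bdry) (i : Fin d) :
    ∑ j, ∑ k, hyper Ω M s t x i j k * Ω.normal x j * Ω.normal x k = 0 := by
  have h1 := hs.hyper_bc t ht x hx i
  have h2 : ∀ i, ∑ k, Ω.gradV (s.m t) x i k * Ω.normal x k = 0 := fun i =>
    congrArg (fun a : E d => a i) (hs.neumann_m t ht x hx)
  have e : ∀ j, ∑ k, hyper Ω M s t x i j k * Ω.normal x j * Ω.normal x k =
      M.ν₂ * frob3 (Ω.grad2 (s.v t) x) ^ (M.p - 2) *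
        ∑ k, Ω.grad2 (s.v t) x i j k * Ω.normal x j * Ω.normal x k +
      exch M s t x / 2 * (s.m t x j * Ω.normal x j *
        ∑ k, Ω.gradV (s.m t) x i k * Ω.normal x k - s.m t x i * Ω.normal x j *
        ∑ k, Ω.gradV (s.m t) x j k * Ω.normal x k) := by
    intro j
    simp only [Finset.mul_sum, ← Finset.sum_sub_distrib, ← Finset.sum_add_distrib]
    refine Finset.sum_congr rfl fun k _ => ?_
    simp only [hyper, hyperH, hyperS, Pi.add_apply, Pi.smul_apply, smul_eq_mul]
    ring
  simp only [e, h2, mul_zero, sub_zero, add_zero, ← Finset.mul_sum, h1]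

theorem traction_power {x : E d} (hx : x ∈ Ω.bdry) :
    inner ℝ (mulV (stress Ω M L s t x) (Ω.normal x) -
        Ω.surfDiv (fun y => tenMulV (hyper Ω M s t y) (Ω.normal y)) x) (s.v t x) =
      inner ℝ (L.k t x) (s.v t x) - M.νb * ‖s.v t x‖ ^ M.p := by
  rw [← hs.traction t ht x hx, inner_add_left, tangential]
  generalize mulV (stress Ω M L s t x) (Ω.normal x) -
    Ω.surfDiv (fun y => tenMulV (hyper Ω M s t y) (Ω.normal y)) x = w
  rw [inner_sub_left, inner_smul_left, inner_smul_left,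
    real_inner_comm (s.v t x) (Ω.normal x), hs.impermeable t ht x hx,
    real_inner_self_eq_norm_sq]
  simp only [conj_trivial, mul_assoc, rpow_sub_two_mul_sq (norm_nonneg _) M.one_le_p]
  ring

theorem thermal_stress_symm (hM : M.ThermalFrameIndifferent) {x : E d} (hx : x ∈ Ω.closed)
    (i j : Fin d) :
    (((s.F t x).det)⁻¹ • (zetaF M s t x * (s.F t x)ᵀ)) i j =
      (((s.F t x).det)⁻¹ • (zetaF M s t x * (s.F t x)ᵀ)) j i := by
  have h1 := (hasFDerivAt_left (hs.differentiableAt_zeta ht hx)).differentiableAt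
  simp only [Matrix.smul_apply]
  congr 1
  exact symm_of_frameIndifferent h1 (fun Q hQ => hM Q hQ _ _ _ (hs.det_pos t ht x hx)
    (hs.θ_nonneg t ht x hx)) i j

end IsSmoothSolution

end Magneto

namespace Magneto

open SmoothDomain

namespace IsSmoothSolution

section Densities

variable {d : ℕ} {Ω : SmoothDomain d} {M : Material d} {L : Loads d} {s : Fields d} {T : ℝ}
variable (hs : IsSmoothSolution Ω M L s T)
include hs

theorem joint_kinetic : ContDiffOn ℝ 1 (fun q : ℝ × E d => s.ρ q.1 q.2 / 2 * ‖s.v q.1 q.2‖ ^ 2)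
    (Ioo 0 T ×ˢ Ω.closed) :=
  ((contDiffOn_infty.1 hs.smooth_ρ 1).div_const 2).mul
    ((contDiffOn_infty.1 hs.smooth_v 1).norm_sq ℝ)

theorem joint_zeeman : ContDiffOn ℝ 1 (fun q : ℝ × E d => inner ℝ (L.hext q.1 q.2) (s.m q.1 q.2))
    (Ioo 0 T ×ˢ Ω.closed) :=
  hs.smooth_hext.inner ℝ (contDiffOn_infty.1 hs.smooth_m 1)

theorem joint_demag : ContDiffOn ℝ 1
    (fun q : ℝ × E d => inner ℝ (s.m q.1 q.2) (Ω.grad (s.u q.1) q.2)) (Ioo 0 T ×ˢ Ω.closed) :=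
  (contDiffOn_infty.1 hs.smooth_m 1).inner ℝ (contDiffOn_infty.1 hs.contDiffOn_grad_u 1)

variable {t : ℝ} (ht : t ∈ Ioo 0 T)
include ht

theorem continuousOn_deriv_hext :
    ContinuousOn (fun x => deriv (fun r => L.hext r x) t) Ω.closed :=
  (contDiffOn_slice (contDiffOn_deriv_time (m := 0) hs.smooth_hext (by simp)) ht).continuousOn

theorem continuousOn_deriv_m :
    ContinuousOn (fun x => deriv (fun r => s.m r x) t) Ω.closed :=
  (contDiffOn_slice (contDiffOn_deriv_time (m := 0) hs.smooth_m (by simp)) ht).continuousOn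

omit hs ht in
theorem energyDensity_eq (x : E d) : energyDensity Ω M L s t x =
    s.ρ t x / 2 * ‖s.v t x‖ ^ 2 + storedDensity Ω M s t x -
      M.μ₀ * inner ℝ (L.hext t x) (s.m t x) - M.μ₀ * inner ℝ (s.m t x) (Ω.grad (s.u t) x) := by
  rw [energyDensity, storedDensity, hField, inner_add_left, real_inner_comm (s.m t x) (Ω.grad _ _)]
  ring

theorem integrableOn_energyDensity : IntegrableOn (energyDensity Ω M L s t) Ω.carrier := by
  refine Ω.integrableOn_carrier (ContinuousOn.congr ?_ fun x _ => energyDensity_eq x)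
  exact (((contDiffOn_slice hs.joint_kinetic ht).continuousOn.add
    (contDiffOn_slice hs.joint_storedDensity ht).continuousOn).sub
    ((contDiffOn_slice hs.joint_zeeman ht).continuousOn.const_mul M.μ₀)).sub
    ((contDiffOn_slice hs.joint_demag ht).continuousOn.const_mul M.μ₀)

theorem energy_eq : energy Ω M L s t =
    (∫ x in Ω.carrier, s.ρ t x / 2 * ‖s.v t x‖ ^ 2) + (∫ x in Ω.carrier, storedDensity Ω M s t x) -
      M.μ₀ * (∫ x in Ω.carrier, inner ℝ (L.hext t x) (s.m t x)) -
      M.μ₀ / 2 * ∫ x in Ω.carrier, inner ℝ (s.m t x) (Ω.grad (s.u t) x) := by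
  have h1 := Ω.integrableOn_carrier (contDiffOn_slice hs.joint_kinetic ht).continuousOn
  have h2 := Ω.integrableOn_carrier (contDiffOn_slice hs.joint_storedDensity ht).continuousOn
  have h3 :=
    (Ω.integrableOn_carrier (contDiffOn_slice hs.joint_zeeman ht).continuousOn).const_mul M.μ₀
  have h4 :=
    (Ω.integrableOn_carrier (contDiffOn_slice hs.joint_demag ht).continuousOn).const_mul M.μ₀
  rw [energy, hs.integral_demag ht]
  simp only [energyDensity_eq]
  rw [integral_sub ?_ h4, integral_sub ?_ h3, integral_add h1 h2, integral_const_mul,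
    integral_const_mul]
  · ring
  · exact h1.add h2
  · exact (h1.add h2).sub h3

theorem integrable_demag_energy : Integrable fun x => M.μ₀ / 2 * ‖gradient (s.u t) x‖ ^ 2 :=
  ((memLp_two_iff_integrable_sq_norm (hs.u_energy t ht).1).1 (hs.u_energy t ht)).const_mul _

end Densities

variable {n : ℕ} {Ω : SmoothDomain (n + 1)} {M : Material (n + 1)} {L : Loads (n + 1)}
  {s : Fields (n + 1)} {T : ℝ} (hs : IsSmoothSolution Ω M L s T) {t : ℝ} (ht : t ∈ Ioo 0 T)
include hs ht

/-- The time derivative of the energy. -/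
theorem hasDerivAt_energy : HasDerivAt (energy Ω M L s)
    ((∫ x in Ω.carrier,
      (Ω.conv (s.v t x) (fun q => s.ρ q.1 q.2 / 2 * ‖s.v q.1 q.2‖ ^ 2) t x +
        s.ρ t x / 2 * ‖s.v t x‖ ^ 2 * Ω.divV (s.v t) x +
        (Ω.conv (s.v t x) (fun q => storedDensity Ω M s q.1 q.2) t x +
        storedDensity Ω M s t x * Ω.divV (s.v t) x) -
        M.μ₀ * inner ℝ (hField Ω L s t x) (deriv (fun r => s.m r x) t))) -
      M.μ₀ * ∫ x in Ω.carrier, inner ℝ (deriv (fun r => L.hext r x) t) (s.m t x)) t := by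
  have hmeas := Ω.isOpen_carrier.measurableSet
  have h1 := hasDerivAt_integral_time hs.joint_kinetic ht
  have h2 := hasDerivAt_integral_time hs.joint_storedDensity ht
  have h3 := hasDerivAt_integral_time hs.joint_zeeman ht
  have h4 := hasDerivAt_integral_time hs.joint_demag ht
  have he : energy Ω M L s =ᶠ[𝓝 t] fun r =>
      (∫ x in Ω.carrier, s.ρ r x / 2 * ‖s.v r x‖ ^ 2) +
      (∫ x in Ω.carrier, storedDensity Ω M s r x) -
      M.μ₀ * (∫ x in Ω.carrier, inner ℝ (L.hext r x) (s.m r x)) -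
      M.μ₀ / 2 * ∫ x in Ω.carrier, inner ℝ (s.m r x) (Ω.grad (s.u r) x) := by
    filter_upwards [isOpen_Ioo.mem_nhds ht] with r hr using hs.energy_eq hr
  refine ((((h1.add h2).sub (h3.const_mul M.μ₀)).sub
    (h4.const_mul (M.μ₀ / 2))).congr_of_eventuallyEq he).congr_deriv ?_
  have hv1 := contDiffOn_infty.1 (hs.slice_v ht) 1
  have hm1 := contDiffOn_infty.1 hs.smooth_m 1
  have hu1 := contDiffOn_infty.1 hs.contDiffOn_grad_u 1
  have hK := integral_deriv_eq_integral_conv hs.joint_kinetic ht hv1 (hs.impermeable t ht)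
  have hW := integral_deriv_eq_integral_conv hs.joint_storedDensity ht hv1 (hs.impermeable t ht)
  have hdm := hs.continuousOn_deriv_m ht
  have hm := (hs.slice_m ht).continuousOn
  have hu := (contDiffOn_slice hu1 ht).continuousOn
  have hdu : ContinuousOn (fun x => deriv (fun r => Ω.grad (s.u r) x) t) Ω.closed :=
    (contDiffOn_slice (contDiffOn_deriv_time (m := 0) hu1 (by simp)) ht).continuousOn
  have iA1 := Ω.integrableOn_carrier ((hs.continuousOn_deriv_hext ht).inner hm)
  have iA2 := Ω.integrableOn_carrier ((contDiffOn_slice hs.smooth_hext ht).continuousOn.inner hdm)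
  have iB1 := Ω.integrableOn_carrier (hm.inner hdu)
  have iB2 := Ω.integrableOn_carrier (hdm.inner hu)
  have hA : ∫ x in Ω.carrier, deriv (fun r => inner ℝ (L.hext r x) (s.m r x)) t =
      (∫ x in Ω.carrier, inner ℝ (L.hext t x) (deriv (fun r => s.m r x) t)) +
      ∫ x in Ω.carrier, inner ℝ (deriv (fun r => L.hext r x) t) (s.m t x) := by
    rw [← integral_add iA2 iA1]
    refine setIntegral_congr_fun hmeas fun x hx => ?_
    have hx' := Ω.carrier_subset_closed hx
    exact ((hasDerivAt_time hs.smooth_hext ht hx').differentiableAt.hasDerivAt.inner ℝ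
      (hasDerivAt_time hm1 ht hx').differentiableAt.hasDerivAt).deriv
  have hB : ∫ x in Ω.carrier, deriv (fun r => inner ℝ (s.m r x) (Ω.grad (s.u r) x)) t =
      2 * ∫ x in Ω.carrier, inner ℝ (deriv (fun r => s.m r x) t) (Ω.grad (s.u t) x) := by
    have h5 := hs.integral_inner_deriv_grad_u ht
    rw [two_mul]
    nth_rewrite 1 [← h5]
    rw [← integral_add iB1 iB2]
    refine setIntegral_congr_fun hmeas fun x hx => ?_
    have hx' := Ω.carrier_subset_closed hx
    exact ((hasDerivAt_time hm1 ht hx').differentiableAt.hasDerivAt.inner ℝ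
      (hasDerivAt_time hu1 ht hx').differentiableAt.hasDerivAt).deriv
  have hH : ∫ x in Ω.carrier, inner ℝ (hField Ω L s t x) (deriv (fun r => s.m r x) t) =
      (∫ x in Ω.carrier, inner ℝ (L.hext t x) (deriv (fun r => s.m r x) t)) +
      ∫ x in Ω.carrier, inner ℝ (deriv (fun r => s.m r x) t) (Ω.grad (s.u t) x) := by
    rw [← integral_add iA2 iB2]
    refine integral_congr_ae (Eventually.of_forall fun x => ?_)
    simp only [hField, inner_add_left]
    rw [real_inner_comm (Ω.grad (s.u t) x)]
  have hdiv := continuousOn_divV hv1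
  have iK : IntegrableOn (fun x =>
      Ω.conv (s.v t x) (fun q => s.ρ q.1 q.2 / 2 * ‖s.v q.1 q.2‖ ^ 2) t x +
        s.ρ t x / 2 * ‖s.v t x‖ ^ 2 * Ω.divV (s.v t) x) Ω.carrier :=
    Ω.integrableOn_carrier ((continuousOn_conv hs.joint_kinetic ht hv1.continuousOn).add
      ((contDiffOn_slice hs.joint_kinetic ht).continuousOn.mul hdiv))
  have iW : IntegrableOn (fun x =>
      Ω.conv (s.v t x) (fun q => storedDensity Ω M s q.1 q.2) t x +
        storedDensity Ω M s t x * Ω.divV (s.v t) x) Ω.carrier :=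
    Ω.integrableOn_carrier ((continuousOn_conv hs.joint_storedDensity ht hv1.continuousOn).add
      ((contDiffOn_slice hs.joint_storedDensity ht).continuousOn.mul hdiv))
  have iH := (Ω.integrableOn_carrier
    ((hs.slice_hField ht).continuousOn.inner hdm)).const_mul M.μ₀
  rw [hA, hB, hK, hW, integral_sub ?_ iH, integral_const_mul, hH, integral_add iK iW]
  · ring
  · exact iK.add iW

/-- The energy balance in which the thermal stress works on the full velocity gradient. -/
theorem energyBalance_gradV (hd : n + 1 = 2 ∨ n + 1 = 3) :
    EnergyBalance Ω M L s (Ω.gradV (s.v t)) t := by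
  have hmeas := Ω.isOpen_carrier.measurableSet
  have hp : 0 ≤ M.p := zero_le_one.trans M.one_le_p
  have hv2 := contDiffOn_infty.1 (hs.slice_v ht) 2
  have hv1 := contDiffOn_infty.1 (hs.slice_v ht) 1
  have hr1 := contDiffOn_infty.1 (hs.slice_mZJ ht) 1
  have hA := fun i j => (hs.slice_gradV ht i j).continuousOn
  have hS := fun i j => contDiffOn_matrix.1 (hs.slice_stressTKSD ht) i j
  have hX : ∀ i j, ContDiffOn ℝ 1 (fun x => (exch M s t x • Ω.gradV (s.m t) x) i j) Ω.closed :=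
    fun i j => (hs.slice_exch ht).mul (contDiffOn_infty.1 (hs.slice_gradM ht i j) 1)
  obtain ⟨hbc, hV⟩ := integral_virtual_power hS (hs.slice_hyper ht) hv2
    fun x hx i => hs.hyper_normal_normal ht hx i
  have hN := integral_divM hX hr1
  -- integrability of the powers
  have i1 : IntegrableOn (fun x => inner ℝ (Ω.divM (stress Ω M L s t) x) (s.v t x)) Ω.carrier :=
    Ω.integrableOn_carrier ((contDiffOn_divM (m := 0) (hs.slice_stress ht)
      (by norm_num)).continuousOn.inner hv1.continuousOn)
  have i2 : IntegrableOn (fun x => ddot (stressT Ω M s t x + stressK Ω M s t x +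
      stressS Ω M L s t x) (Ω.gradV (s.v t) x)) Ω.carrier :=
    Ω.integrableOn_carrier (continuousOn_ddot (fun i j => (contDiffOn_matrix.1
      (((hs.stressT_C1 t ht).add (hs.slice_stressK ht)).add (hs.stressS_C1 t ht)) i j).continuousOn)
      hA)
  have i3 : IntegrableOn (fun x => dddot (hyperS Ω M s t x) (Ω.grad2 (s.v t) x)) Ω.carrier :=
    Ω.integrableOn_carrier (continuousOn_dddot
      (fun i j k => (contDiffOn_tensor.1 (hs.hyperS_C2 t ht) i j k).continuousOn)
      (hs.continuousOn_grad2 ht))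
  have i4 : IntegrableOn (fun x => ddot (exch M s t x • Ω.gradV (s.m t) x)
      (Ω.gradV (mZJ Ω s t) x)) Ω.carrier :=
    Ω.integrableOn_carrier (continuousOn_ddot (fun i j => (hX i j).continuousOn)
      fun i j => (contDiffOn_gradV (m := 0) hr1 (by norm_num) i j).continuousOn)
  have i5 : IntegrableOn (fun x => inner ℝ (drive Ω M L s t x) (mZJ Ω s t x)) Ω.carrier :=
    Ω.integrableOn_carrier ((hs.continuousOn_drive ht).inner hr1.continuousOn)
  have i7 : IntegrableOn (fun x => ddot (((s.F t x).det)⁻¹ • (zetaF M s t x * (s.F t x)ᵀ))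
      (Ω.gradV (s.v t) x)) Ω.carrier :=
    Ω.integrableOn_carrier (continuousOn_ddot (hs.continuousOn_thermal_stress ht) hA)
  have i8 : IntegrableOn (fun x => inner ℝ (((s.F t x).det)⁻¹ • zetaM M s t x) (mDot Ω s t x))
      Ω.carrier :=
    Ω.integrableOn_carrier (((hs.continuousOn_inv_det ht).smul (hs.continuousOn_zetaM ht)).inner
      (hs.slice_mDot ht).continuousOn)
  have i9 : IntegrableOn (fun x => inner ℝ
      (Ω.divM (fun y => exch M s t y • Ω.gradV (s.m t) y) x) (mZJ Ω s t x)) Ω.carrier :=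
    Ω.integrableOn_carrier ((contDiffOn_divM (m := 0) hX (by norm_num)).continuousOn.inner
      hr1.continuousOn)
  have iD : IntegrableOn (fun x => M.ν₁ * frob (strainRate Ω s t x) ^ M.p) Ω.carrier :=
    Ω.integrableOn_carrier (((hs.continuousOn_frob_strainRate ht).rpow_const
      fun _ _ => Or.inr hp).const_mul M.ν₁)
  have iH : IntegrableOn (fun x => M.ν₂ * frob3 (Ω.grad2 (s.v t) x) ^ M.p) Ω.carrier :=
    Ω.integrableOn_carrier (((hs.continuousOn_frob3_grad2 ht).rpow_const
      fun _ _ => Or.inr hp).const_mul M.ν₂)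
  have iC : IntegrableOn (fun x => M.μ₀ * inner ℝ (deriv (fun r => L.hext r x) t) (s.m t x))
      Ω.carrier :=
    (Ω.integrableOn_carrier ((hs.continuousOn_deriv_hext ht).inner
      (hs.slice_m ht).continuousOn)).const_mul M.μ₀
  set P : E (n + 1) → ℝ := fun x =>
      Ω.conv (s.v t x) (fun q => s.ρ q.1 q.2 / 2 * ‖s.v q.1 q.2‖ ^ 2) t x +
        s.ρ t x / 2 * ‖s.v t x‖ ^ 2 * Ω.divV (s.v t) x +
        (Ω.conv (s.v t x) (fun q => storedDensity Ω M s q.1 q.2) t x +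
        storedDensity Ω M s t x * Ω.divV (s.v t) x) -
        M.μ₀ * inner ℝ (hField Ω L s t x) (deriv (fun r => s.m r x) t) with hP
  have hdiv := continuousOn_divV hv1
  have iP : IntegrableOn P Ω.carrier := Ω.integrableOn_carrier
    ((((continuousOn_conv hs.joint_kinetic ht hv1.continuousOn).add
      ((contDiffOn_slice hs.joint_kinetic ht).continuousOn.mul hdiv)).add
      ((continuousOn_conv hs.joint_storedDensity ht hv1.continuousOn).add
      ((contDiffOn_slice hs.joint_storedDensity ht).continuousOn.mul hdiv))).sub
      (((hs.slice_hField ht).continuousOn.inner (hs.continuousOn_deriv_m ht)).const_mul M.μ₀))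
  have hid : ∀ x ∈ Ω.carrier, P x = _ := fun x hx => hs.power_identity ht hx
  have i6 : IntegrableOn (fun x => s.ρ t x * inner ℝ (L.g t x) (s.v t x)) Ω.carrier := by
    have h := ((((((iP.sub i1).sub i2).sub i3).sub i4).add i5).add i7).add i8
    refine h.congr_fun (fun x hx => ?_) hmeas
    simp only [Pi.add_apply, Pi.sub_apply]
    rw [hid x hx]
    ring
  have hdiss : ∀ x ∈ Ω.carrier, dissRate Ω M s t x = M.ν₁ * frob (strainRate Ω s t x) ^ M.p +
      M.ν₂ * frob3 (Ω.grad2 (s.v t) x) ^ M.p + (inner ℝ (drive Ω M L s t x) (mZJ Ω s t x) +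
      inner ℝ (Ω.divM (fun y => exch M s t y • Ω.gradV (s.m t) y) x) (mZJ Ω s t x)) := by
    intro x hx
    rw [hs.llg_power ht hd hx, dissRate]
    ring
  have idiss : IntegrableOn (dissRate Ω M s t) Ω.carrier :=
    ((iD.add iH).add (i5.add i9)).congr_fun (fun x hx => (hdiss x hx).symm) hmeas
  have ipow : IntegrableOn (powerDensity Ω M L s (Ω.gradV (s.v t)) t) Ω.carrier :=
    ((i6.sub iC).sub i7).sub i8
  -- boundary terms
  have hvb : ContinuousOn (s.v t) Ω.bdry := hv1.continuousOn.mono Ω.bdry_subset_closed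
  have hνc : ContinuousOn (fun x => M.νb * ‖s.v t x‖ ^ M.p) Ω.bdry :=
    (hvb.norm.rpow_const fun _ _ => Or.inr hp).const_mul M.νb
  have hkc : ContinuousOn (fun x => inner ℝ (L.k t x) (s.v t x)) Ω.bdry := by
    refine (hbc.add hνc).congr fun x hx => ?_
    have := hs.traction_power ht hx
    rw [stress] at this
    simp only [Pi.add_apply]
    rw [this]
    ring
  have iν := Ω.integrable_surf hνc
  have ik := Ω.integrable_surf hkc
  refine ⟨hs.integrableOn_energyDensity ht, hs.integrable_demag_energy ht, idiss, ipow, iν, ik, _,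
    hs.hasDerivAt_energy ht, ?_⟩
  -- integrated identities
  have hB : ∫ x, inner ℝ (mulV (stress Ω M L s t x) (Ω.normal x) -
        Ω.surfDiv (fun y => tenMulV (hyper Ω M s t y) (Ω.normal y)) x) (s.v t x) ∂Ω.surf =
      (∫ x, inner ℝ (L.k t x) (s.v t x) ∂Ω.surf) - ∫ x, M.νb * ‖s.v t x‖ ^ M.p ∂Ω.surf := by
    rw [← integral_sub ik iν, surf]
    exact setIntegral_congr_fun Ω.isCompact_bdry.measurableSet fun x hx => hs.traction_power ht hx
  have hB0 : ∫ x, inner ℝ (mulV (exch M s t x • Ω.gradV (s.m t) x) (Ω.normal x)) (mZJ Ω s t x)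
      ∂Ω.surf = 0 := by
    rw [surf]
    refine setIntegral_eq_zero_of_forall_eq_zero fun x hx => ?_
    have h0 : mulV (exch M s t x • Ω.gradV (s.m t) x) (Ω.normal x) = 0 := by
      have h := hs.neumann_m t ht x hx
      have : mulV (exch M s t x • Ω.gradV (s.m t) x) (Ω.normal x) =
          exch M s t x • mulV (Ω.gradV (s.m t) x) (Ω.normal x) := by
        ext i; simp [mulV_apply, Finset.mul_sum, mul_assoc]
      rw [this, h, smul_zero]
    rw [h0, inner_zero_left]
  have eS : ∫ x in Ω.carrier, ddot (stressT Ω M s t x + stressK Ω M s t x +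
      stressS Ω M L s t x + stressD Ω M s t x) (Ω.gradV (s.v t) x) =
      (∫ x in Ω.carrier, ddot (stressT Ω M s t x + stressK Ω M s t x +
      stressS Ω M L s t x) (Ω.gradV (s.v t) x)) +
      ∫ x in Ω.carrier, M.ν₁ * frob (strainRate Ω s t x) ^ M.p := by
    rw [← integral_add i2 iD]
    exact integral_congr_ae (Eventually.of_forall fun x => by
      simp only [ddot_add_left _ (stressD Ω M s t x), ddot_stressD])
  have eG : ∫ x in Ω.carrier, dddot (hyper Ω M s t x) (Ω.grad2 (s.v t) x) =
      (∫ x in Ω.carrier, M.ν₂ * frob3 (Ω.grad2 (s.v t) x) ^ M.p) +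
      ∫ x in Ω.carrier, dddot (hyperS Ω M s t x) (Ω.grad2 (s.v t) x) := by
    rw [← integral_add iH i3]
    exact integral_congr_ae (Eventually.of_forall fun x => by
      simp only [hyper, dddot_add_left, dddot_hyperH])
  have eV : ∫ x in Ω.carrier, inner ℝ (Ω.divM (stress Ω M L s t) x) (s.v t x) = _ := hV
  have eB := hB
  simp only [stress] at eB
  rw [eB, eS, eG] at eV
  rw [hB0] at hN
  have eD : ∫ x in Ω.carrier, dissRate Ω M s t x = _ := setIntegral_congr_fun hmeas hdiss
  rw [integral_add ?_ ?_, integral_add iD iH, integral_add i5 i9] at eD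
  rotate_left
  · exact iD.add iH
  · exact i5.add i9
  have eP : ∫ x in Ω.carrier, P x = _ := setIntegral_congr_fun hmeas hid
  rw [integral_sub ?_ i8, integral_sub ?_ i7, integral_add ?_ i6, integral_sub ?_ i5,
    integral_add ?_ i4, integral_add ?_ i3, integral_add i1 i2] at eP
  rotate_left
  · exact i1.add i2
  · exact (i1.add i2).add i3
  · exact ((i1.add i2).add i3).add i4
  · exact (((i1.add i2).add i3).add i4).sub i5
  · exact ((((i1.add i2).add i3).add i4).sub i5).add i6
  · exact (((((i1.add i2).add i3).add i4).sub i5).add i6).sub i7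
  have eW : ∫ x in Ω.carrier, powerDensity Ω M L s (Ω.gradV (s.v t)) t x = _ :=
    (integral_sub ((i6.sub iC).sub i7) i8).trans (congrArg (· - _)
      ((integral_sub (i6.sub iC) i7).trans (congrArg (· - _) (integral_sub i6 iC))))
  rw [eD, eP, eW, eV, hN, integral_const_mul M.μ₀]
  ring

end IsSmoothSolution

end Magneto

theorem mainTheorem2 {d : ℕ} (hd : d = 2 ∨ d = 3) (Ω : Magneto.SmoothDomain d)
    (M : Magneto.Material d) (L : Magneto.Loads d) (s : Magneto.Fields d) (T : ℝ)
    (hs : Magneto.IsSmoothSolution Ω M L s T) (t : ℝ) (ht : t ∈ Set.Ioo 0 T) :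
    (M.ThermalFrameIndifferent →
      Magneto.EnergyBalance Ω M L s (Magneto.strainRate Ω s t) t) ∧
    Magneto.EnergyBalance Ω M L s (Ω.gradV (s.v t)) t := by
  obtain ⟨n, rfl⟩ : ∃ n, d = n + 1 := ⟨d - 1, by omega⟩
  have h := hs.energyBalance_gradV ht hd
  refine ⟨fun hM => ?_, h⟩
  have e : ∀ x ∈ Ω.carrier, Magneto.powerDensity Ω M L s (Ω.gradV (s.v t)) t x =
      Magneto.powerDensity Ω M L s (Magneto.strainRate Ω s t) t x := by
    intro x hx
    rw [Magneto.powerDensity, Magneto.powerDensity, Magneto.strainRate, Magneto.ddot_sym_of_symm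
      (hs.thermal_stress_symm ht hM (Ω.carrier_subset_closed hx))]
  have hmeas := Ω.isOpen_carrier.measurableSet
  obtain ⟨h1, h2, h3, h4, h5, h6, E', h7, h8⟩ := h
  refine ⟨h1, h2, h3, h4.congr_fun e hmeas, h5, h6, E', h7, ?_⟩
  rw [h8, MeasureTheory.setIntegral_congr_fun hmeas e]
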